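/- Let $q=2^h$ with $h\ge 4$, let $k\ge 2$, and let $H_\infty=\mathrm{PG}(2k-1,q)$ be a hyperplane of $\mathrm{PG}(2k,q)$. Points outside $H_\infty$ are called affine. Let $\mathcal Q$ be a set of $q^k$ affine points such that the set $D$ of directions determined by $\mathcal Q$ (the points $P_1P_2\cap H_\infty$ with $P_1\ne P_2$ in $\mathcal Q$) has size $q^k-1$, and such that every line has $0$, $1$, $3$ or $q-1$ points in common with $D$. An $\mathbb F_2$-linear set of $H_\infty=\mathrm{PG}(V)$ is a set $L_U=\{\langle u\rangle_{\mathbb F_q} : u\in U\setminus\{0\}\}$ with $U$ an $\mathbb F_2$-subspace of $V$; its rank is $\dim_{\mathbb F_2}U$, and it is scattered if $\dim_{\mathbb F_2}(U\cap\langle v\rangle_{\mathbb F_q})\le 1$ for all $v \in V$. A scattered $\mathbb F_2$-linear set $D$ of $H_\infty$ of rank $hk$ is of pseudoregulus type with transversal spaces $T_0\neq T_\infty$ if there is a set of $\frac{q^k-1}{q-1}$ pairwise disjoint lines of $H_\infty$, each with exactly $q-1$ points in $D$, such that $T_0$ and $T_\infty$ are exactly the $(k-1)$-dimensional subspaces of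 $H_\infty$ that are disjoint from $D$ and meet all of these lines. Then $D$ is a scattered $\mathbb F_2$-linear set of rank $hk$ of pseudoregulus type, and for its transversal spaces $T_0,T_\infty$ the following hold. (a) There is a Desarguesian $(k-1)$-spread $\mathcal S$ of $H_\infty$ (one obtained by field reduction from the points of $\mathrm{PG}(1,q^k)$) with $T_0,T_\infty\in\mathcal S$ such that every other element of $\mathcal S$ has exactly one point in common with $D$. (b) For every such $\mathcal S$, let $\mathcal P(\mathcal S)$ be the André/Bruck--Bose plane: its points are the affine points and the elements of $\mathcal S$, its lines are the $k$-spaces spanned by an element of $\mathcal S$ and an affine point, together with the line $\ell_\infty$ consisting of the elements of $\mathcal S$, and incidence is containment. Then $\mathcal P(\mathcal S)\cong\mathrm{PG}(2,q^k)$, and $\mathcal H=\mathcal Q\cup\{T_0,T_\infty\}$ is a translation hyperoval of $\mathcal P(\mathcal S)$ with respect to $\ell_\infty$. That is, $\mathcal H$ consists of $q^k+2$ points, no three on a line of $\mathcal P(\mathcal S)$; $\ell_\infty$ meets $\mathcal H$ in exactly two points; and the group of the elations of $\mathcal P(\mathcal S)$ with axis $\ell_\infty$ that map $\mathcal H$ onto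 itself acts transitively on the affine points of $\mathcal H$. -/

import Mathlib

open Module
open scoped LinearAlgebra.Projectivization

universe u v

/-! ### Incidence structures, hyperovals, elations -/

namespace Incidence

/-- An isomorphism of point-line incidence structures. -/
structure Iso (P L P' L' : Type*) [Membership P L] [Membership P' L'] where
  onPoints : P ≃ P'
  onLines : L ≃ L'
  mem_iff : ∀ (p : P) (l : L), onPoints p ∈ onLines l ↔ p ∈ l

/-- A collineation is an automorphism of the incidence structure. -/
abbrev Collineation (P L : Type*) [Membership P L] := Iso P L P L

variable {P L : Type*} [Membership P L]

/-- `g` is an elation with axis `a` (the identity included): it fixes every point of the axis and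
every line through some centre `c`, and the centre lies on the axis. -/
def Collineation.IsElation (g : Collineation P L) (a : L) : Prop :=
  (∀ p : P, p ∈ a → g.onPoints p = p) ∧
    ∃ c : P, c ∈ a ∧ ∀ m : L, c ∈ m → g.onLines m = m

variable (L) in
/-- No three distinct points of `A` are on a common line. -/
def IsArc (A : Set P) : Prop :=
  ∀ x ∈ A, ∀ y ∈ A, ∀ z ∈ A, x ≠ y → x ≠ z → y ≠ z → ∀ l : L, ¬ (x ∈ l ∧ y ∈ l ∧ z ∈ l)

variable (L) in
/-- A hyperoval of a projective plane of order `n` is an `(n+2)`-arc. -/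
def IsHyperoval (n : ℕ) (A : Set P) : Prop :=
  A.ncard = n + 2 ∧ IsArc L A

/-- `A` is a translation hyperoval (of a plane of order `n`) with respect to the line `a`:
`a` is a bisecant of `A`, and the group of the elations with axis `a` that map `A` onto itself
acts transitively on the points of `A` that are not on `a`. -/
def IsTranslationHyperoval (n : ℕ) (A : Set P) (a : L) : Prop :=
  IsHyperoval L n A ∧
  {p ∈ A | p ∈ a}.ncard = 2 ∧
  ∀ x ∈ A, x ∉ a → ∀ y ∈ A, y ∉ a →
    ∃ g : Collineation P L, g.IsElation a ∧ g.onPoints '' A = A ∧ g.onPoints x = y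

end Incidence

/-! ### The projective plane over a field -/

/-- The lines of the projective plane `PG(2, K)`; its points are `ℙ K (Fin 3 → K)`. -/
def PlaneLine (K : Type*) [Field K] :=
  {M : Submodule K (Fin 3 → K) // finrank K M = 2}

instance (K : Type*) [Field K] : Membership (ℙ K (Fin 3 → K)) (PlaneLine K) where
  mem l p := p.submodule ≤ l.1

/-! ### Subspaces of projective spaces

A projective subspace of `PG(V)` of dimension `d` is given by the vector subspace of dimension
`d + 1` that it comes from. -/

section Projective

variable {F : Type u} [Field F] {V : Type v} [AddCommGroup V] [Module F V]

/-- The points of `PG(V)` in the projective subspace given by `U`. -/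
def pointsOf (U : Submodule F V) : Set (ℙ F V) := {P | P.submodule ≤ U}

/-- The directions determined by `Q`: the points in which the hyperplane `H` meets the lines
joining two different points of `Q`. -/
def directions (H : Submodule F V) (Q : Set (ℙ F V)) : Set (ℙ F V) :=
  {R | R ∈ pointsOf H ∧ ∃ P₁ ∈ Q, ∃ P₂ ∈ Q, P₁ ≠ P₂ ∧
    R ∈ pointsOf (P₁.submodule ⊔ P₂.submodule)}

/-! ### Linear sets of pseudoregulus type -/

/-- The `K₀`-linear set `L_U = {⟨u⟩ | u ∈ U \ {0}}`. -/
def linearSet {K₀ : Subfield F} (U : Submodule K₀ V) : Set (ℙ F V) :=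
  {P | ∃ (u : V) (hu : u ≠ 0), u ∈ U ∧ P = Projectivization.mk F u hu}

/-- `U` is scattered: every point of `PG(V)`, as a `K₀`-subspace, meets `U` in a `K₀`-subspace
of dimension at most one. -/
def IsScattered {K₀ : Subfield F} (U : Submodule K₀ V) : Prop :=
  ∀ P : ℙ F V, finrank K₀ ↥(U ⊓ P.submodule.restrictScalars K₀) ≤ 1

/-- `R` is a set of `(q^k - 1)/(q - 1)` pairwise disjoint lines of `PG(H)`, `q = |F|`, each of
which has `(q - 1)/(q₀ - 1)` points in common with `D`, `q₀ = |K₀|`. -/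
structure IsPseudoregulus (K₀ : Subfield F) (k : ℕ) (H : Submodule F V) (D : Set (ℙ F V))
    (R : Set (Submodule F V)) : Prop where
  isLine : ∀ s ∈ R, s ≤ H ∧ finrank F s = 2
  card_lines : R.ncard * (Nat.card F - 1) = Nat.card F ^ k - 1
  disjoint : ∀ s ∈ R, ∀ t ∈ R, s ≠ t → Disjoint s t
  card_inter : ∀ s ∈ R, (D ∩ pointsOf s).ncard * (Nat.card K₀ - 1) = Nat.card F - 1

/-- The `(k-1)`-dimensional projective subspaces of `PG(H)` that are disjoint from `D` and meet
every line of `R`. -/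
def transversals (k : ℕ) (H : Submodule F V) (D : Set (ℙ F V)) (R : Set (Submodule F V)) :
    Set (Submodule F V) :=
  {T | T ≤ H ∧ finrank F T = k ∧ Disjoint (pointsOf T) D ∧ ∀ s ∈ R, ¬ Disjoint T s}

/-- `D` is a scattered `K₀`-linear set of `PG(H)`, `dim H = 2k`, of rank `k * [F : K₀]`, that is of
pseudoregulus type, and `T₀`, `T₁` are the two transversal spaces to an associated
pseudoregulus. -/
def IsPseudoregulusTypeWith (K₀ : Subfield F) (k : ℕ) (H : Submodule F V) (D : Set (ℙ F V))
    (T₀ T₁ : Submodule F V) : Prop :=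
  (∃ U : Submodule K₀ V, (∀ u ∈ U, u ∈ H) ∧ finrank K₀ U = k * finrank K₀ F ∧
    IsScattered U ∧ D = linearSet U) ∧
  ∃ R : Set (Submodule F V), IsPseudoregulus K₀ k H D R ∧
    T₀ ≠ T₁ ∧ transversals k H D R = {T₀, T₁}

/-! ### Desarguesian spreads and the André/Bruck–Bose plane -/

/-- `S` is a Desarguesian `(n-1)`-spread of `PG(H) = PG(rn-1, F)`: it arises by field reduction from
the points of `PG(r-1, K)` for an extension `K` of `F` of degree `n`. -/
def IsDesarguesianSpread (r n : ℕ) (H : Submodule F V) (S : Set (Submodule F V)) : Prop :=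
  ∃ (K : Type u) (_ : Field K) (_ : Algebra F K), finrank F K = n ∧
    ∃ e : (Fin r → K) ≃ₗ[F] H,
      S = {T | ∃ x : ℙ K (Fin r → K),
        T = (x.submodule.restrictScalars F).map (H.subtype ∘ₗ e.toLinearMap)}

/-- Points of the André/Bruck–Bose plane of the spread `S` of `H`: the points of `PG(V)` outside `H`
and the elements of `S`. -/
inductive BBPoint (H : Submodule F V) (S : Set (Submodule F V)) : Type v
  | affine (P : ℙ F V) (hP : P ∉ pointsOf H) : BBPoint H S
  | infinite (T : Submodule F V) (hT : T ∈ S) : BBPoint H S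

/-- Lines of the André/Bruck–Bose plane of the spread `S` of `H`: the subspaces spanned by an element
of `S` and a point outside `H`, and the line at infinity. -/
inductive BBLine (H : Submodule F V) (S : Set (Submodule F V)) : Type v
  | affine (M : Submodule F V)
      (hM : ∃ T ∈ S, ∃ P : ℙ F V, P ∉ pointsOf H ∧ M = T ⊔ P.submodule) : BBLine H S
  | atInfinity : BBLine H S

/-- Incidence in the André/Bruck–Bose plane is containment; the line at infinity consists of the
elements of `S`. -/
def BBLine.Contains {H : Submodule F V} {S : Set (Submodule F V)} :
    BBLine H S → BBPoint H S → Prop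
  | .affine M _, .affine P _ => P ∈ pointsOf M
  | .affine M _, .infinite T _ => T ≤ M
  | .atInfinity, .affine _ _ => False
  | .atInfinity, .infinite _ _ => True

instance (H : Submodule F V) (S : Set (Submodule F V)) :
    Membership (BBPoint H S) (BBLine H S) where
  mem l p := l.Contains p

/-- The points of the André/Bruck–Bose plane that come from the points of `Q` outside `H`, together
with the points at infinity given by `T₀` and `T₁`. -/
def bbSet (H : Submodule F V) (S : Set (Submodule F V)) (Q : Set (ℙ F V))
    (T₀ T₁ : Submodule F V) : Set (BBPoint H S) :=
  {X | (∃ P hP, X = .affine P hP ∧ P ∈ Q) ∨ (∃ T hT, X = .infinite T hT ∧ (T = T₀ ∨ T = T₁))}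

/-- `S` is a Desarguesian `(k-1)`-spread of `PG(H) = PG(2k-1, F)` that contains `T₀` and `T₁`, and
every other element of `S` has exactly one point in common with `D`. -/
def IsSuitableSpread (k : ℕ) (H : Submodule F V) (D : Set (ℙ F V)) (T₀ T₁ : Submodule F V)
    (S : Set (Submodule F V)) : Prop :=
  IsDesarguesianSpread 2 k H S ∧ T₀ ∈ S ∧ T₁ ∈ S ∧
    ∀ T ∈ S, T ≠ T₀ → T ≠ T₁ → ∃! P : ℙ F V, P ∈ D ∧ P ∈ pointsOf T

end Projective

/-! Write H for the hyperplane at infinity and "line" for a vector plane inside it. A linear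
functional `f` with kernel H turns Q into a set A of q^k vectors with `f = 1`, and D into the set of
the points ⟨a - b⟩ with a ≠ b in A.

From directions to a group. A count over the planes through a secant shows that no three points of A
are collinear. Since |D| = q^k - 1, every point of A then sees every direction exactly once, and a
translate a + E with a in A contains one point of A more than E has directions. A line with three
directions thus gives an affine plane with four points of A, and in characteristic two these form a
parallelogram. Two lines with q - 1 directions never meet, by divisibility in the projective plane
that they would span. Sums along such a line can therefore be reached by a detour over lines with
three directions. Hence A is a coset of an additive group U, which is scattered, has q^k elements
and meets every line in 1, 2, 4 or q elements (`HasSpecialDirections.exists_isSpecialSubgroup`).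

From the group to a normal form. A scattered group in dimension n has at most q^(n/2) elements
(`ScatteredSubgroup.card_sq_le`). Applied to the quotient by some u in U, this bound forces a line
through u that meets U in q elements, a big line; so the big lines partition U \ {0}. A third big
line in the span of two others is the graph of a linear map between them that respects U. These maps
make the ring of the linear maps stabilizing U ∩ s act sharply transitively on its nonzero elements.
The ring is then a field of order q; diagonalizing it gives U ∩ s = {x e₁ + σ(x) e₂}, with the same
σ on every big line s. Independent big lines add up to U = {(x, σ(x))} in F^k × F^k
(`IsSpecialSubgroup.exists_normal_form`). As U is scattered, σ fixes only 0 and 1. The two factors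
are the transversal spaces, and there are no others.

The spread and the plane. Let K be the extension of F of degree k. The map σ extends to an
automorphism τ of K that still fixes only 0 and 1, and H can be identified with K² so that U becomes
{(y, τ(y))}. A one-dimensional K-subspace off the axes meets U in the solutions of τ(y) = c y, of
which exactly one is nonzero. This gives (a). For (b), V is embedded in K³ as the set of the vectors
with last coordinate in F, which identifies the plane with PG(2, K). Two affine points of the
hyperoval on a line through T differ by a nonzero element of U ∩ T; there is none for the two
transversal spaces and exactly one otherwise, so no three points are on a line. The translations by
the elements of U are the required elations. -/

/-! ### The bound for scattered subgroups -/

section ScatteredBound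

variable {F : Type*} [Field F] {W : Type*} [AddCommGroup W] [Module F W]

variable (F) in
/-- An additive subgroup is scattered if it meets every vector line in at most two elements. -/
def ScatteredSubgroup (U : AddSubgroup W) : Prop :=
  ∀ u ∈ U, u ≠ 0 → ∀ c : F, c • u ∈ U → c = 0 ∨ c = 1

theorem card_eq_card_pow_finrank [Finite F] [FiniteDimensional F W] :
    Nat.card W = Nat.card F ^ finrank F W := by
  have := Module.finite_of_finite F (M := W)
  cases nonempty_fintype F
  cases nonempty_fintype W
  rw [Nat.card_eq_fintype_card, Nat.card_eq_fintype_card, Module.card_eq_pow_finrank (K := F)]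

theorem card_dualAnnihilator_mul [Finite F] [FiniteDimensional F W] (p : Submodule F W) :
    Nat.card p.dualAnnihilator * Nat.card F ^ finrank F p = Nat.card F ^ finrank F W := by
  rw [card_eq_card_pow_finrank (F := F) (W := p.dualAnnihilator), ← pow_add, add_comm,
    Subspace.finrank_add_finrank_dualAnnihilator_eq]

-- The count is q^n at u = 0 and q^(n-1) elsewhere. A single formula with an indicator can be summed
-- over a group.
open Classical in
theorem card_mul_sum_dual_apply_eq_zero [Finite F] [FiniteDimensional F W] [Fintype (Dual F W)]
    (u : W) :
    (Nat.card F : ℤ) * ∑ f : Dual F W, (if f u = 0 then 1 else 0) =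
      Nat.card F ^ finrank F W * (1 + (Nat.card F - 1) * (if u = 0 then 1 else 0)) := by
  have h1 : (∑ f : Dual F W, (if f u = 0 then 1 else 0) : ℤ) =
      Nat.card (Submodule.span F {u}).dualAnnihilator := by
    rw [Finset.sum_boole, Nat.card_eq_fintype_card, Fintype.card_subtype]
    congr 2
    ext f
    simp only [Finset.mem_filter, Finset.mem_univ, true_and, Submodule.mem_dualAnnihilator]
    constructor
    · intro h w hw
      obtain ⟨a, rfl⟩ := Submodule.mem_span_singleton.1 hw
      simp [h]
    · exact fun h => h u (Submodule.mem_span_singleton_self u)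
  have h2 := card_dualAnnihilator_mul (Submodule.span F {u})
  rw [h1]
  by_cases hu : u = 0
  · subst hu
    have h0 : finrank F (Submodule.span F {(0 : W)}) = 0 := by simp
    rw [h0, pow_zero, mul_one] at h2
    have h3 : (Nat.card (Submodule.span F {(0 : W)}).dualAnnihilator : ℤ) =
        (Nat.card F : ℤ) ^ finrank F W := by
      exact_mod_cast h2
    rw [h3]; simp; ring
  · rw [finrank_span_singleton hu, pow_one] at h2
    simp only [hu, if_false, mul_zero, add_zero, mul_one]
    rw [mul_comm]; exact_mod_cast h2

-- The common annihilator has codimension equal to the rank of (u, v), which drops below two only if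
-- u = 0, v = 0 or u = v. At u = v = 0 all three indicators are 1, and the last term restores the
-- right value: 1 + 3(q - 1) + (q² - 3q + 2) = q².
open Classical in
theorem card_sq_mul_sum_dual_apply_eq_zero [Finite F] [FiniteDimensional F W]
    [Fintype (Dual F W)] (u v : W)
    (h : u ≠ 0 → v ≠ 0 → u ≠ v → LinearIndependent F ![u, v]) :
    (Nat.card F : ℤ) ^ 2 *
      ∑ f : Dual F W, (if f u = 0 then 1 else 0) * (if f v = 0 then 1 else 0) =
      Nat.card F ^ finrank F W * (1 + (Nat.card F - 1) *
        ((if u = 0 then 1 else 0) + (if v = 0 then 1 else 0) + (if u = v then 1 else 0)) +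
        (Nat.card F ^ 2 - 3 * Nat.card F + 2) * ((if u = 0 then 1 else 0) *
          (if v = 0 then 1 else 0))) := by
  have key := fun w : W => card_mul_sum_dual_apply_eq_zero (F := F) w
  by_cases hu : u = 0
  · subst hu
    have := key v
    simp only [map_zero, if_true, one_mul, pow_two, mul_assoc, this]
    by_cases hv : v = 0
    · subst hv; simp; ring
    · simp [hv, Ne.symm hv]; ring
  by_cases hv : v = 0
  · subst hv
    have := key u
    simp only [map_zero, if_true, mul_one, pow_two, mul_assoc, this]
    simp [hu]; ring
  by_cases huv : u = v
  · subst huv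
    have := key u
    simp only [mul_ite, mul_one, mul_zero, pow_two, mul_assoc]
    have h2 : ∀ f : Dual F W, (if f u = 0 then if f u = 0 then (1 : ℤ) else 0 else 0) =
        if f u = 0 then 1 else 0 := fun f => by split_ifs <;> rfl
    simp only [h2, this]
    simp [hu]; ring
  · have h1 : (∑ f : Dual F W, (if f u = 0 then 1 else 0) * (if f v = 0 then 1 else 0) : ℤ) =
        Nat.card (Submodule.span F (Set.range ![u, v])).dualAnnihilator := by
      have : ∀ f : Dual F W, (if f u = 0 then (1 : ℤ) else 0) * (if f v = 0 then 1 else 0) =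
          if f u = 0 ∧ f v = 0 then 1 else 0 := fun f => by
        by_cases h1 : f u = 0 <;> by_cases h2 : f v = 0 <;> simp [h1, h2]
      simp only [this]
      rw [Finset.sum_boole, Nat.card_eq_fintype_card, Fintype.card_subtype]
      congr 2
      ext f
      simp only [Finset.mem_filter, Finset.mem_univ, true_and, Submodule.mem_dualAnnihilator,
        Matrix.range_cons, Matrix.range_empty, Set.union_empty, Set.singleton_union]
      constructor
      · rintro ⟨h1, h2⟩ w hw
        obtain ⟨a, b, rfl⟩ := Submodule.mem_span_pair.1 hw
        simp [h1, h2]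
      · intro h
        exact ⟨h u (Submodule.subset_span (by simp)), h v (Submodule.subset_span (by simp))⟩
    have h2 := card_dualAnnihilator_mul (Submodule.span F (Set.range ![u, v]))
    rw [finrank_span_eq_card (h hu hv huv), Fintype.card_fin] at h2
    rw [h1]
    simp only [hu, hv, huv, if_false, mul_zero, add_zero, mul_one]
    rw [mul_comm]; exact_mod_cast h2

/-- A scattered additive subgroup of an `n`-dimensional space over a field with `q > 2` elements
has at most `q ^ (n / 2)` elements. -/
theorem ScatteredSubgroup.card_sq_le [Finite F] [FiniteDimensional F W] {U : AddSubgroup W}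
    (hU : ScatteredSubgroup F U) (hq : 2 < Nat.card F) :
    Nat.card U ^ 2 ≤ Nat.card F ^ finrank F W := by
  classical
  have := Module.finite_of_finite F (M := W)
  have : Finite (Dual F W) := Module.finite_of_finite F
  have := Fintype.ofFinite (Dual F W)
  have := Fintype.ofFinite U
  set q : ℤ := (Nat.card F : ℤ) with hqdef
  set M : ℤ := (Nat.card U : ℤ) with hM
  set n := finrank F W
  -- `c f` is the order of U ∩ ker f. Its first two moments over the dual space are computed exactly
  -- and combined into a sum of nonnegative terms, whose term at f = 0 is the bound.
  let c : Dual F W → ℤ := fun f => ∑ u : U, (if f u = 0 then 1 else 0)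
  have hMsum : ∑ _u : U, (1 : ℤ) = M := by simp [hM, Nat.card_eq_fintype_card]
  have hdual : ∑ _f : Dual F W, (1 : ℤ) = q ^ n := by
    have : Nat.card (Dual F W) = Nat.card F ^ n := by
      rw [card_eq_card_pow_finrank (F := F) (W := Dual F W), Subspace.dual_finrank_eq]
    simp only [Finset.sum_const, Finset.card_univ, nsmul_eq_mul, mul_one,
      ← Nat.card_eq_fintype_card, this]
    push_cast; rfl
  have hdelta : ∑ u : U, (if (u : W) = 0 then (1 : ℤ) else 0) = 1 := by
    rw [Finset.sum_eq_single (0 : U)]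
    · simp
    · intro b _ hb; simp [hb]
    · simp
  have hS1 : q * ∑ f, c f = q ^ n * (M + (q - 1)) := by
    simp only [c]
    rw [Finset.sum_comm, Finset.mul_sum]
    simp_rw [hqdef, card_mul_sum_dual_apply_eq_zero, ← hqdef]
    rw [← Finset.mul_sum, Finset.sum_add_distrib, ← Finset.mul_sum, hdelta, hMsum, mul_one]
  have hS2 : q ^ 2 * ∑ f, c f ^ 2 = q ^ n * (M ^ 2 + 3 * (q - 1) * M + (q ^ 2 - 3 * q + 2)) := by
    have e1 : ∀ f, c f ^ 2 = ∑ u : U, ∑ v : U,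
        (if f u = 0 then 1 else 0) * (if f v = 0 then 1 else 0) := fun f => by
      simp only [c, pow_two, Finset.sum_mul_sum]
    simp_rw [e1]
    rw [Finset.sum_comm, Finset.mul_sum]
    have e2 : ∀ u : U, (∑ f : Dual F W, ∑ v : U,
        (if f u = 0 then (1 : ℤ) else 0) * (if f v = 0 then 1 else 0)) =
        ∑ v : U, ∑ f : Dual F W, (if f u = 0 then 1 else 0) * (if f v = 0 then 1 else 0) :=
      fun u => Finset.sum_comm
    simp_rw [e2, Finset.mul_sum (s := (Finset.univ : Finset U))]
    have e3 : ∀ u v : U, (u : W) ≠ 0 → (v : W) ≠ 0 → (u : W) ≠ v →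
        LinearIndependent F ![(u : W), v] := fun u v hu hv huv => by
      rw [LinearIndependent.pair_iff' hu]
      intro a ha
      rcases hU u u.2 hu a (ha ▸ v.2) with rfl | rfl
      · exact hv (by rw [← ha, zero_smul])
      · exact huv (by rw [← ha, one_smul])
    have e4 : ∀ u : U, ∑ v : U, (if (u : W) = v then (1 : ℤ) else 0) = 1 := fun u => by
      rw [Finset.sum_eq_single u]
      · simp
      · intro b _ hb; simp [Ne.symm hb]
      · simp
    rw [Finset.sum_congr rfl fun (u : U) _ => Finset.sum_congr rfl fun (v : U) _ =>
      card_sq_mul_sum_dual_apply_eq_zero (F := F) (u : W) v (e3 u v)]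
    rw [← hqdef]
    have hMm : ∀ x : ℤ, ∑ _u : U, x = x * M := fun x => by
      rw [← hMsum, Finset.mul_sum, mul_one]
    have inner : ∀ u : U, ∑ v : U, q ^ finrank F W * (1 + (q - 1) *
        ((if (u : W) = 0 then 1 else 0) + (if (v : W) = 0 then 1 else 0) +
          (if (u : W) = v then 1 else 0)) + (q ^ 2 - 3 * q + 2) *
          ((if (u : W) = 0 then 1 else 0) * (if (v : W) = 0 then 1 else 0))) =
        q ^ n * (M + (q - 1) * ((if (u : W) = 0 then 1 else 0) * M + 1 + 1) +
          (q ^ 2 - 3 * q + 2) * (if (u : W) = 0 then 1 else 0)) := fun u => by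
      rw [← Finset.mul_sum, Finset.sum_add_distrib, Finset.sum_add_distrib, ← Finset.mul_sum,
        ← Finset.mul_sum, ← Finset.mul_sum, Finset.sum_add_distrib, Finset.sum_add_distrib,
        hdelta, e4, hMsum, hMm, mul_one]
    rw [Finset.sum_congr rfl fun (u : U) _ => inner u, ← Finset.mul_sum, Finset.sum_add_distrib,
      Finset.sum_add_distrib, ← Finset.mul_sum, ← Finset.mul_sum, Finset.sum_add_distrib,
      Finset.sum_add_distrib, ← Finset.sum_mul, hdelta, hMsum, hMm]
    ring
  have htotal : ∑ f, (q * c f - M) * (q * c f - 2 * M) = q ^ n * ((q - 1) * (q - 2)) := by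
    have : ∀ f, (q * c f - M) * (q * c f - 2 * M) =
        q ^ 2 * c f ^ 2 - 3 * M * (q * c f) + 2 * M ^ 2 * 1 := fun f => by ring
    simp_rw [this]
    rw [Finset.sum_add_distrib, Finset.sum_sub_distrib, ← Finset.mul_sum, ← Finset.mul_sum,
      ← Finset.mul_sum, ← Finset.mul_sum, hS1, hS2, hdual]
    ring
  -- The image f(U) is an additive subgroup of F, so its order divides q, say with quotient t. Then
  -- q c(f) = t M, and (t - 1)(t - 2) is nonnegative at every integer t.
  have hnonneg : ∀ f, 0 ≤ (q * c f - M) * (q * c f - 2 * M) := fun f => by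
    let g : U →+ F := f.toAddMonoidHom.comp U.subtype
    have hc : c f = Nat.card g.ker := by
      simp only [c]
      rw [Finset.sum_boole, Nat.card_eq_fintype_card, Fintype.card_subtype]
      congr 2
      ext x
      simp only [Finset.mem_filter, Finset.mem_univ, true_and]
      rfl
    have h1 : Nat.card g.ker * Nat.card g.range = Nat.card U := by
      rw [mul_comm, ← AddSubgroup.index_ker, mul_comm, AddSubgroup.card_mul_index]
    obtain ⟨t, ht⟩ := AddSubgroup.card_addSubgroup_dvd_card g.range
    have h2 : q * c f = t * M := by
      rw [hc, hqdef, hM, ht, ← h1]; push_cast; ring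
    rw [h2]
    have h3 : (t * M - M) * (t * M - 2 * M) = M ^ 2 * (((t : ℤ) - 1) * (t - 2)) := by ring
    rw [h3]
    refine mul_nonneg (sq_nonneg _) ?_
    rcases Nat.lt_or_ge t 2 with h | h
    · interval_cases t <;> norm_num
    · have : (2 : ℤ) ≤ t := by exact_mod_cast h
      exact mul_nonneg (by linarith) (by linarith)
  -- At f = 0 one has c = M, and the term is M² (q - 1)(q - 2). The positive factor cancels against
  -- the one in the total.
  have hle := Finset.single_le_sum (fun f _ => hnonneg f) (Finset.mem_univ (0 : Dual F W))
  rw [htotal] at hle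
  have hc0 : c 0 = M := by simp only [c, LinearMap.zero_apply, if_true, hMsum]
  rw [hc0] at hle
  have hq2 : (2 : ℤ) < q := by rw [hqdef]; exact_mod_cast hq
  have hpos : 0 < (q - 1) * (q - 2) := mul_pos (by linarith) (by linarith)
  have : M ^ 2 ≤ q ^ n := by
    refine le_of_mul_le_mul_right ?_ hpos
    calc M ^ 2 * ((q - 1) * (q - 2)) = (q * M - M) * (q * M - 2 * M) := by ring
      _ ≤ _ := hle
  rw [hM, hqdef] at this
  exact_mod_cast this

end ScatteredBound

/-! ### Diagonalization of plane endomorphisms with φ^q = φ -/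

section Diagonalization

open Polynomial

variable {F : Type*} [Field F] {W : Type*} [AddCommGroup W] [Module F W]

theorem splits_X_pow_natCard_sub_X [Finite F] : (X ^ Nat.card F - X : F[X]).Splits := by
  cases nonempty_fintype F
  rw [Nat.card_eq_fintype_card, splits_iff_card_roots, FiniteField.roots_X_pow_card_sub_X,
    FiniteField.X_pow_card_sub_X_natDegree_eq F Fintype.one_lt_card]
  rfl

theorem squarefree_X_pow_natCard_sub_X [Finite F] : Squarefree (X ^ Nat.card F - X : F[X]) := by
  cases nonempty_fintype F
  obtain ⟨n, _, hn⟩ := FiniteField.card F (ringChar F)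
  refine (galois_poly_separable (ringChar F) _ ?_).squarefree
  rw [Nat.card_eq_fintype_card, hn]
  exact dvd_pow_self _ n.ne_zero

/-- A non-scalar endomorphism `φ` of a plane over a field with `q` elements such that `φ ^ q = φ`
has two different eigenvalues. -/
theorem exists_two_eigenvectors [Finite F] (hW : finrank F W = 2) (φ : End F W)
    (hφ : φ ^ Nat.card F = φ) (hns : ∀ c : F, φ ≠ c • LinearMap.id) :
    ∃ (e₁ e₂ : W) (a b : F), LinearIndependent F ![e₁, e₂] ∧ φ e₁ = a • e₁ ∧ φ e₂ = b • e₂ ∧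
      a ≠ b := by
  have : FiniteDimensional F W := .of_finrank_pos (by omega)
  have : Nontrivial W := Module.nontrivial_of_finrank_pos (R := F) (by omega)
  -- X^q - X is squarefree and splits over F, so φ is semisimple and has an eigenvalue in F.
  have haev : aeval φ (X ^ Nat.card F - X : F[X]) = 0 := by simp [hφ]
  have hss := (End.isSemisimple_of_squarefree_aeval_eq_zero squarefree_X_pow_natCard_sub_X
    haev).isFinitelySemisimple
  obtain ⟨a, ha⟩ := ((splits_X_pow_natCard_sub_X (F := F)).of_dvd
    (squarefree_X_pow_natCard_sub_X (F := F)).ne_zero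
    (minpoly.dvd F φ haev)).exists_eval_eq_zero
      (minpoly.degree_pos (Algebra.IsIntegral.isIntegral φ)).ne'
  obtain ⟨e₁, he₁⟩ := (End.hasEigenvalue_of_isRoot (f := φ) ha).exists_hasEigenvector
  have h1 : φ e₁ = a • e₁ := he₁.apply_eq_smul
  have hne : e₁ ≠ 0 := he₁.2
  obtain ⟨w, hw⟩ : ∃ w, LinearIndependent F ![e₁, w] := by
    by_contra! hcon
    have : finrank F W ≤ 1 := by
      refine finrank_le_one e₁ fun w => ?_
      by_contra! h
      exact hcon w ((LinearIndependent.pair_iff' hne).2 h)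
    omega
  have hspan : ∀ z : W, ∃ x y : F, x • e₁ + y • w = z := fun z => by
    have := hw.span_eq_top_of_card_eq_finrank' (by simp [hW])
    have hz : z ∈ Submodule.span F (Set.range ![e₁, w]) := by rw [this]; trivial
    rw [Matrix.range_cons, Matrix.range_cons, Matrix.range_empty, Set.union_empty,
      Set.singleton_union] at hz
    exact Submodule.mem_span_pair.1 hz
  obtain ⟨x, b, hxb⟩ := hspan (φ w)
  -- With a repeated eigenvalue, w would be a generalized eigenvector, hence an eigenvector by
  -- semisimplicity, and φ would be a scalar.
  by_cases hab : a = b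
  · exfalso
    subst hab
    have hgen : w ∈ φ.genEigenspace a 2 := by
      rw [show (2 : ℕ∞) = ((2 : ℕ) : ℕ∞) from rfl, End.mem_genEigenspace_nat, LinearMap.mem_ker,
        pow_two]
      have e1 : (φ - a • 1) w = x • e₁ := by
        simp only [LinearMap.sub_apply, LinearMap.smul_apply, Module.End.one_apply, ← hxb]
        abel
      rw [Module.End.mul_apply, e1]
      simp [h1]
    rw [hss.genEigenspace_eq_eigenspace a (by norm_num), End.mem_eigenspace_iff] at hgen
    refine hns a (LinearMap.ext fun z => ?_)
    obtain ⟨s, t, rfl⟩ := hspan z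
    simp only [map_add, map_smul, h1, hgen, LinearMap.smul_apply, LinearMap.id_apply]
  -- The coefficient l of e₁ in the second eigenvector solves x + l a = b l.
  · refine ⟨e₁, w + (x / (b - a)) • e₁, a, b, ?_, h1, ?_, hab⟩
    · rw [LinearIndependent.pair_iff] at hw ⊢
      intro s t hst
      obtain ⟨h2, h3⟩ := hw (s + t * (x / (b - a))) t (by rw [← hst]; module)
      subst h3
      simpa using h2
    · have hba : b - a ≠ 0 := sub_ne_zero.2 (Ne.symm hab)
      rw [map_add, map_smul, h1, ← hxb, smul_add, smul_smul, smul_smul, add_right_comm, add_comm,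
        ← add_smul]
      congr 2
      field_simp
      ring

end Diagonalization

/-! ### Scattered subgroups of a plane with a sharply transitive stabilizer -/

section MonomialForm

variable {F : Type*} [Field F] {W : Type*} [AddCommGroup W] [Module F W]

variable (F) in
/-- The ring of the linear maps that map an additive subgroup into itself. -/
def AddSubgroup.endStabilizer (A : AddSubgroup W) : Subring (End F W) where
  carrier := {φ | ∀ p ∈ A, φ p ∈ A}
  mul_mem' hφ hψ p hp := hφ _ (hψ p hp)
  one_mem' _ hp := hp
  add_mem' hφ hψ p hp := A.add_mem (hφ p hp) (hψ p hp)
  zero_mem' _ _ := A.zero_mem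
  neg_mem' hφ p hp := A.neg_mem (hφ p hp)

theorem AddSubgroup.exists_mem_ne_ne {A : AddSubgroup W} (hA : 2 < Nat.card A) (u : W) :
    ∃ w ∈ A, w ≠ 0 ∧ w ≠ u := by
  classical
  have : Finite A := Nat.finite_of_card_ne_zero (by omega)
  have := Fintype.ofFinite A
  by_contra! h
  have h2 : (Finset.univ : Finset A).image Subtype.val ⊆ {0, u} := fun w hw => by
    obtain ⟨w, -, rfl⟩ := Finset.mem_image.1 hw
    by_cases hw : (w : W) = 0
    · simp [hw]
    · simp [h w w.2 hw]
  have h3 := (Finset.card_le_card h2).trans Finset.card_le_two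
  rw [Finset.card_image_of_injective _ Subtype.val_injective, Finset.card_univ,
    ← Nat.card_eq_fintype_card] at h3
  omega

/-- A scattered additive subgroup with `q` elements of a plane over a field with `q` elements is
`{x e₁ + σ(x) e₂}` in a suitable basis, with `σ` a field endomorphism, if the linear maps that
stabilize it act sharply transitively on its nonzero elements. -/
theorem ScatteredSubgroup.exists_monomial_form [Finite F] (hq : 2 < Nat.card F)
    (hW : finrank F W = 2) {A : AddSubgroup W} (hA : ScatteredSubgroup F A)
    (hcard : Nat.card A = Nat.card F) {u : W} (hu : u ∈ A) (hu0 : u ≠ 0)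
    (htrans : ∀ w ∈ A, w ≠ 0 → ∃ φ ∈ A.endStabilizer F, φ u = w)
    (hfree : ∀ φ ∈ A.endStabilizer F, ∀ w ∈ A, w ≠ 0 → φ w = 0 → φ = 0) :
    ∃ (e₁ e₂ : W) (σ : F →+* F), LinearIndependent F ![e₁, e₂] ∧
      ∀ x y : F, x • e₁ + y • e₂ ∈ A ↔ y = σ x := by
  have : FiniteDimensional F W := .of_finrank_pos (by omega)
  have : Finite W := Module.finite_of_finite F
  set C := A.endStabilizer F
  -- Evaluation at u identifies the stabilizer ring with A. The ring therefore has q elements;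
  -- having no zero divisors, it is a field, and all its elements satisfy φ^q = φ.
  have hbij : Function.Bijective (fun φ : C => (⟨φ.1 u, φ.2 u hu⟩ : A)) := by
    constructor
    · intro φ ψ h
      have h' : (φ - ψ).1 u = 0 := by
        simpa [sub_eq_zero] using congrArg Subtype.val h
      have := hfree (φ - ψ).1 (φ - ψ).2 u hu hu0 h'
      exact sub_eq_zero.1 (Subtype.ext this)
    · rintro ⟨w, hw⟩
      by_cases hw0 : w = 0
      · exact ⟨0, Subtype.ext (by simp [hw0])⟩
      · obtain ⟨φ, hφ, h⟩ := htrans w hw hw0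
        exact ⟨⟨φ, hφ⟩, Subtype.ext h⟩
  have hCcard : Nat.card C = Nat.card F := (Nat.card_eq_of_bijective _ hbij).trans hcard
  have hCfin : Finite C := Nat.finite_of_card_ne_zero (by omega)
  have hCnt : Nontrivial C := by
    rw [← Finite.one_lt_card_iff_nontrivial]; omega
  have hCnzd : NoZeroDivisors C := ⟨fun {φ ψ} h => by
    by_contra! hcon
    have h1 : ψ.1 u ≠ 0 := fun h0 => hcon.2 (Subtype.ext (hfree _ ψ.2 u hu hu0 h0))
    refine hcon.1 (Subtype.ext (hfree _ φ.2 _ (ψ.2 u hu) h1 ?_))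
    exact LinearMap.congr_fun (congrArg Subtype.val h) u⟩
  have hCdom : IsDomain C := NoZeroDivisors.to_isDomain C
  have hCfield : IsField C := Finite.isDomain_to_isField C
  have hpow : ∀ φ : C, φ ^ Nat.card F = φ := fun φ => by
    let _ := hCfield.toField
    let _ := Fintype.ofFinite C
    have := FiniteField.pow_card φ
    rwa [← Nat.card_eq_fintype_card, hCcard] at this
  -- A scalar that maps u into A is 0 or 1, and A has more than two elements, so the stabilizer
  -- cannot consist of scalars.
  obtain ⟨φ, hφ⟩ : ∃ φ : C, ∀ c : F, φ.1 ≠ c • LinearMap.id := by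
    by_contra! hcon
    obtain ⟨w, hw, hw0, hwu⟩ := AddSubgroup.exists_mem_ne_ne (hcard ▸ hq) u
    obtain ⟨ψ, hψ, hψw⟩ := htrans w hw hw0
    obtain ⟨c, hc⟩ := hcon ⟨ψ, hψ⟩
    have hc' : c • u = w := by rw [← hψw, show ψ = _ from hc]; rfl
    rcases hA u hu hu0 c (hc' ▸ hw) with rfl | rfl
    · exact hw0 (by rw [← hc', zero_smul])
    · exact hwu (by rw [← hc', one_smul])
  obtain ⟨e₁, e₂, a, b, hind, h1, h2, hab⟩ :=
    exists_two_eigenvectors hW φ.1 (by simpa using congrArg Subtype.val (hpow φ)) hφ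
  have hspan : ∀ z : W, ∃ x y : F, x • e₁ + y • e₂ = z := fun z => by
    have := hind.span_eq_top_of_card_eq_finrank' (by simp [hW])
    have hz : z ∈ Submodule.span F (Set.range ![e₁, e₂]) := by rw [this]; trivial
    rw [Matrix.range_cons, Matrix.range_cons, Matrix.range_empty, Set.union_empty,
      Set.singleton_union] at hz
    exact Submodule.mem_span_pair.1 hz
  have hind' := LinearIndependent.pair_iff.1 hind
  -- Since the stabilizer is commutative, all of it preserves the two eigenlines of φ and acts on
  -- them by ring homomorphisms χ₁ and χ₂ to F.
  have hcomm : ∀ ψ : C, ∀ z, φ.1 (ψ.1 z) = ψ.1 (φ.1 z) := fun ψ z =>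
    LinearMap.congr_fun (congrArg Subtype.val (hCfield.mul_comm φ ψ)) z
  have hab' : a - b ≠ 0 := sub_ne_zero.2 hab
  have hχ₁ : ∀ ψ : C, ∃ x : F, ψ.1 e₁ = x • e₁ := fun ψ => by
    obtain ⟨x, y, hxy⟩ := hspan (ψ.1 e₁)
    have := hcomm ψ e₁
    rw [h1, map_smul, ← hxy, map_add, map_smul, map_smul, h1, h2] at this
    obtain ⟨-, h4⟩ := hind' 0 (y * (b - a)) (by
      rw [← sub_eq_zero] at this; rw [← this]; module)
    have hy : y = 0 := (mul_eq_zero.1 h4).resolve_right fun h => hab (by linear_combination -h)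
    exact ⟨x, by rw [← hxy, hy, zero_smul, add_zero]⟩
  have hχ₂ : ∀ ψ : C, ∃ x : F, ψ.1 e₂ = x • e₂ := fun ψ => by
    obtain ⟨x, y, hxy⟩ := hspan (ψ.1 e₂)
    have := hcomm ψ e₂
    rw [h2, map_smul, ← hxy, map_add, map_smul, map_smul, h1, h2] at this
    obtain ⟨h4, -⟩ := hind' (x * (a - b)) 0 (by
      rw [← sub_eq_zero] at this; rw [← this]; module)
    have hx : x = 0 := (mul_eq_zero.1 h4).resolve_right hab'
    exact ⟨y, by rw [← hxy, hx, zero_smul, zero_add]⟩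
  have he₁ : e₁ ≠ 0 := hind.ne_zero 0
  have he₂ : e₂ ≠ 0 := hind.ne_zero 1
  have mkChar : ∀ e : W, e ≠ 0 → (∀ ψ : C, ∃ x : F, ψ.1 e = x • e) →
      ∃ χ : C →+* F, ∀ ψ : C, ψ.1 e = χ ψ • e := fun e he h => by
    choose χ hχ using h
    have hinj : ∀ {x y : F}, x • e = y • e → x = y := fun h => smul_left_injective F he h
    exact ⟨{ toFun := χ
             map_one' := hinj (by rw [← hχ, one_smul]; rfl)
             map_zero' := hinj (by rw [← hχ, zero_smul]; rfl)
             map_add' := fun s t => hinj (by rw [← hχ, add_smul, ← hχ, ← hχ]; rfl)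
             map_mul' := fun s t => hinj (by
              rw [← hχ, mul_comm, mul_smul, ← hχ s, ← map_smul, ← hχ t]; rfl) }, hχ⟩
  obtain ⟨χ₁, hχ₁⟩ := mkChar e₁ he₁ hχ₁
  obtain ⟨χ₂, hχ₂⟩ := mkChar e₂ he₂ hχ₂
  let _ := hCfield.toField
  have hχbij : Function.Bijective χ₁ := by
    have hinj : Function.Injective χ₁ := by
      rw [injective_iff_map_eq_zero]
      intro ψ hψ
      by_contra hne
      obtain ⟨θ, hθ⟩ := hCfield.mul_inv_cancel hne
      have := map_mul χ₁ ψ θ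
      rw [hθ, hψ, map_one, zero_mul] at this
      exact one_ne_zero this
    exact (Nat.bijective_iff_injective_and_card _).2 ⟨hinj, hCcard⟩
  -- A is the orbit of u = s e₁ + t e₂, including 0. Parametrized by the value x of χ₁, it consists
  -- of the vectors x s e₁ + χ₂(χ₁⁻¹(x)) t e₂. After rescaling the basis by s and t, the map σ is χ₂
  -- ∘ χ₁⁻¹.
  let τ : C ≃+* F := RingEquiv.ofBijective χ₁ hχbij
  obtain ⟨s, t, hst⟩ := hspan u
  have hform : ∀ w ∈ A, ∃ x : F, w = (x * s) • e₁ + (χ₂ (τ.symm x) * t) • e₂ := fun w hw => by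
    obtain ⟨ψ, hψ⟩ := hbij.2 ⟨w, hw⟩
    have hψ' : ψ.1 u = w := congrArg Subtype.val hψ
    refine ⟨τ ψ, ?_⟩
    rw [← hψ', ← hst, map_add, map_smul, map_smul, hχ₁, hχ₂, RingEquiv.symm_apply_apply,
      smul_smul, smul_smul, mul_comm s, mul_comm t]
    rfl
  have hmem : ∀ x : F, (x * s) • e₁ + (χ₂ (τ.symm x) * t) • e₂ ∈ A := fun x => by
    have := (τ.symm x).2 u hu
    rw [← hst, map_add, map_smul, map_smul, hχ₁, hχ₂, smul_smul, smul_smul, mul_comm s,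
      mul_comm t] at this
    have h3 : χ₁ (τ.symm x) = x := τ.apply_symm_apply x
    rwa [h3] at this
  -- A scattered group with more than two elements is not contained in a vector line. This makes s
  -- and t nonzero.
  have hone : ∀ e : W, A ≤ (Submodule.span F {e}).toAddSubgroup → False := fun e he => by
    obtain ⟨c, hc⟩ := Submodule.mem_span_singleton.1 (he hu)
    have hc0 : c ≠ 0 := by rintro rfl; exact hu0 (by rw [← hc, zero_smul])
    obtain ⟨w, hw, hw0, hwu⟩ := AddSubgroup.exists_mem_ne_ne (hcard ▸ hq) u
    obtain ⟨d, hd⟩ := Submodule.mem_span_singleton.1 (he hw)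
    have h3 : (d * c⁻¹) • u = w := by rw [← hc, smul_smul, inv_mul_cancel_right₀ hc0, hd]
    rcases hA u hu hu0 _ (h3 ▸ hw) with h | h
    · exact hw0 (by rw [← h3, h, zero_smul])
    · exact hwu (by rw [← h3, h, one_smul])
  have hs : s ≠ 0 := by
    rintro rfl
    refine hone e₂ fun w hw => ?_
    obtain ⟨x, rfl⟩ := hform w hw
    exact Submodule.mem_span_singleton.2 ⟨χ₂ (τ.symm x) * t, by simp⟩
  have ht : t ≠ 0 := by
    rintro rfl
    refine hone e₁ fun w hw => ?_
    obtain ⟨x, rfl⟩ := hform w hw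
    exact Submodule.mem_span_singleton.2 ⟨x * s, by simp⟩
  refine ⟨s • e₁, t • e₂, χ₂.comp τ.symm.toRingHom, ?_, fun x y => ?_⟩
  · rw [LinearIndependent.pair_iff]
    intro x y hxy
    rw [smul_smul, smul_smul] at hxy
    obtain ⟨h3, h4⟩ := hind' _ _ hxy
    exact ⟨(mul_eq_zero.1 h3).resolve_right hs, (mul_eq_zero.1 h4).resolve_right ht⟩
  · rw [smul_smul, smul_smul]
    constructor
    · intro h
      obtain ⟨x', hx'⟩ := hform _ h
      obtain ⟨h3, h4⟩ := hind' ((x - x') * s) ((y - χ₂ (τ.symm x')) * t) (by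
        rw [← sub_eq_zero] at hx'; rw [← hx']; module)
      have h5 : x = x' := sub_eq_zero.1 ((mul_eq_zero.1 h3).resolve_right hs)
      have h6 := sub_eq_zero.1 ((mul_eq_zero.1 h4).resolve_right ht)
      rw [h6, h5]; rfl
    · rintro rfl
      exact hmem x

end MonomialForm

/-! ### Direct sums of subgroups -/

section Subgroups

variable {G : Type*} [AddCommGroup G]

theorem AddSubgroup.addCoprod_injective {A B C : AddSubgroup G} (hA : A ≤ C) (hB : B ≤ C)
    (hAB : Disjoint A B) : Function.Injective
      (fun p : A × B => (⟨p.1 + p.2, C.add_mem (hA p.1.2) (hB p.2.2)⟩ : C)) := by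
  rintro ⟨a, b⟩ ⟨c, d⟩ h
  have h1 : (a : G) + b = c + d := congrArg Subtype.val h
  have h2 : (a : G) - c = d - b := by rw [sub_eq_sub_iff_add_eq_add, h1, add_comm]
  have h3 : (a : G) - c = 0 := by
    have := AddSubgroup.disjoint_def.1 hAB (A.sub_mem a.2 c.2) (h2 ▸ B.sub_mem d.2 b.2)
    exact this
  have h4 : (d : G) - b = 0 := h2 ▸ h3
  exact Prod.ext (Subtype.ext (sub_eq_zero.1 h3)) (Subtype.ext (sub_eq_zero.1 h4).symm)

theorem AddSubgroup.card_mul_card_le {A B C : AddSubgroup G} [Finite C] (hA : A ≤ C) (hB : B ≤ C)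
    (hAB : Disjoint A B) : Nat.card A * Nat.card B ≤ Nat.card C := by
  rw [← Nat.card_prod]
  exact Nat.card_le_card_of_injective _ (AddSubgroup.addCoprod_injective hA hB hAB)

theorem AddSubgroup.exists_add_eq_of_card_le {A B C : AddSubgroup G} [Finite C] (hA : A ≤ C)
    (hB : B ≤ C) (hAB : Disjoint A B) (hC : Nat.card C ≤ Nat.card A * Nat.card B) :
    ∀ c ∈ C, ∃ a ∈ A, ∃ b ∈ B, a + b = c := fun c hc => by
  rw [← Nat.card_prod] at hC
  obtain ⟨⟨a, b⟩, h⟩ :=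
    ((AddSubgroup.addCoprod_injective hA hB hAB).bijective_of_nat_card_le hC).2 ⟨c, hc⟩
  exact ⟨a, a.2, b, b.2, congrArg Subtype.val h⟩

end Subgroups

/-! ### Special subgroups and their big lines -/

section NormalForm

variable {F : Type*} [Field F] {V : Type*} [AddCommGroup V] [Module F V]

theorem ScatteredSubgroup.card_inf_sq_le [Finite F] [FiniteDimensional F V] {U : AddSubgroup V}
    (hU : ScatteredSubgroup F U) (hq : 2 < Nat.card F) (E : Submodule F V) :
    Nat.card (U ⊓ E.toAddSubgroup : AddSubgroup V) ^ 2 ≤ Nat.card F ^ finrank F E := by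
  have h1 : ScatteredSubgroup F (U.comap E.subtype.toAddMonoidHom) := fun u hu hu0 c hc =>
    hU u hu (fun h => hu0 (Subtype.ext h)) c hc
  have h2 := h1.card_sq_le hq
  have h3 : Nat.card (U ⊓ E.toAddSubgroup : AddSubgroup V) =
      Nat.card (U.comap E.subtype.toAddMonoidHom) :=
    Nat.card_congr
      { toFun := fun x => ⟨⟨x, x.2.2⟩, x.2.1⟩
        invFun := fun x => ⟨x.1, x.2, x.1.2⟩
        left_inv := fun _ => rfl
        right_inv := fun _ => rfl }
  rwa [h3]

variable (F) in
/-- A plane (a projective line) that meets the additive subgroup in `q` elements. -/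
def IsBigLine (U : AddSubgroup V) (s : Submodule F V) : Prop :=
  finrank F s = 2 ∧ Nat.card (U ⊓ s.toAddSubgroup : AddSubgroup V) = Nat.card F

variable (F) in
/-- A scattered additive subgroup of `H` with `q ^ k` elements that meets the vector planes of
`H` in `1`, `2`, `4` or `q` elements. -/
structure IsSpecialSubgroup (k : ℕ) (H : Submodule F V) (U : AddSubgroup V) : Prop where
  card_field : 16 ≤ Nat.card F
  finrank_eq : finrank F H = 2 * k
  two_le : 2 ≤ k
  le : U ≤ H.toAddSubgroup
  card_eq : Nat.card U = Nat.card F ^ k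
  scattered : ScatteredSubgroup F U
  card_line : ∀ s : Submodule F V, finrank F s = 2 →
    Nat.card (U ⊓ s.toAddSubgroup : AddSubgroup V) ∈ ({1, 2, 4, Nat.card F} : Set ℕ)
  disjoint_of_ne : ∀ s t : Submodule F V, IsBigLine F U s → IsBigLine F U t → s ≠ t → Disjoint s t

theorem linearIndependent_pair_of_mem {U : AddSubgroup V} (hU : ScatteredSubgroup F U) {u v : V}
    (hu : u ∈ U) (hv : v ∈ U) (hu0 : u ≠ 0) (hv0 : v ≠ 0) (huv : v ≠ u) :
    LinearIndependent F ![u, v] := by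
  rw [LinearIndependent.pair_iff' hu0]
  intro a ha
  rcases hU u hu hu0 a (ha ▸ hv) with rfl | rfl
  · exact hv0 (by rw [← ha, zero_smul])
  · exact huv (by rw [← ha, one_smul])

theorem finrank_span_pair {u v : V} (h : LinearIndependent F ![u, v]) :
    finrank F (Submodule.span F {u, v}) = 2 := by
  have := finrank_span_eq_card h
  rwa [Matrix.range_cons, Matrix.range_cons, Matrix.range_empty, Set.union_empty,
    Set.singleton_union, Fintype.card_fin] at this

theorem eq_span_pair {s : Submodule F V} (hs : finrank F s = 2) {u v : V} (hu : u ∈ s)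
    (hv : v ∈ s) (h : LinearIndependent F ![u, v]) : s = Submodule.span F {u, v} := by
  have : FiniteDimensional F s := .of_finrank_pos (by omega)
  refine (Submodule.eq_of_le_of_finrank_eq (Submodule.span_le.2 ?_) ?_).symm
  · rintro x (rfl | rfl) <;> assumption
  · rw [finrank_span_pair h, hs]

namespace IsSpecialSubgroup

variable {k : ℕ} {H : Submodule F V} {U : AddSubgroup V}

theorem exists_pair (hU : IsSpecialSubgroup F k H U) {s : Submodule F V}
    (hs : IsBigLine F U s) : ∃ u ∈ U, ∃ v ∈ U, u ∈ s ∧ v ∈ s ∧ LinearIndependent F ![u, v] := by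
  have hq := hU.card_field
  have h2 : 2 < Nat.card (U ⊓ s.toAddSubgroup : AddSubgroup V) := by rw [hs.2]; omega
  obtain ⟨u, hu, hu0, -⟩ := AddSubgroup.exists_mem_ne_ne h2 0
  obtain ⟨v, hv, hv0, hvu⟩ := AddSubgroup.exists_mem_ne_ne h2 u
  exact ⟨u, hu.1, v, hv.1, hu.2, hv.2, linearIndependent_pair_of_mem hU.scattered hu.1 hv.1 hu0
    hv0 hvu⟩

theorem le_of_isBigLine (hU : IsSpecialSubgroup F k H U) {s : Submodule F V}
    (hs : IsBigLine F U s) : s ≤ H := by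
  obtain ⟨u, hu, v, hv, hus, hvs, h⟩ := hU.exists_pair hs
  rw [eq_span_pair hs.1 hus hvs h, Submodule.span_le]
  rintro x (rfl | rfl)
  exacts [hU.le hu, hU.le hv]

theorem isBigLine_of_lt (hU : IsSpecialSubgroup F k H U) {s : Submodule F V}
    (hs : finrank F s = 2) (h : 4 < Nat.card (U ⊓ s.toAddSubgroup : AddSubgroup V)) :
    IsBigLine F U s := by
  refine ⟨hs, ?_⟩
  rcases hU.card_line s hs with h1 | h1 | h1 | h1
  · omega
  · omega
  · omega
  · exact h1

variable [Finite F] [FiniteDimensional F V]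

/-- If every line of E through u met U in at most four elements, the image of U ∩ E in the quotient
by ⟨u⟩ would be scattered. It would have at least q^j / 2 elements in dimension 2j - 1, and the
bound for scattered groups would give q ≤ 4. -/
theorem exists_isBigLine_le (hU : IsSpecialSubgroup F k H U) {E : Submodule F V} {j : ℕ}
    (hE : finrank F E = 2 * j)
    (hcard : Nat.card (U ⊓ E.toAddSubgroup : AddSubgroup V) = Nat.card F ^ j) {u : V}
    (hu : u ∈ U) (huE : u ∈ E) (hu0 : u ≠ 0) : ∃ s ≤ E, u ∈ s ∧ IsBigLine F U s := by
  have hV : Finite V := Module.finite_of_finite F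
  by_contra! hcon
  have hq := hU.card_field
  set N := Submodule.span F {u}
  set B : AddSubgroup V := U ⊓ E.toAddSubgroup
  -- The elements 0, u, v, u + v already fill the quota of four on the line of u and v, so all other
  -- images modulo u are excluded.
  have hB : ∀ v ∈ B, v ∉ N → ∀ w ∈ B, w ∈ Submodule.span F {u, v} →
      N.mkQ w = 0 ∨ N.mkQ w = N.mkQ v := by
    intro v hv hvN w hw hwv
    have hv0 : v ≠ 0 := by rintro rfl; exact hvN N.zero_mem
    have hvu : v ≠ u := by rintro rfl; exact hvN (Submodule.mem_span_singleton_self v)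
    have hind := linearIndependent_pair_of_mem hU.scattered hu hv.1 hu0 hv0 hvu
    have hs2 := finrank_span_pair hind
    have hus : u ∈ Submodule.span F {u, v} := Submodule.subset_span (by simp)
    have hvs : v ∈ Submodule.span F {u, v} := Submodule.subset_span (by simp)
    have hsE : Submodule.span F {u, v} ≤ E := by
      rw [Submodule.span_le]
      rintro x (rfl | rfl)
      exacts [huE, hv.2]
    have hle : Nat.card (U ⊓ (Submodule.span F {u, v}).toAddSubgroup : AddSubgroup V) ≤ 4 := by
      by_contra! h
      exact hcon _ hsE hus (hU.isBigLine_of_lt hs2 h)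
    by_contra! hw'
    have hwN : w ∉ N := fun h => hw'.1 (by simpa using h)
    have hwvN : w - v ∉ N := fun h => hw'.2 (by
      rw [← sub_eq_zero, ← map_sub, Submodule.mkQ_apply, Submodule.Quotient.mk_eq_zero]
      exact h)
    have huN : u ∈ N := Submodule.mem_span_singleton_self u
    classical
    have h5 : ({0, u, v, w, u + v} : Finset V).card = 5 := by
      have e1 : u + v ≠ 0 := fun h => hvN (by
        rw [eq_neg_of_add_eq_zero_right h]; exact N.neg_mem huN)
      have e2 : w ≠ 0 := by rintro rfl; exact hwN N.zero_mem
      have e3 : w ≠ u := by rintro rfl; exact hwN huN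
      have e4 : w ≠ v := by rintro rfl; exact hwvN (by simp)
      have e5 : w ≠ u + v := by rintro rfl; exact hwvN (by simpa using huN)
      simp [Finset.card_insert_of_notMem, *, Ne.symm hu0, Ne.symm hv0, Ne.symm e1, Ne.symm e2,
        Ne.symm e3, Ne.symm e4, Ne.symm hvu]
    have h6 : (({0, u, v, w, u + v} : Finset V) : Set V) ⊆
        (U ⊓ (Submodule.span F {u, v}).toAddSubgroup : AddSubgroup V) := by
      intro x hx
      simp only [Finset.coe_insert, Finset.coe_singleton, Set.mem_insert_iff,
        Set.mem_singleton_iff] at hx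
      rcases hx with rfl | rfl | rfl | rfl | rfl
      · exact AddSubgroup.zero_mem _
      · exact ⟨hu, hus⟩
      · exact ⟨hv.1, hvs⟩
      · exact ⟨hw.1, hwv⟩
      · exact ⟨U.add_mem hu hv.1, Submodule.add_mem _ hus hvs⟩
    have h7 := Set.ncard_le_ncard h6 (Set.toFinite _)
    rw [Set.ncard_coe_finset, h5] at h7
    exact absurd (h7.trans hle) (by norm_num)
  set B' : AddSubgroup (V ⧸ N) := B.map N.mkQ.toAddMonoidHom
  have hB' : ScatteredSubgroup F B' := by
    rintro _ ⟨v, hv, rfl⟩ hv0 c ⟨w, hw, hwc⟩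
    have hwc' : N.mkQ w = c • N.mkQ v := hwc
    have hv0' : N.mkQ v ≠ 0 := hv0
    have hvN : v ∉ N := fun h => hv0' (by simpa using h)
    have hwv : w ∈ Submodule.span F {u, v} := by
      have : w - c • v ∈ N := by
        rw [← Submodule.ker_mkQ N, LinearMap.mem_ker, map_sub, map_smul, hwc', sub_self]
      obtain ⟨d, hd⟩ := Submodule.mem_span_singleton.1 this
      exact Submodule.mem_span_pair.2 ⟨d, c, by rw [hd]; abel⟩
    rcases hB v hv hvN w hw hwv with h | h
    · left
      rw [h] at hwc'
      exact (smul_eq_zero.1 hwc'.symm).resolve_right hv0'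
    · right
      rw [h] at hwc'
      exact smul_left_injective F hv0' (by simpa using hwc'.symm)
  have h1 := hB'.card_inf_sq_le (by omega) (E.map N.mkQ)
  have hB'E : B' ⊓ (E.map N.mkQ).toAddSubgroup = B' := by
    rw [inf_eq_left]
    rintro _ ⟨v, hv, rfl⟩
    exact ⟨v, hv.2, rfl⟩
  rw [hB'E] at h1
  have hNE : N ≤ E := by rwa [Submodule.span_singleton_le_iff_mem]
  have hfin : finrank F (E.map N.mkQ) + 1 = 2 * j := by
    have e1 := LinearMap.finrank_range_add_finrank_ker (N.mkQ.domRestrict E)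
    rw [LinearMap.range_domRestrict, LinearMap.ker_domRestrict, Submodule.ker_mkQ, hE] at e1
    rw [← e1]
    congr 1
    have e2 := (Submodule.comapSubtypeEquivOfLe hNE).finrank_eq
    rw [finrank_span_singleton hu0] at e2
    exact e2.symm
  -- By scatteredness the projection modulo u has only 0 and u in its kernel on U ∩ E, so at most
  -- half of the order is lost.
  have h2 : Nat.card B ≤ 2 * Nat.card B' := by
    let g : B →+ V ⧸ N := N.mkQ.toAddMonoidHom.comp B.subtype
    have e1 : Nat.card g.range * Nat.card g.ker = Nat.card B := by
      rw [← AddSubgroup.index_ker, mul_comm, AddSubgroup.card_mul_index]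
    have e2 : g.range = B' := by
      ext x
      constructor
      · rintro ⟨b, rfl⟩; exact ⟨b, b.2, rfl⟩
      · rintro ⟨b, hb, rfl⟩; exact ⟨⟨b, hb⟩, rfl⟩
    have e3 : Nat.card g.ker ≤ 2 := by
      by_contra! h
      obtain ⟨w, hw, hw0, hwu⟩ := AddSubgroup.exists_mem_ne_ne h ⟨u, hu, huE⟩
      have : N.mkQ (w : V) = 0 := hw
      have hwN : (w : V) ∈ N := by simpa using this
      obtain ⟨c, hc⟩ := Submodule.mem_span_singleton.1 hwN
      rcases hU.scattered u hu hu0 c (hc ▸ w.2.1) with rfl | rfl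
      · exact hw0 (Subtype.ext (by rw [← hc, zero_smul]; rfl))
      · exact hwu (Subtype.ext (by rw [← hc, one_smul]))
    rw [← e1, e2, mul_comm]
    exact Nat.mul_le_mul_right _ e3
  rw [hcard] at h2
  have h3 : Nat.card F ^ (2 * j) ≤ 4 * Nat.card F ^ finrank F (E.map N.mkQ) := by
    calc Nat.card F ^ (2 * j) = (Nat.card F ^ j) ^ 2 := by rw [← pow_mul, mul_comm]
      _ ≤ (2 * Nat.card B') ^ 2 := Nat.pow_le_pow_left h2 2
      _ = 4 * Nat.card B' ^ 2 := by ring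
      _ ≤ _ := Nat.mul_le_mul_left 4 h1
  rw [← hfin, pow_succ, mul_comm] at h3
  have := Nat.le_of_mul_le_mul_right h3 (pow_pos (by omega) _)
  omega

end IsSpecialSubgroup

end NormalForm

/-! ### Transfer between big lines and the normal form of a special subgroup -/

section NormalFormTheorem

variable {F : Type*} [Field F] {V : Type*} [AddCommGroup V] [Module F V]

namespace IsSpecialSubgroup

variable {k : ℕ} {H : Submodule F V} {U : AddSubgroup V}
variable [Finite F] [FiniteDimensional F V]

theorem exists_isBigLine (hU : IsSpecialSubgroup F k H U) {u : V} (hu : u ∈ U) (hu0 : u ≠ 0) :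
    ∃ s, u ∈ s ∧ IsBigLine F U s := by
  obtain ⟨s, -, hus, hs⟩ := hU.exists_isBigLine_le hU.finrank_eq (j := k)
    (by rw [inf_eq_left.2 hU.le, hU.card_eq]) hu (hU.le hu) hu0
  exact ⟨s, hus, hs⟩

theorem exists_isBigLine_ne (hU : IsSpecialSubgroup F k H U) {s : Submodule F V}
    (hs : IsBigLine F U s) : ∃ t, t ≠ s ∧ IsBigLine F U t := by
  have hV : Finite V := Module.finite_of_finite F
  have hq := hU.card_field
  obtain ⟨u, hu, hus⟩ : ∃ u ∈ U, u ∉ s := by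
    by_contra! h
    have h1 : U ⊓ s.toAddSubgroup = U := inf_eq_left.2 h
    have h2 := hs.2
    rw [h1, hU.card_eq] at h2
    have h3 : Nat.card F ^ 1 < Nat.card F ^ k :=
      Nat.pow_lt_pow_right (by omega) (by have := hU.two_le; omega)
    rw [pow_one] at h3
    omega
  obtain ⟨t, hut, ht⟩ := hU.exists_isBigLine hu (by rintro rfl; exact hus s.zero_mem)
  exact ⟨t, by rintro rfl; exact hus hut, ht⟩

omit [Finite F] [FiniteDimensional F V] in
theorem eq_of_mem_of_mem (hU : IsSpecialSubgroup F k H U) {s t : Submodule F V}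
    (hs : IsBigLine F U s) (ht : IsBigLine F U t) {w : V} (hws : w ∈ s) (hwt : w ∈ t)
    (hw : w ≠ 0) : s = t := by
  by_contra hst
  exact hw (Submodule.disjoint_def.1 (hU.disjoint_of_ne s t hs ht hst) w hws hwt)

omit [Finite F] [FiniteDimensional F V] in
theorem disjoint_inf_inf {s t : Submodule F V} (h : Disjoint s t) :
    Disjoint (U ⊓ s.toAddSubgroup) (U ⊓ t.toAddSubgroup) := by
  rw [AddSubgroup.disjoint_def]
  exact fun hx hy => Submodule.disjoint_def.1 h _ hx.2 hy.2

omit [Finite F] [FiniteDimensional F V] in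
theorem inf_mono_right_toAddSubgroup {s t : Submodule F V} (h : s ≤ t) :
    U ⊓ s.toAddSubgroup ≤ U ⊓ t.toAddSubgroup := fun _ hx => ⟨hx.1, h hx.2⟩

/-- The direct sum of U ∩ s and U ∩ t gives the lower bound, scatteredness the upper one. So U is
again extremal in the span, and there are further big lines inside it. -/
theorem card_inf_sup (hU : IsSpecialSubgroup F k H U) {s t : Submodule F V}
    (hs : IsBigLine F U s) (ht : IsBigLine F U t) (hst : s ≠ t) :
    finrank F (s ⊔ t : Submodule F V) = 2 * 2 ∧
      Nat.card (U ⊓ (s ⊔ t).toAddSubgroup : AddSubgroup V) = Nat.card F ^ 2 := by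
  have hV : Finite V := Module.finite_of_finite F
  have hq := hU.card_field
  have hd := hU.disjoint_of_ne s t hs ht hst
  have h1 : finrank F (s ⊔ t : Submodule F V) = 2 * 2 := by
    have := Submodule.finrank_sup_add_finrank_inf_eq s t
    rw [hd.eq_bot, finrank_bot, hs.1, ht.1] at this
    omega
  refine ⟨h1, le_antisymm ?_ ?_⟩
  · have := hU.scattered.card_inf_sq_le (by omega) (s ⊔ t)
    rw [h1, pow_mul] at this
    exact (Nat.pow_le_pow_iff_left (by norm_num)).1 this
  · have := AddSubgroup.card_mul_card_le
      (inf_mono_right_toAddSubgroup (U := U) (le_sup_left : s ≤ s ⊔ t))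
      (inf_mono_right_toAddSubgroup (U := U) (le_sup_right : t ≤ s ⊔ t)) (disjoint_inf_inf hd)
    rwa [hs.2, ht.2, ← pow_two] at this

/-- Between two different big lines, a third one gives a linear map that respects `U`. -/
theorem exists_transfer_of_ne (hU : IsSpecialSubgroup F k H U) {s t : Submodule F V}
    (hs : IsBigLine F U s) (ht : IsBigLine F U t) (hst : s ≠ t) {u₁ v₁ u₂ : V} (hu₁ : u₁ ∈ U)
    (hv₁ : v₁ ∈ U) (hu₁s : u₁ ∈ s) (hv₁s : v₁ ∈ s) (hind : LinearIndependent F ![u₁, v₁])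
    (hu₂ : u₂ ∈ U) (hu₂t : u₂ ∈ t) (hu₂0 : u₂ ≠ 0) :
    ∃ v₂ ∈ U, v₂ ∈ t ∧ LinearIndependent F ![u₂, v₂] ∧
      ∀ x y : F, x • u₁ + y • v₁ ∈ U ↔ x • u₂ + y • v₂ ∈ U := by
  have hV : Finite V := Module.finite_of_finite F
  have hd := hU.disjoint_of_ne s t hs ht hst
  have hd0 := Submodule.disjoint_def.1 hd
  obtain ⟨h4, hcard⟩ := hU.card_inf_sup hs ht hst
  have hu₁0 : u₁ ≠ 0 := hind.ne_zero 0
  have hsum0 : u₁ + u₂ ≠ 0 := fun h => hu₁0 (hd0 u₁ hu₁s (by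
    rw [eq_neg_of_add_eq_zero_left h]; exact t.neg_mem hu₂t))
  -- This third line is disjoint from s and from t, so it is the graph of a linear isomorphism from
  -- s to t that takes u₁ to u₂. The rest shows that this isomorphism maps U ∩ s onto U ∩ t.
  obtain ⟨r, hr, hur, hrbig⟩ := hU.exists_isBigLine_le h4 hcard (U.add_mem hu₁ hu₂)
    (Submodule.add_mem_sup hu₁s hu₂t) hsum0
  have hrs : r ≠ s := by
    rintro rfl
    have : u₂ ∈ r := by simpa using r.sub_mem hur hu₁s
    exact hu₂0 (hd0 u₂ this hu₂t)
  have hrt : r ≠ t := by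
    rintro rfl
    have : u₁ ∈ r := by simpa using r.sub_mem hur hu₂t
    exact hu₁0 (hd0 u₁ hu₁s this)
  have hdrs := Submodule.disjoint_def.1 (hU.disjoint_of_ne r s hrbig hs hrs)
  have hdrt := Submodule.disjoint_def.1 (hU.disjoint_of_ne r t hrbig ht hrt)
  have hdecomp := AddSubgroup.exists_add_eq_of_card_le
    (inf_mono_right_toAddSubgroup (U := U) (le_sup_left : s ≤ s ⊔ t))
    (inf_mono_right_toAddSubgroup (U := U) (le_sup_right : t ≤ s ⊔ t)) (disjoint_inf_inf hd)
    (by rw [hcard, hs.2, ht.2, pow_two])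
  choose! a ha b hb hab using hdecomp
  have hrU : ∀ w : (U ⊓ r.toAddSubgroup : AddSubgroup V),
      (w : V) ∈ U ⊓ (s ⊔ t).toAddSubgroup := fun w => ⟨w.2.1, hr w.2.2⟩
  -- The projection from U ∩ r to U ∩ s is injective because r is disjoint from t, and onto because
  -- both groups have q elements. The second projection is treated alike.
  have hproj₁ : ∀ c ∈ U, c ∈ s → ∃ d ∈ U, d ∈ t ∧ c + d ∈ r := by
    have hinj : Function.Injective (fun w : (U ⊓ r.toAddSubgroup : AddSubgroup V) =>
        (⟨a w, ha w (hrU w)⟩ : (U ⊓ s.toAddSubgroup : AddSubgroup V))) := by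
      intro w w' h
      have h' : a w = a w' := congrArg Subtype.val h
      have e : (w : V) - w' = b w - b w' := by
        calc (w : V) - w' = (a w + b w) - (a w' + b w') := by
              rw [hab w (hrU w), hab w' (hrU w')]
          _ = _ := by rw [h', add_sub_add_left_eq_sub]
      exact Subtype.ext (sub_eq_zero.1 (hdrt _ (r.sub_mem w.2.2 w'.2.2)
        (e ▸ t.sub_mem (hb w (hrU w)).2 (hb w' (hrU w')).2)))
    have hsurj := (hinj.bijective_of_nat_card_le (by rw [hs.2, hrbig.2])).2
    intro c hc hcs
    obtain ⟨w, hw⟩ := hsurj ⟨c, hc, hcs⟩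
    have hw' : a w = c := congrArg Subtype.val hw
    exact ⟨b w, (hb w (hrU w)).1, (hb w (hrU w)).2, by rw [← hw', hab w (hrU w)]; exact w.2.2⟩
  have hproj₂ : ∀ d ∈ U, d ∈ t → ∃ c ∈ U, c ∈ s ∧ c + d ∈ r := by
    have hinj : Function.Injective (fun w : (U ⊓ r.toAddSubgroup : AddSubgroup V) =>
        (⟨b w, hb w (hrU w)⟩ : (U ⊓ t.toAddSubgroup : AddSubgroup V))) := by
      intro w w' h
      have h' : b w = b w' := congrArg Subtype.val h
      have e : (w : V) - w' = a w - a w' := by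
        calc (w : V) - w' = (a w + b w) - (a w' + b w') := by
              rw [hab w (hrU w), hab w' (hrU w')]
          _ = _ := by rw [h', add_sub_add_right_eq_sub]
      exact Subtype.ext (sub_eq_zero.1 (hdrs _ (r.sub_mem w.2.2 w'.2.2)
        (e ▸ s.sub_mem (ha w (hrU w)).2 (ha w' (hrU w')).2)))
    have hsurj := (hinj.bijective_of_nat_card_le (by rw [ht.2, hrbig.2])).2
    intro c hc hcs
    obtain ⟨w, hw⟩ := hsurj ⟨c, hc, hcs⟩
    have hw' : b w = c := congrArg Subtype.val hw
    exact ⟨a w, (ha w (hrU w)).1, (ha w (hrU w)).2, by rw [← hw', hab w (hrU w)]; exact w.2.2⟩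
  obtain ⟨v₂, hv₂, hv₂t, hvr⟩ := hproj₁ v₁ hv₁ hv₁s
  have hcomb : ∀ x y : F, (x • u₁ + y • v₁) + (x • u₂ + y • v₂) ∈ r := fun x y => by
    have := r.add_mem (r.smul_mem x hur) (r.smul_mem y hvr)
    rwa [smul_add, smul_add, add_add_add_comm] at this
  have hms : ∀ x y : F, x • u₁ + y • v₁ ∈ s := fun x y =>
    s.add_mem (s.smul_mem x hu₁s) (s.smul_mem y hv₁s)
  have hmt : ∀ x y : F, x • u₂ + y • v₂ ∈ t := fun x y =>
    t.add_mem (t.smul_mem x hu₂t) (t.smul_mem y hv₂t)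
  refine ⟨v₂, hv₂, hv₂t, ?_, fun x y => ⟨fun h => ?_, fun h => ?_⟩⟩
  · rw [LinearIndependent.pair_iff] at hind ⊢
    intro x y hxy
    have h1 := hcomb x y
    rw [hxy, add_zero] at h1
    exact hind x y (hdrs _ h1 (hms x y))
  · obtain ⟨d, hd, hdt, hdr⟩ := hproj₁ _ h (hms x y)
    have h1 := r.sub_mem (hcomb x y) hdr
    rw [add_sub_add_left_eq_sub] at h1
    rw [sub_eq_zero.1 (hdrt _ h1 (t.sub_mem (hmt x y) hdt))]
    exact hd
  · obtain ⟨c, hc, hcs, hcr⟩ := hproj₂ _ h (hmt x y)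
    have h1 := r.sub_mem (hcomb x y) hcr
    rw [add_sub_add_right_eq_sub] at h1
    rw [sub_eq_zero.1 (hdrs _ h1 (s.sub_mem (hms x y) hcs))]
    exact hc

/-- For s = t, two transfers through another big line are composed. This supplies the linear maps of
s to itself that stabilize U ∩ s. -/
theorem exists_transfer (hU : IsSpecialSubgroup F k H U) {s t : Submodule F V}
    (hs : IsBigLine F U s) (ht : IsBigLine F U t) {u₁ v₁ u₂ : V} (hu₁ : u₁ ∈ U)
    (hv₁ : v₁ ∈ U) (hu₁s : u₁ ∈ s) (hv₁s : v₁ ∈ s) (hind : LinearIndependent F ![u₁, v₁])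
    (hu₂ : u₂ ∈ U) (hu₂t : u₂ ∈ t) (hu₂0 : u₂ ≠ 0) :
    ∃ v₂ ∈ U, v₂ ∈ t ∧ LinearIndependent F ![u₂, v₂] ∧
      ∀ x y : F, x • u₁ + y • v₁ ∈ U ↔ x • u₂ + y • v₂ ∈ U := by
  by_cases hst : s = t
  · subst hst
    obtain ⟨r, hrs, hr⟩ := hU.exists_isBigLine_ne hs
    obtain ⟨u, hu, _, _, hur, _, huv⟩ := hU.exists_pair hr
    obtain ⟨v, hv, hvr, h1, h2⟩ := hU.exists_transfer_of_ne hs hr hrs.symm hu₁ hv₁ hu₁s hv₁s hind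
      hu hur (huv.ne_zero 0)
    obtain ⟨v₂, hv₂, hv₂s, h3, h4⟩ := hU.exists_transfer_of_ne hr hs hrs hu hv hur hvr h1 hu₂
      hu₂t hu₂0
    exact ⟨v₂, hv₂, hv₂s, h3, fun x y => (h2 x y).trans (h4 x y)⟩
  · exact hU.exists_transfer_of_ne hs ht hst hu₁ hv₁ hu₁s hv₁s hind hu₂ hu₂t hu₂0

/-- The linear map `(x, y) ↦ x u + y v`. -/
noncomputable def _root_.pairMap (u v : V) : F × F →ₗ[F] V :=
  (LinearMap.toSpanSingleton F V u).coprod (LinearMap.toSpanSingleton F V v)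

omit [Finite F] [FiniteDimensional F V] in
theorem _root_.pairMap_apply (u v : V) (p : F × F) : pairMap u v p = p.1 • u + p.2 • v := by
  simp [pairMap]

omit [Finite F] [FiniteDimensional F V] in
theorem _root_.pairMap_injective {u v : V} (h : LinearIndependent F ![u, v]) :
    Function.Injective (pairMap (F := F) u v) := by
  rw [injective_iff_map_eq_zero]
  intro p hp
  rw [pairMap_apply] at hp
  exact Prod.ext (LinearIndependent.pair_iff.1 h _ _ hp).1
    (LinearIndependent.pair_iff.1 h _ _ hp).2

omit [Finite F] [FiniteDimensional F V] in
theorem _root_.range_pairMap {s : Submodule F V} (hs : finrank F s = 2) {u v : V} (hu : u ∈ s)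
    (hv : v ∈ s) (h : LinearIndependent F ![u, v]) : LinearMap.range (pairMap (F := F) u v) = s := by
  rw [eq_span_pair hs hu hv h]
  ext w
  simp [Submodule.mem_span_pair, pairMap_apply]

/-- Transfers from a big line to itself make the stabilizer of U ∩ s transitive, and a graph
argument makes it free; the result on planes then yields σ. Transfers to the other big lines
preserve membership in U coordinatewise, so they carry the same σ everywhere. -/
theorem exists_monomial_form (hU : IsSpecialSubgroup F k H U) :
    ∃ σ : F →+* F, ∀ s, IsBigLine F U s → ∃ e₁ ∈ s, ∃ e₂ ∈ s, LinearIndependent F ![e₁, e₂] ∧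
      ∀ x y : F, x • e₁ + y • e₂ ∈ U ↔ y = σ x := by
  have hV : Finite V := Module.finite_of_finite F
  have hq := hU.card_field
  have hk := hU.two_le
  obtain ⟨w, hw, hw0, -⟩ := AddSubgroup.exists_mem_ne_ne (A := U) (by
    rw [hU.card_eq]
    calc 2 < Nat.card F ^ 1 := by rw [pow_one]; omega
      _ ≤ _ := Nat.pow_le_pow_right (by omega) (by omega)) 0
  obtain ⟨s, -, hs⟩ := hU.exists_isBigLine hw hw0
  obtain ⟨u₁, hu₁, v₁, hv₁, hu₁s, hv₁s, hind⟩ := hU.exists_pair hs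
  set L := pairMap (F := F) u₁ v₁ with hL
  have hLinj := pairMap_injective hind
  have hLrange := range_pairMap hs.1 hu₁s hv₁s hind
  have hLs : ∀ p, L p ∈ s := fun p => by rw [← hLrange]; exact ⟨p, rfl⟩
  set A : AddSubgroup (F × F) := U.comap L.toAddMonoidHom
  have hAmem : ∀ p, p ∈ A ↔ L p ∈ U := fun p => Iff.rfl
  have hA : ScatteredSubgroup F A := fun p hp hp0 c hc => by
    refine hU.scattered (L p) hp (fun h => hp0 (hLinj (by rw [h, map_zero]))) c ?_
    rw [← map_smul]; exact hc
  have hcard : Nat.card A = Nat.card F := by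
    rw [← hs.2]
    refine Nat.card_congr (Equiv.ofBijective (fun p => ⟨L p, p.2, hLs p⟩) ⟨fun p p' h => ?_, ?_⟩)
    · exact Subtype.ext (hLinj (congrArg Subtype.val h))
    · rintro ⟨z, hz, hzs⟩
      obtain ⟨p, rfl⟩ : z ∈ LinearMap.range L := by rw [hLrange]; exact hzs
      exact ⟨⟨p, hz⟩, rfl⟩
  have hL10 : L (1, 0) = u₁ := by simp [hL, pairMap_apply]
  have hL01 : L (0, 1) = v₁ := by simp [hL, pairMap_apply]
  have hLeq : ∀ p : F × F, L p = p.1 • u₁ + p.2 • v₁ := fun p => pairMap_apply _ _ p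
  have h10 : ((1, 0) : F × F) ∈ A := by rw [hAmem, hL10]; exact hu₁
  have h10' : ((1, 0) : F × F) ≠ 0 := fun h => one_ne_zero (congrArg Prod.fst h)
  have htrans : ∀ w ∈ A, w ≠ 0 → ∃ φ ∈ A.endStabilizer F, φ (1, 0) = w := by
    intro w hw hw0
    obtain ⟨v', hv', hv's, -, h⟩ := hU.exists_transfer hs hs hu₁ hv₁ hu₁s hv₁s hind
      ((hAmem w).1 hw) (hLs w) (fun h => hw0 (hLinj (by rw [h, map_zero])))
    obtain ⟨w', rfl⟩ : v' ∈ LinearMap.range L := by rw [hLrange]; exact hv's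
    refine ⟨pairMap w w', fun p hp => ?_, by simp [pairMap_apply]⟩
    rw [hAmem, hLeq, h] at hp
    rwa [pairMap_apply, hAmem, map_add, map_smul, map_smul]
  -- The graph of φ, read as a map from s to another big line t, is the range of M below. It
  -- contains at least q elements of U and is therefore a big line. If φ kills w, the graph shares
  -- `L w` with s, so it equals s and φ vanishes.
  have hfree : ∀ φ ∈ A.endStabilizer F, ∀ w ∈ A, w ≠ 0 → φ w = 0 → φ = 0 := by
    intro φ hφ w hw hw0 hφw
    obtain ⟨t, hts, ht⟩ := hU.exists_isBigLine_ne hs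
    obtain ⟨u₂, hu₂, _, _, hu₂t, _, hu₂v⟩ := hU.exists_pair ht
    obtain ⟨v₂, hv₂, hv₂t, hind₂, h⟩ := hU.exists_transfer hs ht hu₁ hv₁ hu₁s hv₁s hind hu₂ hu₂t
      (hu₂v.ne_zero 0)
    set L' := pairMap (F := F) u₂ v₂ with hL'
    have hL't : ∀ p, L' p ∈ t := fun p => by
      rw [← range_pairMap ht.1 hu₂t hv₂t hind₂]; exact ⟨p, rfl⟩
    have hL'U : ∀ p ∈ A, L' p ∈ U := fun p hp => by
      rw [hAmem, hLeq, h] at hp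
      rwa [hL', pairMap_apply]
    have hd := Submodule.disjoint_def.1 (hU.disjoint_of_ne s t hs ht hts.symm)
    let M : F × F →ₗ[F] V := L + L'.comp φ
    have hMinj : Function.Injective M := by
      rw [injective_iff_map_eq_zero]
      intro p hp
      have h1 : L p = L' (-(φ p)) := by
        rw [map_neg]; exact eq_neg_of_add_eq_zero_left hp
      exact hLinj (by rw [hd _ (hLs p) (h1 ▸ hL't _), map_zero])
    have hr2 : finrank F (LinearMap.range M) = 2 := by
      rw [LinearMap.finrank_range_of_inj hMinj]; simp
    have hr : IsBigLine F U (LinearMap.range M) := by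
      refine hU.isBigLine_of_lt hr2 (lt_of_lt_of_le (b := Nat.card A) (by omega) ?_)
      refine Nat.card_le_card_of_injective
        (fun p : A => (⟨M p, U.add_mem p.2 (hL'U _ (hφ p p.2)), ⟨p, rfl⟩⟩ :
          (U ⊓ (LinearMap.range M).toAddSubgroup : AddSubgroup V))) fun p p' h => ?_
      exact Subtype.ext (hMinj (congrArg Subtype.val h))
    have hMw : M w = L w := by
      change L w + L' (φ w) = L w
      rw [hφw, map_zero, add_zero]
    have hrs : LinearMap.range M = s :=
      hU.eq_of_mem_of_mem hr hs (w := L w) ⟨w, hMw⟩ (hLs w)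
        (fun h => hw0 (hLinj (by rw [h, map_zero])))
    refine LinearMap.ext fun p => ?_
    have h1 : M p ∈ s := by rw [← hrs]; exact ⟨p, rfl⟩
    have h2 : L' (φ p) ∈ s := by
      have := s.sub_mem h1 (hLs p)
      rwa [show M p = L p + L' (φ p) from rfl, add_sub_cancel_left] at this
    exact pairMap_injective hind₂ (by rw [← hL', hd _ h2 (hL't _)]; simp)
  obtain ⟨p₁, p₂, σ, hp, hσ⟩ := hA.exists_monomial_form (by omega) (by simp) hcard h10 h10' htrans
    hfree
  refine ⟨σ, fun t ht => ?_⟩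
  obtain ⟨u₂, hu₂, _, _, hu₂t, _, hu₂v⟩ := hU.exists_pair ht
  obtain ⟨v₂, hv₂, hv₂t, hind₂, h⟩ := hU.exists_transfer hs ht hu₁ hv₁ hu₁s hv₁s hind hu₂ hu₂t
    (hu₂v.ne_zero 0)
  set L' := pairMap (F := F) u₂ v₂ with hL'
  have hL't : ∀ p, L' p ∈ t := fun p => by
    rw [← range_pairMap ht.1 hu₂t hv₂t hind₂]; exact ⟨p, rfl⟩
  refine ⟨L' p₁, hL't _, L' p₂, hL't _, ?_, fun x y => ?_⟩
  · rw [LinearIndependent.pair_iff] at hp ⊢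
    intro x y hxy
    rw [← map_smul, ← map_smul, ← map_add] at hxy
    exact hp x y (pairMap_injective hind₂ (by rw [← hL', hxy, map_zero]))
  · rw [← map_smul, ← map_smul, ← map_add, hL', pairMap_apply, ← h, ← hLeq, ← hAmem, hσ]

/-- `U` is `{(x, σ(x))}` for a suitable identification of `H` with `F ^ k × F ^ k`. -/
theorem exists_normal_form (hU : IsSpecialSubgroup F k H U) :
    ∃ (σ : F →+* F) (Φ : (Fin k → F) × (Fin k → F) →ₗ[F] V), Function.Injective Φ ∧
      LinearMap.range Φ = H ∧ ∀ w, w ∈ U ↔ ∃ x : Fin k → F, w = Φ (x, σ ∘ x) := by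
  have hV : Finite V := Module.finite_of_finite F
  have hq := hU.card_field
  obtain ⟨σ, hσ⟩ := hU.exists_monomial_form
  -- Big lines are adjoined one at a time. At each stage U is extremal in the range E, so the
  -- nonzero elements of U ∩ E lie on big lines inside E.
  have key : ∀ j ≤ k, ∃ Φ : (Fin j → F) × (Fin j → F) →ₗ[F] V, Function.Injective Φ ∧
      LinearMap.range Φ ≤ H ∧ ∀ x : Fin j → F, Φ (x, σ ∘ x) ∈ U := by
    intro j
    induction j with
    | zero =>
      intro _
      refine ⟨0, fun _ _ _ => Subsingleton.elim _ _, ?_, fun x => U.zero_mem⟩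
      rw [LinearMap.range_zero]; exact bot_le
    | succ j ih =>
      intro hj
      obtain ⟨Φ, hinj, hrange, hΦU⟩ := ih (by omega)
      set E := LinearMap.range Φ
      have hE : finrank F E = 2 * j := by
        rw [LinearMap.finrank_range_of_inj hinj]; simp; omega
      have hcardE : Nat.card (U ⊓ E.toAddSubgroup : AddSubgroup V) = Nat.card F ^ j := by
        refine le_antisymm ?_ ?_
        · have := hU.scattered.card_inf_sq_le (by omega) E
          rw [hE, mul_comm, pow_mul] at this
          exact (Nat.pow_le_pow_iff_left (by norm_num)).1 this
        · have := Nat.card_le_card_of_injective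
            (fun x : Fin j → F => (⟨Φ (x, σ ∘ x), hΦU x, ⟨_, rfl⟩⟩ :
              (U ⊓ E.toAddSubgroup : AddSubgroup V))) fun x y h =>
                congrArg Prod.fst (hinj (congrArg Subtype.val h))
          rwa [Nat.card_fun, Nat.card_eq_fintype_card (α := Fin j), Fintype.card_fin] at this
      obtain ⟨u, hu, huE⟩ : ∃ u ∈ U, u ∉ E := by
        by_contra! h
        have h1 : U ⊓ E.toAddSubgroup = U := inf_eq_left.2 h
        rw [h1, hU.card_eq] at hcardE
        have := Nat.pow_lt_pow_right (a := Nat.card F) (by omega) hj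
        omega
      have hu0 : u ≠ 0 := by rintro rfl; exact huE E.zero_mem
      obtain ⟨s, hus, hs⟩ := hU.exists_isBigLine hu hu0
      -- A common nonzero element would lie on a big line inside E. That line would be s, which
      -- contains u outside E.
      have hdU : Disjoint (U ⊓ s.toAddSubgroup) (U ⊓ E.toAddSubgroup) := by
        rw [AddSubgroup.disjoint_def]
        intro w hws hwE
        by_contra hw0
        obtain ⟨r, hrE, hwr, hr⟩ := hU.exists_isBigLine_le hE hcardE hwE.1 hwE.2 hw0
        have := hU.eq_of_mem_of_mem hr hs hwr hws.2 hw0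
        exact huE (hrE (this ▸ hus))
      -- If s met E outside U, the sum s ⊔ E would have dimension at most 2j + 1 but contain at
      -- least q^(j+1) elements of U, too many for a scattered group.
      have hd : Disjoint s E := by
        rw [disjoint_iff]
        by_contra hbot
        have h1 := Submodule.finrank_sup_add_finrank_inf_eq s E
        have h2 : 1 ≤ finrank F (s ⊓ E : Submodule F V) :=
          Submodule.one_le_finrank_iff.2 hbot
        rw [hs.1, hE] at h1
        have h3 := hU.scattered.card_inf_sq_le (by omega) (s ⊔ E)
        have h4 := AddSubgroup.card_mul_card_le
          (inf_mono_right_toAddSubgroup (U := U) (le_sup_left : s ≤ s ⊔ E))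
          (inf_mono_right_toAddSubgroup (U := U) (le_sup_right : E ≤ s ⊔ E)) hdU
        rw [hs.2, hcardE, mul_comm, ← pow_succ] at h4
        have h5 := (Nat.pow_le_pow_left h4 2).trans h3
        rw [← pow_mul] at h5
        have := (Nat.pow_le_pow_iff_right (by omega : 1 < Nat.card F)).1 h5
        omega
      obtain ⟨e₁, he₁, e₂, he₂, hind, hform⟩ := hσ s hs
      let T : (Fin (j + 1) → F) →ₗ[F] (Fin j → F) := LinearMap.funLeft F F Fin.succ
      let P : (Fin (j + 1) → F) →ₗ[F] F := LinearMap.proj 0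
      let Ψ : (Fin (j + 1) → F) × (Fin (j + 1) → F) →ₗ[F] V :=
        Φ.comp (T.prodMap T) + (pairMap e₁ e₂).comp (P.prodMap P)
      have hΨ : ∀ p, Ψ p = Φ (p.1 ∘ Fin.succ, p.2 ∘ Fin.succ) + (p.1 0 • e₁ + p.2 0 • e₂) :=
        fun p => by
          simp only [Ψ, LinearMap.add_apply, LinearMap.comp_apply, pairMap_apply]
          rfl
      have hsmem : ∀ x y : F, x • e₁ + y • e₂ ∈ s := fun x y =>
        s.add_mem (s.smul_mem x he₁) (s.smul_mem y he₂)
      refine ⟨Ψ, ?_, ?_, fun x => ?_⟩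
      · rw [injective_iff_map_eq_zero]
        intro p hp
        rw [hΨ] at hp
        have h1 : p.1 0 • e₁ + p.2 0 • e₂ = 0 := by
          refine Submodule.disjoint_def.1 hd _ (hsmem _ _) ?_
          rw [eq_neg_of_add_eq_zero_right hp]
          exact E.neg_mem ⟨_, rfl⟩
        rw [h1, add_zero] at hp
        have h2 := (injective_iff_map_eq_zero Φ).1 hinj _ hp
        obtain ⟨h3, h4⟩ := LinearIndependent.pair_iff.1 hind _ _ h1
        refine Prod.ext (funext fun i => ?_) (funext fun i => ?_)
        · refine Fin.cases h3 (fun i => ?_) i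
          exact congrFun (congrArg Prod.fst h2) i
        · refine Fin.cases h4 (fun i => ?_) i
          exact congrFun (congrArg Prod.snd h2) i
      · rintro _ ⟨p, rfl⟩
        rw [hΨ]
        exact H.add_mem (hrange ⟨_, rfl⟩) (hU.le_of_isBigLine hs (hsmem _ _))
      · rw [hΨ]
        exact U.add_mem (hΦU _) ((hform _ _).2 rfl)
  obtain ⟨Φ, hinj, hrange, hΦU⟩ := key k le_rfl
  refine ⟨σ, Φ, hinj, ?_, fun w => ⟨fun hw => ?_, ?_⟩⟩
  · refine Submodule.eq_of_le_of_finrank_eq hrange ?_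
    rw [hU.finrank_eq, LinearMap.finrank_range_of_inj hinj]; simp; omega
  · have h1 : Function.Injective (fun x : Fin k → F => (⟨Φ (x, σ ∘ x), hΦU x⟩ : U)) :=
      fun x y h => congrArg Prod.fst (hinj (congrArg Subtype.val h))
    obtain ⟨x, hx⟩ := (h1.bijective_of_nat_card_le (by
      rw [hU.card_eq, Nat.card_fun, Nat.card_eq_fintype_card (α := Fin k),
        Fintype.card_fin])).2 ⟨w, hw⟩
    exact ⟨x, (congrArg Subtype.val hx).symm⟩
  · rintro ⟨x, rfl⟩
    exact hΦU x

end IsSpecialSubgroup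

end NormalFormTheorem

/-! ### Counting by fibres -/

section FiberCounting

variable {α β γ : Type*} [Finite α] [Finite β] [Finite γ]

omit [Finite β] [Finite γ] in
theorem ncard_eq_sum_fiber [Fintype γ] (X : Set α) (f : α → γ) :
    X.ncard = ∑ c, (X ∩ f ⁻¹' {c}).ncard := by
  classical
  have := Fintype.ofFinite α
  rw [Set.ncard_eq_toFinset_card', Finset.card_eq_sum_card_fiberwise (f := f) (t := Finset.univ)
    (fun _ _ => Finset.mem_coe.2 (Finset.mem_univ _))]
  refine Finset.sum_congr rfl fun c _ => ?_
  rw [Set.ncard_eq_toFinset_card']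
  congr 1
  ext x
  simp

theorem mul_ncard_le_mul_ncard_of_fiber {X : Set α} {Y : Set β} (f : α → γ) (g : β → γ) {n m : ℕ}
    (h : ∀ c, n * (X ∩ f ⁻¹' {c}).ncard ≤ m * (Y ∩ g ⁻¹' {c}).ncard) :
    n * X.ncard ≤ m * Y.ncard := by
  have := Fintype.ofFinite γ
  rw [ncard_eq_sum_fiber X f, ncard_eq_sum_fiber Y g, Finset.mul_sum, Finset.mul_sum]
  exact Finset.sum_le_sum fun c _ => h c

omit [Finite β] in
theorem dvd_ncard_of_fiber {X : Set α} (f : α → γ) {m : ℕ}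
    (h : ∀ x ∈ X, (X ∩ f ⁻¹' {f x}).ncard = m) : m ∣ X.ncard := by
  have := Fintype.ofFinite γ
  rw [ncard_eq_sum_fiber X f]
  refine Finset.dvd_sum fun c _ => ?_
  rcases (X ∩ f ⁻¹' {c}).eq_empty_or_nonempty with h0 | ⟨x, hx, rfl⟩
  · rw [h0, Set.ncard_empty]; exact dvd_zero m
  · rw [h x hx]

omit [Finite β] in
theorem ncard_eq_ncard_image_mul {X : Set α} (f : α → γ) {m : ℕ}
    (h : ∀ x ∈ X, (X ∩ f ⁻¹' {f x}).ncard = m) : X.ncard = (f '' X).ncard * m := by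
  classical
  have := Fintype.ofFinite γ
  have := Fintype.ofFinite α
  rw [ncard_eq_sum_fiber X f, Set.ncard_eq_toFinset_card' (f '' X), ← smul_eq_mul,
    ← Finset.sum_const, ← Finset.sum_subset (Finset.subset_univ (f '' X).toFinset)]
  · refine Finset.sum_congr rfl fun c hc => ?_
    obtain ⟨x, hx, rfl⟩ := Set.mem_toFinset.1 hc
    exact h x hx
  · intro c _ hc
    rw [Set.ncard_eq_zero]
    refine Set.eq_empty_of_forall_notMem fun x hx => hc ?_
    exact Set.mem_toFinset.2 ⟨x, hx.1, hx.2⟩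

omit [Finite β] in
theorem ncard_le_mul_ncard_image {X : Set α} (f : α → γ) {m : ℕ}
    (h : ∀ x ∈ X, (X ∩ f ⁻¹' {f x}).ncard ≤ m) : X.ncard ≤ m * (f '' X).ncard := by
  classical
  have := Fintype.ofFinite γ
  have := Fintype.ofFinite α
  rw [ncard_eq_sum_fiber X f, Set.ncard_eq_toFinset_card' (f '' X), mul_comm, ← smul_eq_mul,
    ← Finset.sum_const, ← Finset.sum_subset (Finset.subset_univ (f '' X).toFinset)]
  · refine Finset.sum_le_sum fun c hc => ?_
    obtain ⟨x, hx, rfl⟩ := Set.mem_toFinset.1 hc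
    exact h x hx
  · intro c _ hc
    rw [Set.ncard_eq_zero]
    refine Set.eq_empty_of_forall_notMem fun x hx => hc ?_
    exact Set.mem_toFinset.2 ⟨x, hx.1, hx.2⟩

end FiberCounting

/-! ### Points and lines as subspaces -/

section ProjectivePoints

variable {F : Type u} [Field F] {V : Type v} [AddCommGroup V] [Module F V]

theorem Projectivization.submodule_eq_span {P : ℙ F V} {v : V} (hv : v ∈ P.submodule)
    (hv0 : v ≠ 0) : P.submodule = Submodule.span F {v} := by
  have : FiniteDimensional F P.submodule := .of_finrank_pos (by rw [P.finrank_submodule]; simp)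
  refine (Submodule.eq_of_le_of_finrank_eq ?_ ?_).symm
  · rwa [Submodule.span_singleton_le_iff_mem]
  · rw [P.finrank_submodule, finrank_span_singleton hv0]

theorem Projectivization.mem_pointsOf_iff {P : ℙ F V} {v : V} (hv : v ∈ P.submodule)
    (hv0 : v ≠ 0) {s : Submodule F V} : P ∈ pointsOf s ↔ v ∈ s := by
  change P.submodule ≤ s ↔ v ∈ s
  rw [P.submodule_eq_span hv hv0, Submodule.span_singleton_le_iff_mem]

theorem Projectivization.eq_of_mem_of_mem {P R : ℙ F V} {v : V} (hP : v ∈ P.submodule)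
    (hR : v ∈ R.submodule) (hv0 : v ≠ 0) : P = R :=
  Projectivization.submodule_injective
    ((P.submodule_eq_span hP hv0).trans (R.submodule_eq_span hR hv0).symm)

theorem Projectivization.mem_submodule_mk (v : V) (hv : v ≠ 0) :
    v ∈ (Projectivization.mk F v hv).submodule := by
  rw [Projectivization.submodule_mk]; exact Submodule.mem_span_singleton_self v

theorem Projectivization.rep_mem_submodule (P : ℙ F V) : P.rep ∈ P.submodule := by
  rw [P.submodule_eq]; exact Submodule.mem_span_singleton_self _

theorem ncard_pointsOf [Finite F] [FiniteDimensional F V] {s : Submodule F V}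
    (hs : finrank F s = 2) : (pointsOf s).ncard = Nat.card F + 1 := by
  rw [← Projectivization.card_of_finrank_two F s hs]
  rw [← Set.ncard_univ, ← Set.ncard_image_of_injective Set.univ
    (Projectivization.map_injective s.subtype s.injective_subtype)]
  congr 1
  ext P
  simp only [Set.image_univ, Set.mem_range]
  constructor
  · intro hP
    have hr : P.rep ∈ s := hP P.rep_mem_submodule
    refine ⟨Projectivization.mk F ⟨P.rep, hr⟩ fun h => P.rep_nonzero (congrArg Subtype.val h), ?_⟩
    rw [Projectivization.map_mk]
    exact P.mk_rep
  · rintro ⟨P, rfl⟩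
    induction P using Projectivization.ind with
    | h v hv =>
      rw [Projectivization.map_mk]
      have hv0 : (v : V) ≠ 0 := fun h => hv (Subtype.ext h)
      exact (Projectivization.mem_pointsOf_iff (Projectivization.mem_submodule_mk (v : V) hv0)
        hv0).2 v.2

theorem finrank_sup_of_notMem {P : ℙ F V} {v : V} [FiniteDimensional F V]
    (hv : v ∉ P.submodule) : finrank F (Submodule.span F {v} ⊔ P.submodule : Submodule F V) = 2 := by
  have hv0 : v ≠ 0 := by rintro rfl; exact hv P.submodule.zero_mem
  have h1 := Submodule.finrank_sup_add_finrank_inf_eq (Submodule.span F {v}) P.submodule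
  have h2 : Submodule.span F {v} ⊓ P.submodule = ⊥ := by
    rw [eq_bot_iff]
    rintro x ⟨hx, hxP⟩
    obtain ⟨c, rfl⟩ := Submodule.mem_span_singleton.1 hx
    by_contra hc
    have hc0 : c ≠ 0 := by rintro rfl; exact hc (by simp)
    exact hv (by
      have := P.submodule.smul_mem c⁻¹ hxP
      rwa [smul_smul, inv_mul_cancel₀ hc0, one_smul] at this)
  rw [h2, finrank_bot, finrank_span_singleton hv0, P.finrank_submodule] at h1
  omega

theorem sup_eq_of_finrank_two {P : ℙ F V} {v : V} [FiniteDimensional F V] {s : Submodule F V}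
    (hs : finrank F s = 2) (hP : P ∈ pointsOf s) (hvs : v ∈ s) (hv : v ∉ P.submodule) :
    Submodule.span F {v} ⊔ P.submodule = s :=
  Submodule.eq_of_le_of_finrank_eq
    (sup_le ((Submodule.span_singleton_le_iff_mem _ _).2 hvs) hP)
    (by rw [finrank_sup_of_notMem hv, hs])

theorem card_map_mkQ_mul [Finite F] [FiniteDimensional F V] {N E : Submodule F V} (h : N ≤ E) :
    Nat.card (E.map N.mkQ) * Nat.card F ^ finrank F N = Nat.card F ^ finrank F E := by
  rw [card_eq_card_pow_finrank (F := F) (W := E.map N.mkQ), ← pow_add]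
  congr 1
  have e1 := LinearMap.finrank_range_add_finrank_ker (N.mkQ.domRestrict E)
  rw [LinearMap.range_domRestrict, LinearMap.ker_domRestrict, Submodule.ker_mkQ] at e1
  rw [← e1]
  congr 1
  exact (Submodule.comapSubtypeEquivOfLe h).finrank_eq.symm

end ProjectivePoints

/-! ### Directions: no three points of A are collinear -/

section Directions

variable {F : Type u} [Field F] {V : Type v} [AddCommGroup V] [Module F V]

/-- The affine point set `A` has `q ^ k` points and determines the set `D` of `q ^ k - 1`
directions, and every line has `0`, `1`, `3` or `q - 1` points in common with `D`. -/
structure HasSpecialDirections (k : ℕ) (A : Set V) (D : Set (ℙ F V)) : Prop where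
  card_field : 16 ≤ Nat.card F
  two_eq_zero : (2 : F) = 0
  two_le : 2 ≤ k
  ncard_eq : A.ncard = Nat.card F ^ k
  mem_iff : ∀ R : ℙ F V, R ∈ D ↔ ∃ a ∈ A, ∃ b ∈ A, a ≠ b ∧ a - b ∈ R.submodule
  ncard_directions : D.ncard = Nat.card F ^ k - 1
  ncard_line : ∀ s : Submodule F V, finrank F s = 2 →
    (D ∩ pointsOf s).ncard ∈ ({0, 1, 3, Nat.card F - 1} : Set ℕ)

namespace HasSpecialDirections

variable {k : ℕ} {A : Set V} {D : Set (ℙ F V)}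

theorem exists_direction (hA : HasSpecialDirections k A D) {a b : V} (ha : a ∈ A) (hb : b ∈ A)
    (hab : a ≠ b) : ∃ R ∈ D, a - b ∈ R.submodule :=
  ⟨Projectivization.mk F (a - b) (sub_ne_zero.2 hab),
    (hA.mem_iff _).2 ⟨a, ha, b, hb, hab, Projectivization.mem_submodule_mk _ _⟩,
    Projectivization.mem_submodule_mk _ _⟩

variable [Finite F] [FiniteDimensional F V]

theorem exists_notMem (hA : HasSpecialDirections k A D) {s : Submodule F V}
    (hs : finrank F s = 2) : ∃ R ∈ pointsOf s, R ∉ D := by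
  have hV : Finite V := Module.finite_of_finite F
  have hq := hA.card_field
  by_contra! h
  have h1 : D ∩ pointsOf s = pointsOf s := Set.inter_eq_right.2 h
  have h2 := hA.ncard_line s hs
  rw [h1, ncard_pointsOf hs] at h2
  simp only [Set.mem_insert_iff, Set.mem_singleton_iff] at h2
  omega

/-- All q + 1 points of s cannot be directions, as q + 1 is not an admitted number. The q parallels
to a non-direction in a plane a + s each contain at most one point of A. -/
theorem ncard_translate_le (hA : HasSpecialDirections k A D) {s : Submodule F V}
    (hs : finrank F s = 2) (a : V) : {x ∈ A | x - a ∈ s}.ncard ≤ Nat.card F := by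
  have hV : Finite V := Module.finite_of_finite F
  have hq := hA.card_field
  obtain ⟨R, hRs, hRD⟩ := hA.exists_notMem hs
  have h1 := card_map_mkQ_mul (F := F) (N := R.submodule) (E := s) hRs
  rw [R.finrank_submodule, hs, pow_one, pow_two] at h1
  have h2 := Nat.eq_of_mul_eq_mul_right (by omega) h1
  have : Finite (V ⧸ R.submodule) := Module.finite_of_finite F
  rw [← h2]
  refine Set.ncard_le_ncard_of_injOn (fun x => R.submodule.mkQ (x - a))
    (t := (s.map R.submodule.mkQ : Set (V ⧸ R.submodule))) ?_ ?_ (Set.toFinite _)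
  · intro x hx
    exact ⟨_, hx.2, rfl⟩
  · intro x hx y hy hxy
    by_contra hne
    refine hRD ((hA.mem_iff R).2 ⟨x, hx.1, y, hy.1, hne, ?_⟩)
    have : R.submodule.mkQ ((x - a) - (y - a)) = 0 := by
      rw [map_sub]; exact sub_eq_zero.2 hxy
    rwa [sub_sub_sub_cancel_right, Submodule.mkQ_apply, Submodule.Quotient.mk_eq_zero] at this

/-- No three points of `A` are collinear. -/
theorem not_collinear (hA : HasSpecialDirections k A D) {a b c : V} (ha : a ∈ A) (hb : b ∈ A)
    (hc : c ∈ A) (hab : b ≠ a) (hac : c ≠ a) (hbc : b ≠ c) (d : ℙ F V)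
    (hbd : b - a ∈ d.submodule) (hcd : c - a ∈ d.submodule) : False := by
  have hV : Finite V := Module.finite_of_finite F
  have hq := hA.card_field
  have hk := hA.two_le
  set q := Nat.card F with hqdef
  have hqk : q * q ≤ q ^ k := by
    rw [← pow_two]; exact Nat.pow_le_pow_right (by omega) hk
  have hqq : 16 * q ≤ q * q := Nat.mul_le_mul_right q hq
  have hdD : d ∈ D := (hA.mem_iff d).2 ⟨b, hb, a, ha, hab, hbd⟩
  set L := {x ∈ A | x - a ∈ d.submodule} with hL
  have hLA : L ⊆ A := fun x hx => hx.1
  have hLcard : L.ncard ≤ q := by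
    have h1 : Nat.card d.submodule = q := by
      rw [card_eq_card_pow_finrank (F := F), d.finrank_submodule, pow_one]
    rw [← h1]
    exact Set.ncard_le_ncard_of_injOn (fun x => x - a) (t := (d.submodule : Set V))
      (fun x hx => hx.2) (fun x _ y _ h => sub_left_injective h) (Set.toFinite _)
  have h3L : 3 ≤ L.ncard := by
    have h1 : ({a, b, c} : Set V) ⊆ L := by
      rintro x (rfl | rfl | rfl)
      · exact ⟨ha, by simp⟩
      · exact ⟨hb, hbd⟩
      · exact ⟨hc, hcd⟩
    have h2 : ({a, b, c} : Set V).ncard = 3 :=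
      Set.ncard_eq_three.2 ⟨a, b, c, hab.symm, hac.symm, hbc, rfl⟩
    rw [← h2]
    exact Set.ncard_le_ncard h1 (Set.toFinite _)
  -- The count is done plane by plane through the collinear set L. A plane with a further point of A
  -- has q - 1 directions, so q - 2 besides d, and at most q - |L| points of A off L.
  have hmain : (q - 2) * (A \ L).ncard ≤ (q - L.ncard) * (D \ {d}).ncard := by
    refine mul_ncard_le_mul_ncard_of_fiber
      (fun x => (Submodule.span F {x - a} ⊔ d.submodule : Submodule F V))
      (fun P : ℙ F V => (Submodule.span F {P.rep} ⊔ d.submodule : Submodule F V)) fun s => ?_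
    rcases ((A \ L) ∩ (fun x => (Submodule.span F {x - a} ⊔ d.submodule : Submodule F V)) ⁻¹'
      {s}).eq_empty_or_nonempty with h0 | ⟨x, ⟨hxA, hxL⟩, hxs⟩
    · rw [h0, Set.ncard_empty, mul_zero]; exact Nat.zero_le _
    have hxs' : (Submodule.span F {x - a} ⊔ d.submodule : Submodule F V) = s := hxs
    have hxd : x - a ∉ d.submodule := fun h => hxL ⟨hxA, h⟩
    have hs2 : finrank F s = 2 := by rw [← hxs']; exact finrank_sup_of_notMem hxd
    have hds : d ∈ pointsOf s := by
      change d.submodule ≤ s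
      rw [← hxs']; exact le_sup_right
    have hxas : x - a ∈ s := by
      rw [← hxs']
      exact Submodule.mem_sup_left (Submodule.mem_span_singleton_self _)
    have hDs : (D \ {d}) ∩ (fun P : ℙ F V => (Submodule.span F {P.rep} ⊔ d.submodule :
        Submodule F V)) ⁻¹' {s} = (D ∩ pointsOf s) \ {d} := by
      ext P
      simp only [Set.mem_inter_iff, Set.mem_sdiff, Set.mem_singleton_iff, Set.mem_preimage]
      constructor
      · rintro ⟨⟨h1, h2⟩, h3⟩
        refine ⟨⟨h1, ?_⟩, h2⟩
        rw [Projectivization.mem_pointsOf_iff P.rep_mem_submodule P.rep_nonzero, ← h3]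
        exact Submodule.mem_sup_left (Submodule.mem_span_singleton_self _)
      · rintro ⟨⟨h1, h2⟩, h3⟩
        refine ⟨⟨h1, h3⟩, sup_eq_of_finrank_two hs2 hds (h2 P.rep_mem_submodule) fun h => ?_⟩
        exact h3 (Projectivization.eq_of_mem_of_mem P.rep_mem_submodule h P.rep_nonzero)
    have hdDs : d ∈ D ∩ pointsOf s := ⟨hdD, hds⟩
    rw [hDs, Set.ncard_sdiff_singleton_of_mem hdDs]
    have hdir : ∀ y ∈ L, ∃ R ∈ D ∩ pointsOf s, x - y ∈ R.submodule := fun y hy => by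
      have hxy : x ≠ y := by rintro rfl; exact hxL hy
      obtain ⟨R, hR, hRm⟩ := hA.exists_direction hxA hy.1 hxy
      refine ⟨R, ⟨hR, ?_⟩, hRm⟩
      rw [Projectivization.mem_pointsOf_iff hRm (sub_ne_zero.2 hxy)]
      have := s.sub_mem hxas (hds hy.2)
      rwa [sub_sub_sub_cancel_right] at this
    have hxyd : ∀ y ∈ L, x - y ∉ d.submodule := fun y hy h => hxd (by
      have := d.submodule.add_mem h hy.2
      rwa [sub_add_sub_cancel] at this)
    -- The directions from x to a, b and c differ from each other and from d. With at least four
    -- directions, s must have q - 1.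
    have h4 : 4 ≤ (D ∩ pointsOf s).ncard := by
      have haL : a ∈ L := ⟨ha, by simp⟩
      have hbL : b ∈ L := ⟨hb, hbd⟩
      have hcL : c ∈ L := ⟨hc, hcd⟩
      obtain ⟨P, hP, hPm⟩ := hdir a haL
      obtain ⟨R, hR, hRm⟩ := hdir b hbL
      obtain ⟨S, hS, hSm⟩ := hdir c hcL
      have hne : ∀ y ∈ L, ∀ z ∈ L, y ≠ z → ∀ T : ℙ F V, x - y ∈ T.submodule →
          x - z ∈ T.submodule → False := by
        intro y hy z hz hyz T h1 h2
        have h3 : y - z ∈ T.submodule := by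
          have := T.submodule.sub_mem h2 h1
          rwa [sub_sub_sub_cancel_left] at this
        have h4 : y - z ∈ d.submodule := by
          have := d.submodule.sub_mem hy.2 hz.2
          rwa [sub_sub_sub_cancel_right] at this
        have h5 := Projectivization.eq_of_mem_of_mem h3 h4 (sub_ne_zero.2 hyz)
        exact hxyd y hy (h5 ▸ h1)
      have hPR : P ≠ R := by rintro rfl; exact hne a haL b hbL hab.symm _ hPm hRm
      have hPS : P ≠ S := by rintro rfl; exact hne a haL c hcL hac.symm _ hPm hSm
      have hRS : R ≠ S := by rintro rfl; exact hne b hbL c hcL hbc _ hRm hSm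
      have hdP : d ≠ P := by rintro rfl; exact hxyd a haL hPm
      have hdR : d ≠ R := by rintro rfl; exact hxyd b hbL hRm
      have hdS : d ≠ S := by rintro rfl; exact hxyd c hcL hSm
      have h5 : ({d, P, R, S} : Set (ℙ F V)) ⊆ D ∩ pointsOf s := by
        rintro x (rfl | rfl | rfl | rfl) <;> assumption
      have h6 : ({d, P, R, S} : Set (ℙ F V)).ncard = 4 := by
        rw [Set.ncard_insert_of_notMem (by simp [hdP, hdR, hdS]),
          Set.ncard_eq_three.2 ⟨P, R, S, hPR, hPS, hRS, rfl⟩]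
      rw [← h6]
      exact Set.ncard_le_ncard h5 (Set.toFinite _)
    have h5 : (D ∩ pointsOf s).ncard = q - 1 := by
      rcases hA.ncard_line s hs2 with h | h | h | h
      · omega
      · omega
      · omega
      · exact h
    rw [h5, mul_comm]
    have h6 : (A \ L ∩ (fun x => (Submodule.span F {x - a} ⊔ d.submodule : Submodule F V)) ⁻¹'
        {s}).ncard + L.ncard ≤ q := by
      rw [← Set.ncard_union_eq]
      · refine le_trans (Set.ncard_le_ncard ?_ (Set.toFinite _)) (hA.ncard_translate_le hs2 a)
        rintro y (⟨⟨hy, -⟩, hys⟩ | hy)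
        · refine ⟨hy, ?_⟩
          rw [← show (Submodule.span F {y - a} ⊔ d.submodule : Submodule F V) = s from hys]
          exact Submodule.mem_sup_left (Submodule.mem_span_singleton_self _)
        · exact ⟨hy.1, hds hy.2⟩
      · rw [Set.disjoint_left]
        exact fun y hy hyL => hy.1.2 hyL
    refine Nat.mul_le_mul (by omega) (by omega)
  rw [Set.ncard_sdiff hLA, Set.ncard_sdiff_singleton_of_mem hdD, hA.ncard_eq, hA.ncard_directions,
    ← hqdef] at hmain
  set m := L.ncard
  zify [show 2 ≤ q by omega, show m ≤ q ^ k by omega, hLcard, show 1 ≤ q ^ k - 1 by omega,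
    show 1 ≤ q ^ k by omega] at hmain
  have e1 : (3 : ℤ) ≤ m := by exact_mod_cast h3L
  have e2 : (16 : ℤ) * q ≤ (q : ℤ) ^ k := by
    have : 16 * q ≤ q ^ k := hqq.trans hqk
    exact_mod_cast this
  have e3 : (16 : ℤ) ≤ q := by exact_mod_cast hq
  -- With m = |L| the count reads (q - 2)(q^k - m) ≤ (q - m)(q^k - 2). The left side exceeds the
  -- right one by (m - 2)(q^k - q), which is positive for m ≥ 3.
  nlinarith [mul_pos (by linarith : (0 : ℤ) < m - 2) (by linarith : (0 : ℤ) < (q : ℤ) ^ k - q)]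

/-- The q^k - 1 other points of A are seen from a in different directions, because no three are
collinear. There are only q^k - 1 directions, so all of them occur. -/
theorem exists_of_mem (hA : HasSpecialDirections k A D) {a : V} (ha : a ∈ A) {R : ℙ F V}
    (hR : R ∈ D) : ∃ b ∈ A, b ≠ a ∧ b - a ∈ R.submodule := by
  have hV : Finite V := Module.finite_of_finite F
  have hne : ∀ b ∈ A \ {a}, b - a ≠ 0 := fun b hb => sub_ne_zero.2 hb.2
  have hinj : ∀ (b c : V) (hb : b ∈ A \ {a}) (hc : c ∈ A \ {a}),
      Projectivization.mk F (b - a) (hne b hb) = Projectivization.mk F (c - a) (hne c hc) →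
      b = c := fun b c hb hc h => by
    by_contra hbc
    refine hA.not_collinear ha hb.1 hc.1 hb.2 hc.2 hbc _
      (Projectivization.mem_submodule_mk _ (hne b hb)) ?_
    rw [h]
    exact Projectivization.mem_submodule_mk _ _
  obtain ⟨b, hb, h⟩ := Set.surj_on_of_inj_on_of_ncard_le (s := A \ {a}) (t := D)
    (fun b hb => Projectivization.mk F (b - a) (hne b hb))
    (fun b hb => (hA.mem_iff _).2
      ⟨b, hb.1, a, ha, hb.2, Projectivization.mem_submodule_mk _ (hne b hb)⟩)
    hinj (by rw [hA.ncard_directions, Set.ncard_sdiff_singleton_of_mem ha, hA.ncard_eq]) (Set.toFinite _) R hR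
  exact ⟨b, hb.1, hb.2, by rw [h]; exact Projectivization.mem_submodule_mk _ _⟩

/-- The points other than a correspond to the directions in E, each seen exactly once from a; the
summand 1 accounts for a itself. -/
theorem ncard_translate (hA : HasSpecialDirections k A D) {a : V} (ha : a ∈ A)
    (E : Submodule F V) : {x ∈ A | x - a ∈ E}.ncard = (D ∩ pointsOf E).ncard + 1 := by
  have hV : Finite V := Module.finite_of_finite F
  have haE : a ∈ {x ∈ A | x - a ∈ E} := ⟨ha, by simp⟩
  rw [← Set.ncard_sdiff_singleton_add_one haE]
  congr 1
  have hne : ∀ b ∈ {x ∈ A | x - a ∈ E} \ {a}, b - a ≠ 0 := fun b hb => sub_ne_zero.2 hb.2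
  refine Set.ncard_congr (fun b hb => Projectivization.mk F (b - a) (hne b hb)) ?_ ?_ ?_
  · intro b hb
    refine ⟨(hA.mem_iff _).2
      ⟨b, hb.1.1, a, ha, hb.2, Projectivization.mem_submodule_mk _ (hne b hb)⟩, ?_⟩
    exact (Projectivization.mem_pointsOf_iff (Projectivization.mem_submodule_mk _ (hne b hb))
      (hne b hb)).2 hb.1.2
  · intro b c hb hc h
    by_contra hbc
    refine hA.not_collinear ha hb.1.1 hc.1.1 hb.2 hc.2 hbc _
      (Projectivization.mem_submodule_mk _ (hne b hb)) ?_
    rw [h]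
    exact Projectivization.mem_submodule_mk _ _
  · rintro R ⟨hR, hRE⟩
    obtain ⟨b, hb, hba, hbR⟩ := hA.exists_of_mem ha hR
    exact ⟨b, ⟨⟨hb, hRE hbR⟩, hba⟩, Projectivization.eq_of_mem_of_mem
      (Projectivization.mem_submodule_mk _ _) hbR (sub_ne_zero.2 hba)⟩

end HasSpecialDirections

end Directions

/-! ### A is a coset of a subgroup -/

section Additivity

variable {F : Type u} [Field F] {V : Type v} [AddCommGroup V] [Module F V]

namespace HasSpecialDirections

variable {k : ℕ} {A : Set V} {D : Set (ℙ F V)} [Finite F] [FiniteDimensional F V]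

/-- A line with exactly three directions spans, with a point of `A`, a plane that meets `A` in a
parallelogram. -/
theorem add_sub_mem (hA : HasSpecialDirections k A D) {a b c : V} (ha : a ∈ A) (hb : b ∈ A)
    (hc : c ∈ A) (hab : b ≠ a) (hac : c ≠ a) (hbc : b ≠ c) {s : Submodule F V}
    (hbs : b - a ∈ s) (hcs : c - a ∈ s) (hs3 : (D ∩ pointsOf s).ncard = 3) :
    b + c - a ∈ A := by
  have hV : Finite V := Module.finite_of_finite F
  have h4 := hA.ncard_translate ha s
  rw [hs3] at h4
  obtain ⟨x, ⟨hx, hxs⟩, hx3⟩ : ∃ x ∈ {x ∈ A | x - a ∈ s}, x ∉ ({a, b, c} : Set V) := by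
    by_contra! h
    have h1 := Set.ncard_le_ncard (show {x ∈ A | x - a ∈ s} ⊆ ({a, b, c} : Set V) from h)
      (Set.toFinite _)
    have h2 := Set.ncard_eq_three.2 ⟨a, b, c, hab.symm, hac.symm, hbc, rfl⟩
    omega
  simp only [Set.mem_insert_iff, Set.mem_singleton_iff, not_or] at hx3
  obtain ⟨hxa, hxb, hxc⟩ := hx3
  obtain ⟨P, hPD, hP⟩ := hA.exists_direction hb ha hab
  obtain ⟨R, hRD, hR⟩ := hA.exists_direction hc ha hac
  obtain ⟨T, hTD, hT⟩ := hA.exists_direction hx ha hxa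
  have hPR : P ≠ R := by rintro rfl; exact hA.not_collinear ha hb hc hab hac hbc _ hP hR
  have hPT : P ≠ T := by
    rintro rfl; exact hA.not_collinear ha hb hx hab hxa (Ne.symm hxb) _ hP hT
  have hRT : R ≠ T := by
    rintro rfl; exact hA.not_collinear ha hc hx hac hxa (Ne.symm hxc) _ hR hT
  have hcover : ∀ S ∈ D ∩ pointsOf s, S = P ∨ S = R ∨ S = T := by
    have h1 : ({P, R, T} : Set (ℙ F V)) ⊆ D ∩ pointsOf s := by
      rintro S (rfl | rfl | rfl)
      · exact ⟨hPD, (Projectivization.mem_pointsOf_iff hP (sub_ne_zero.2 hab)).2 hbs⟩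
      · exact ⟨hRD, (Projectivization.mem_pointsOf_iff hR (sub_ne_zero.2 hac)).2 hcs⟩
      · exact ⟨hTD, (Projectivization.mem_pointsOf_iff hT (sub_ne_zero.2 hxa)).2 hxs⟩
    have h2 := Set.eq_of_subset_of_ncard_le h1 (by
      rw [hs3, Set.ncard_eq_three.2 ⟨P, R, T, hPR, hPT, hRT, rfl⟩]) (Set.toFinite _)
    intro S hS
    rw [← h2] at hS
    exact hS
  have hthird : ∀ {y z : V}, y ∈ A → z ∈ A → y ≠ z → y - a ∈ s → z - a ∈ s →
      ∃ S, y - z ∈ S.submodule ∧ (S = P ∨ S = R ∨ S = T) := fun {y z} hy hz hyz hys hzs => by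
    obtain ⟨S, hSD, hS⟩ := hA.exists_direction hy hz hyz
    refine ⟨S, hS, hcover S ⟨hSD, (Projectivization.mem_pointsOf_iff hS (sub_ne_zero.2 hyz)).2 ?_⟩⟩
    have := s.sub_mem hys hzs
    rwa [sub_sub_sub_cancel_right] at this
  have hnot : ∀ {y z : V} {S : ℙ F V}, y ∈ A → z ∈ A → y ≠ z → y ≠ a → z ≠ a →
      y - z ∈ S.submodule → (y - a ∈ S.submodule ∨ z - a ∈ S.submodule) → False := by
    intro y z S hy hz hyz hya hza h1 h2
    have h3 : z - a ∈ S.submodule ∧ y - a ∈ S.submodule := by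
      rcases h2 with h2 | h2
      · refine ⟨?_, h2⟩
        have := S.submodule.sub_mem h2 h1
        rwa [sub_sub_sub_cancel_left] at this
      · refine ⟨h2, ?_⟩
        have := S.submodule.add_mem h1 h2
        rwa [sub_add_sub_cancel] at this
    exact hA.not_collinear ha hy hz hya hza hyz S h3.2 h3.1
  -- Four points, no three collinear, share three directions, so opposite sides are parallel: c - b
  -- has the direction of x - a, and x - b that of c - a.
  obtain ⟨S, hS, hS'⟩ := hthird hc hb hbc.symm hcs hbs
  have hST : S = T := by
    rcases hS' with rfl | rfl | h
    · exact (hnot hc hb hbc.symm hac hab hS (Or.inr hP)).elim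
    · exact (hnot hc hb hbc.symm hac hab hS (Or.inl hR)).elim
    · exact h
  obtain ⟨S', hS2, hS2'⟩ := hthird hx hb hxb hxs hbs
  have hSR : S' = R := by
    rcases hS2' with rfl | h | rfl
    · exact (hnot hx hb hxb hxa hab hS2 (Or.inr hP)).elim
    · exact h
    · exact (hnot hx hb hxb hxa hab hS2 (Or.inl hT)).elim
  rw [hST, T.submodule_eq_span hT (sub_ne_zero.2 hxa)] at hS
  rw [hSR, R.submodule_eq_span hR (sub_ne_zero.2 hac)] at hS2
  obtain ⟨l, hl⟩ := Submodule.mem_span_singleton.1 hS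
  obtain ⟨m, hm⟩ := Submodule.mem_span_singleton.1 hS2
  have hind : ∀ y z : F, y • (b - a) + z • (c - a) = 0 → y = 0 := by
    intro y z h
    by_contra hy
    refine hPR (Projectivization.eq_of_mem_of_mem hP ?_ (sub_ne_zero.2 hab))
    have h5 : b - a = (-(y⁻¹ * z)) • (c - a) := by
      have h6 : y⁻¹ • (y • (b - a) + z • (c - a)) = 0 := by rw [h, smul_zero]
      rw [smul_add, smul_smul, smul_smul, inv_mul_cancel₀ hy, one_smul] at h6
      rw [neg_smul]
      exact eq_neg_of_add_eq_zero_left h6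
    rw [h5]
    exact R.submodule.smul_mem _ hR
  -- Here c - b = l (x - a) and x - b = m (c - a). Eliminating x and comparing the coefficients of b
  -- - a gives l = -1, which is 1 in characteristic two.
  have hl1 : l + 1 = 0 := by
    refine hind _ (l * m - 1) ?_
    have e1 : x - a = (b - a) + m • (c - a) := by rw [hm]; abel
    have e2 : (c - a) - (b - a) = l • (x - a) := by rw [hl]; abel
    rw [e1] at e2
    rw [← sub_eq_zero] at e2
    have e3 : (l + 1) • (b - a) + (l * m - 1) • (c - a) =
        -((c - a) - (b - a) - l • ((b - a) + m • (c - a))) := by module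
    rw [e3, e2, neg_zero]
  have h2 := hA.two_eq_zero
  have hl' : l = 1 := by linear_combination hl1 - h2
  rw [hl', one_smul] at hl
  have htwo : (2 : F) • b = 0 := by rw [h2, zero_smul]
  have : b + c - a = x := by
    have h3 : x = a + (c - b) := by rw [← hl]; abel
    have htwo' : (2 : F) • a = 0 := by rw [h2, zero_smul]
    rw [two_smul] at htwo htwo'
    rw [h3, ← sub_eq_zero]
    calc b + c - a - (a + (c - b)) = (b + b) - (a + a) := by abel
      _ = 0 := by rw [htwo, htwo', sub_zero]
  rwa [this]

/-- Two different lines with `q - 1` directions are disjoint. -/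
theorem disjoint_of_ne (hA : HasSpecialDirections k A D) {s t : Submodule F V}
    (hs : finrank F s = 2) (ht : finrank F t = 2)
    (hsD : (D ∩ pointsOf s).ncard = Nat.card F - 1)
    (htD : (D ∩ pointsOf t).ncard = Nat.card F - 1) (hst : s ≠ t) : Disjoint s t := by
  have hV : Finite V := Module.finite_of_finite F
  have hq := hA.card_field
  rw [disjoint_iff]
  by_contra hbot
  set E := s ⊔ t with hE
  have hsE : s ≤ E := le_sup_left
  have htE : t ≤ E := le_sup_right
  have hinf1 : finrank F (s ⊓ t : Submodule F V) = 1 := by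
    have h1 : 1 ≤ finrank F (s ⊓ t : Submodule F V) := Submodule.one_le_finrank_iff.2 hbot
    have h2 : finrank F (s ⊓ t : Submodule F V) < 2 := by
      by_contra! h
      have e1 : s ⊓ t = s := Submodule.eq_of_le_of_finrank_le inf_le_left (by omega)
      have e2 : s ⊓ t = t := Submodule.eq_of_le_of_finrank_le inf_le_right (by omega)
      exact hst (e1.symm.trans e2)
    omega
  have hE3 : finrank F E = 3 := by
    have := Submodule.finrank_sup_add_finrank_inf_eq s t
    rw [← hE, hinf1, hs, ht] at this
    omega
  obtain ⟨a, ha⟩ : A.Nonempty := by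
    rw [← Set.ncard_pos, hA.ncard_eq]
    exact pow_pos (by omega) k
  set M := {x ∈ A | x - a ∈ E} with hM
  have hMcard : M.ncard = (D ∩ pointsOf E).ncard + 1 := hA.ncard_translate ha E
  have hfiber : ∀ r ≤ E, ∀ x ∈ M, M ∩ r.mkQ ⁻¹' {r.mkQ x} = {y ∈ A | y - x ∈ r} := by
    intro r hr x hx
    ext y
    simp only [Set.mem_inter_iff, Set.mem_preimage, Set.mem_singleton_iff, Set.mem_ofPred_eq,
      Submodule.mkQ_apply, Submodule.Quotient.eq]
    refine ⟨fun h => ⟨h.1.1, h.2⟩, fun h => ⟨⟨h.1, ?_⟩, h.2⟩⟩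
    have := E.add_mem (hr h.2) hx.2
    rwa [sub_add_sub_cancel] at this
  -- The part M of A in the solid a + E splits into cosets of r, and every nonempty one has exactly
  -- one point more than r has directions. At most q cosets occur.
  have hcoset : ∀ r ≤ E, finrank F r = 2 →
      M.ncard = (r.mkQ '' M).ncard * ((D ∩ pointsOf r).ncard + 1) := by
    intro r hr _
    have : Finite (V ⧸ r) := Module.finite_of_finite F
    refine ncard_eq_ncard_image_mul r.mkQ fun x hx => ?_
    rw [hfiber r hr x hx, hA.ncard_translate hx.1]
  have himage : ∀ r ≤ E, finrank F r = 2 → (r.mkQ '' M).ncard ≤ Nat.card F := by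
    intro r hr hr2
    have : Finite (V ⧸ r) := Module.finite_of_finite F
    have h1 := card_map_mkQ_mul (F := F) hr
    rw [hr2, hE3, pow_succ' _ 2] at h1
    have h2 := Nat.eq_of_mul_eq_mul_right (pow_pos (by omega) 2) h1
    rw [← h2]
    refine Set.ncard_le_ncard_of_injOn (fun x => x - r.mkQ a)
      (t := (E.map r.mkQ : Set (V ⧸ r))) ?_ (fun x _ y _ h => sub_left_injective h)
      (Set.toFinite _)
    rintro _ ⟨x, hx, rfl⟩
    exact ⟨x - a, hx.2, map_sub _ _ _⟩
  have hMq := hcoset s hsE hs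
  rw [hsD, Nat.sub_add_cancel (by omega)] at hMq
  have hc_le := himage s hsE hs
  set c := (s.mkQ '' M).ncard with hc
  -- The q points of A in a + t are spread over the cosets of s with at most two in each, since
  -- three would be collinear in the direction s ⊓ t.
  have hc_ge : Nat.card F ≤ 2 * c := by
    have : Finite (V ⧸ s) := Module.finite_of_finite F
    have h1 := hA.ncard_translate ha t
    rw [htD, Nat.sub_add_cancel (by omega)] at h1
    rw [← h1]
    refine (ncard_le_mul_ncard_image (m := 2) s.mkQ fun x hx => ?_).trans
      (Nat.mul_le_mul_left 2 (Set.ncard_le_ncard (Set.image_mono fun y hy => ⟨hy.1, htE hy.2⟩)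
        (Set.toFinite _)))
    by_contra! h2
    obtain ⟨y, z, w, hy, hz, hw, hyz, hyw, hzw⟩ := (Set.two_lt_ncard_iff (Set.toFinite _)).1 h2
    have hinf : ∀ {y z : V}, y ∈ {x ∈ A | x - a ∈ t} ∩ s.mkQ ⁻¹' {s.mkQ x} →
        z ∈ {x ∈ A | x - a ∈ t} ∩ s.mkQ ⁻¹' {s.mkQ x} → y - z ∈ s ⊓ t := by
      rintro y z ⟨hy, hy'⟩ ⟨hz, hz'⟩
      constructor
      · refine (Submodule.Quotient.eq s).1 ?_
        exact (show s.mkQ y = s.mkQ x from hy').trans (show s.mkQ z = s.mkQ x from hz').symm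
      · have := t.sub_mem hy.2 hz.2
        rwa [sub_sub_sub_cancel_right] at this
    refine hA.not_collinear hy.1.1 hz.1.1 hw.1.1 hyz.symm hyw.symm hzw
      (Projectivization.mk'' (s ⊓ t) hinf1) ?_ ?_
    · rw [Projectivization.submodule_mk'']; exact hinf hz hy
    · rw [Projectivization.submodule_mk'']; exact hinf hw hy
  -- A line of E with at most three directions would give |M| ≤ 4q, so c ≤ 4, against q ≤ 2c and q ≥
  -- 16.
  have hbig : ∀ r ≤ E, finrank F r = 2 → (D ∩ pointsOf r).ncard = Nat.card F - 1 := by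
    intro r hr hr2
    have h1 := hcoset r hr hr2
    have h2 := himage r hr hr2
    have h3 := hA.ncard_line r hr2
    simp only [Set.mem_insert_iff, Set.mem_singleton_iff] at h3
    by_contra h4
    have h5 : (D ∩ pointsOf r).ncard + 1 ≤ 4 := by omega
    have h6 := Nat.mul_le_mul h2 h5
    rw [← h1, hMq, mul_comm] at h6
    have h7 := Nat.le_of_mul_le_mul_left h6 (by omega)
    omega
  -- The lines of E through y partition the other points of D in E, so a common number of these
  -- points per line divides the total.
  have hdvd : ∀ y ∈ pointsOf E, ∀ m : ℕ, (∀ r ≤ E, finrank F r = 2 → y ∈ pointsOf r →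
      ((D ∩ pointsOf r) \ {y}).ncard = m) → m ∣ ((D ∩ pointsOf E) \ {y}).ncard := by
    intro y hy m hm
    refine dvd_ncard_of_fiber (fun P : ℙ F V => (Submodule.span F {P.rep} ⊔ y.submodule :
      Submodule F V)) fun P hP => ?_
    have hnot : ∀ R : ℙ F V, R ≠ y → R.rep ∉ y.submodule := fun R hR h =>
      hR (Projectivization.eq_of_mem_of_mem R.rep_mem_submodule h R.rep_nonzero)
    have hPy := hnot P hP.2
    set r : Submodule F V := Submodule.span F {P.rep} ⊔ y.submodule with hr
    have hr2 : finrank F r = 2 := finrank_sup_of_notMem hPy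
    have hrE : r ≤ E := sup_le ((Submodule.span_singleton_le_iff_mem _ _).2
      (hP.1.2 P.rep_mem_submodule)) hy
    have hyr : y ∈ pointsOf r := show y.submodule ≤ r from le_sup_right
    rw [← hm r hrE hr2 hyr]
    congr 1
    ext R
    simp only [Set.mem_inter_iff, Set.mem_sdiff, Set.mem_singleton_iff, Set.mem_preimage]
    constructor
    · rintro ⟨⟨⟨h1, -⟩, h2⟩, h3⟩
      refine ⟨⟨h1, ?_⟩, h2⟩
      rw [Projectivization.mem_pointsOf_iff R.rep_mem_submodule R.rep_nonzero, ← h3]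
      exact Submodule.mem_sup_left (Submodule.mem_span_singleton_self _)
    · rintro ⟨⟨h1, h2⟩, h3⟩
      exact ⟨⟨⟨h1, le_trans (show R.submodule ≤ r from h2) hrE⟩, h3⟩,
        sup_eq_of_finrank_two hr2 hyr (h2 R.rep_mem_submodule) (hnot R h3)⟩
  obtain ⟨y, hys, hyD⟩ := hA.exists_notMem hs
  have hy1 := hdvd y (le_trans (show y.submodule ≤ s from hys) hsE) (Nat.card F - 1)
    fun r hr hr2 _ => by
      rw [Set.sdiff_singleton_eq_self fun h => hyD h.1, hbig r hr hr2]
  rw [Set.sdiff_singleton_eq_self fun h => hyD h.1] at hy1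
  obtain ⟨x, hxD, hxs⟩ : (D ∩ pointsOf s).Nonempty := by
    rw [← Set.ncard_pos, hsD]; omega
  have hxE : x ∈ pointsOf E := le_trans (show x.submodule ≤ s from hxs) hsE
  have hx1 := hdvd x hxE (Nat.card F - 2) fun r hr hr2 hxr => by
      rw [Set.ncard_sdiff_singleton_of_mem (show x ∈ D ∩ pointsOf r from ⟨hxD, hxr⟩), hbig r hr hr2]; omega
  rw [Set.ncard_sdiff_singleton_of_mem (show x ∈ D ∩ pointsOf E from ⟨hxD, hxE⟩)] at hx1
  set q := Nat.card F
  set N := (D ∩ pointsOf E).ncard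
  rw [hMq] at hMcard
  have hc8 : 8 ≤ c := by omega
  -- N = cq - 1 is the number of directions in E. A point off D gives q - 1 ∣ N, so q - 1 ∣ c - 1
  -- and c = q. A point of D then gives q - 2 ∣ q² - 2 = (q - 2)(q + 2) + 2, so q - 2 ∣ 2, which is
  -- absurd.
  have e1 : N = c * (q - 1) + (c - 1) := by
    zify [show 1 ≤ q by omega, show 1 ≤ c by omega]
    have : (c : ℤ) * q = N + 1 := by exact_mod_cast hMcard
    linear_combination -this
  rw [e1] at hy1
  have h3 : q - 1 ∣ c - 1 := (Nat.dvd_add_right (Dvd.intro_left c rfl)).1 hy1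
  have h4 : q - 1 ≤ c - 1 := Nat.le_of_dvd (by omega) h3
  have h5 : c = q := by omega
  rw [h5] at hMcard
  have e2 : N - 1 = (q - 2) * (q + 2) + 2 := by
    have : N - 1 = q * q - 2 := by omega
    rw [this]
    have hqq : 2 ≤ q * q := by nlinarith
    zify [show 2 ≤ q by omega, hqq]
    ring
  rw [e2] at hx1
  have h6 : q - 2 ∣ 2 := (Nat.dvd_add_right (Dvd.intro (q + 2) rfl)).1 hx1
  have h7 := Nat.le_of_dvd (by norm_num) h6
  omega

/-- If the line s of u and v has q - 1 directions, a vector w off s serves for a detour: v + w, then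
u + (v + w), then (u + v + w) + w = u + v. Each sum is formed on a line that meets s but differs
from it. Such a line does not have q - 1 directions, and the parallelogram applies. -/
theorem add_sub_mem_of_mem (hA : HasSpecialDirections k A D) {a b c : V} (ha : a ∈ A)
    (hb : b ∈ A) (hc : c ∈ A) : b + c - a ∈ A := by
  have hV : Finite V := Module.finite_of_finite F
  have hq := hA.card_field
  have hk := hA.two_le
  have htwo : ∀ v : V, v + v = 0 := fun v => by
    rw [← two_smul F, hA.two_eq_zero, zero_smul]
  have hind : ∀ {u v : V}, a + u ∈ A → a + v ∈ A → u ≠ 0 → v ≠ 0 → u ≠ v →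
      LinearIndependent F ![u, v] := by
    intro u v hu hv hu0 hv0 huv
    rw [LinearIndependent.pair_iff' hu0]
    rintro x rfl
    refine hA.not_collinear ha hu hv (by simpa using hu0) (by simpa using hv0) (by simpa using huv)
      (Projectivization.mk F u hu0) ?_ ?_
    · rw [add_sub_cancel_left]; exact Projectivization.mem_submodule_mk _ _
    · rw [add_sub_cancel_left]
      exact Submodule.smul_mem _ _ (Projectivization.mem_submodule_mk _ _)
  have hadd : ∀ {u v : V}, a + u ∈ A → a + v ∈ A → u ≠ 0 → v ≠ 0 → u ≠ v →
      (D ∩ pointsOf (Submodule.span F {u, v})).ncard ≠ Nat.card F - 1 → a + (u + v) ∈ A := by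
    intro u v hu hv hu0 hv0 huv hs
    have hus : u ∈ Submodule.span F {u, v} := Submodule.subset_span (by simp)
    have hvs : v ∈ Submodule.span F {u, v} := Submodule.subset_span (by simp)
    have h1 := hA.ncard_line _ (finrank_span_pair (hind hu hv hu0 hv0 huv))
    simp only [Set.mem_insert_iff, Set.mem_singleton_iff] at h1
    have h2 := hA.ncard_translate ha (Submodule.span F {u, v})
    have h3 : 2 < {x ∈ A | x - a ∈ Submodule.span F {u, v}}.ncard :=
      (Set.two_lt_ncard_iff (Set.toFinite _)).2 ⟨a, a + u, a + v, ⟨ha, by simp⟩,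
        ⟨hu, by simpa using hus⟩, ⟨hv, by simpa using hvs⟩, by simpa using hu0,
        by simpa using hv0, by simpa using huv⟩
    have := hA.add_sub_mem ha hu hv (by simpa using hu0) (by simpa using hv0) (by simpa using huv)
      (s := Submodule.span F {u, v}) (by simpa using hus) (by simpa using hvs) (by omega)
    rwa [show a + u + (a + v) - a = a + (u + v) by abel] at this
  suffices h : ∀ u v : V, a + u ∈ A → a + v ∈ A → a + (u + v) ∈ A by
    have := h (b - a) (c - a) (by simpa using hb) (by simpa using hc)
    rwa [show a + (b - a + (c - a)) = b + c - a by abel] at this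
  intro u v hu hv
  by_cases hu0 : u = 0
  · simpa [hu0] using hv
  by_cases hv0 : v = 0
  · simpa [hv0] using hu
  by_cases huv : u = v
  · rw [huv, htwo, add_zero]; exact ha
  by_cases hs : (D ∩ pointsOf (Submodule.span F {u, v})).ncard ≠ Nat.card F - 1
  · exact hadd hu hv hu0 hv0 huv hs
  push Not at hs
  set s := Submodule.span F {u, v} with hsdef
  have hs2 : finrank F s = 2 := finrank_span_pair (hind hu hv hu0 hv0 huv)
  have hus : u ∈ s := Submodule.subset_span (by simp)
  have hvs : v ∈ s := Submodule.subset_span (by simp)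
  obtain ⟨w, hw, hws⟩ : ∃ w, a + w ∈ A ∧ w ∉ s := by
    by_contra! h
    have h1 : {x ∈ A | x - a ∈ s} = A := by
      ext x
      refine ⟨fun hx => hx.1, fun hx => ⟨hx, h _ (by simpa using hx)⟩⟩
    have h2 := hA.ncard_translate_le hs2 a
    rw [h1, hA.ncard_eq] at h2
    have h3 : Nat.card F ^ 1 < Nat.card F ^ k := Nat.pow_lt_pow_right (by omega) (by omega)
    rw [pow_one] at h3
    omega
  have hkey : ∀ {x y z : V}, a + x ∈ A → a + y ∈ A → x ≠ 0 → y ≠ 0 → x ≠ y → z ≠ 0 → z ∈ s →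
      z ∈ Submodule.span F {x, y} → y ∉ s → a + (x + y) ∈ A := by
    intro x y z hx hy hx0 hy0 hxy hz0 hzs hz hys
    refine hadd hx hy hx0 hy0 hxy fun hbig => ?_
    by_cases heq : Submodule.span F {x, y} = s
    · exact hys (heq ▸ Submodule.subset_span (by simp))
    · exact hz0 (Submodule.disjoint_def.1 (hA.disjoint_of_ne
        (finrank_span_pair (hind hx hy hx0 hy0 hxy)) hs2 hbig hs heq) z hz hzs)
  have hw0 : w ≠ 0 := by rintro rfl; exact hws s.zero_mem
  have hvw : v ≠ w := by rintro rfl; exact hws hvs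
  have h1 : a + (v + w) ∈ A := hkey hv hw hv0 hw0 hvw hv0 hvs (Submodule.subset_span (by simp)) hws
  have hvws : v + w ∉ s := fun h => hws (by simpa using s.sub_mem h hvs)
  have hvw0 : v + w ≠ 0 := fun h => hvws (h ▸ s.zero_mem)
  have huvw : u ≠ v + w := fun h => hvws (h ▸ hus)
  have h2 : a + (u + (v + w)) ∈ A :=
    hkey hu h1 hu0 hvw0 huvw hu0 hus (Submodule.subset_span (by simp)) hvws
  have huvws : u + (v + w) ∉ s := fun h => hvws (by simpa using s.sub_mem h hus)
  have huvs : u + v ∈ s := s.add_mem hus hvs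
  have huv0 : u + v ≠ 0 := fun h => huv (by
    rw [eq_neg_of_add_eq_zero_left h, eq_comm]; exact eq_neg_of_add_eq_zero_left (htwo v))
  have h3 : u + (v + w) + w = u + v := by rw [add_assoc, add_assoc, htwo, add_zero]
  have h4 : a + (u + (v + w) + w) ∈ A := by
    refine hkey h2 hw (fun h => huvws (h ▸ s.zero_mem)) hw0 (fun h => huv0 ?_) huv0 huvs ?_ hws
    · rw [← add_assoc] at h
      simpa using h
    · exact Submodule.mem_span_pair.2 ⟨1, 1, by rw [one_smul, one_smul, h3]⟩
  rwa [h3] at h4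

/-- The translate of `A` through the origin is a special additive subgroup. -/
theorem exists_isSpecialSubgroup (hA : HasSpecialDirections k A D) {H : Submodule F V}
    (hH : finrank F H = 2 * k) (hDH : D ⊆ pointsOf H) {a : V} (ha : a ∈ A) :
    ∃ U : AddSubgroup V, IsSpecialSubgroup F k H U ∧ (∀ x, x ∈ A ↔ x - a ∈ U) ∧
      (∀ R : ℙ F V, R ∈ D ↔ ∃ u ∈ U, u ≠ 0 ∧ u ∈ R.submodule) ∧
      ∀ E : Submodule F V,
        Nat.card (U ⊓ E.toAddSubgroup : AddSubgroup V) = (D ∩ pointsOf E).ncard + 1 := by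
  have hV : Finite V := Module.finite_of_finite F
  have hq := hA.card_field
  have htwo : ∀ v : V, v + v = 0 := fun v => by
    rw [← two_smul F, hA.two_eq_zero, zero_smul]
  let U : AddSubgroup V :=
    { carrier := {u | a + u ∈ A}
      zero_mem' := by simpa using ha
      add_mem' := fun {u v} hu hv => by
        have := hA.add_sub_mem_of_mem ha hu hv
        rwa [show a + u + (a + v) - a = a + (u + v) by abel] at this
      neg_mem' := fun {u} hu => by
        rwa [Set.mem_ofPred_eq, ← eq_neg_of_add_eq_zero_left (htwo u)] }
  have hUmem : ∀ u, u ∈ U ↔ a + u ∈ A := fun u => Iff.rfl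
  have hUcard : ∀ E : Submodule F V,
      Nat.card (U ⊓ E.toAddSubgroup : AddSubgroup V) = (D ∩ pointsOf E).ncard + 1 := fun E => by
    rw [← hA.ncard_translate ha E]
    change ((U ⊓ E.toAddSubgroup : AddSubgroup V) : Set V).ncard = _
    refine Set.ncard_congr (fun u _ => a + u) (fun u hu => ⟨hu.1, by simpa using hu.2⟩)
      (fun u v _ _ h => add_left_cancel h) fun x hx => ⟨x - a, ⟨?_, hx.2⟩, by abel⟩
    change a + (x - a) ∈ A
    rw [add_sub_cancel]; exact hx.1
  have hDU : ∀ R : ℙ F V, R ∈ D ↔ ∃ u ∈ U, u ≠ 0 ∧ u ∈ R.submodule := by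
    refine fun R => ⟨fun hR => ?_, ?_⟩
    · obtain ⟨b, hb, hba, hbR⟩ := hA.exists_of_mem ha hR
      exact ⟨b - a, by rw [hUmem, add_sub_cancel]; exact hb, sub_ne_zero.2 hba, hbR⟩
    · rintro ⟨u, hu, hu0, huR⟩
      exact (hA.mem_iff R).2 ⟨a + u, hu, a, ha, by simpa using hu0, by simpa using huR⟩
  refine ⟨U, ⟨hq, hH, hA.two_le, ?_, ?_, ?_, ?_, ?_⟩, fun x => ?_, hDU, hUcard⟩
  · intro u hu
    by_cases hu0 : u = 0
    · rw [hu0]; exact H.zero_mem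
    have hR : Projectivization.mk F u hu0 ∈ D :=
      (hDU _).2 ⟨u, hu, hu0, Projectivization.mem_submodule_mk _ _⟩
    exact hDH hR (Projectivization.mem_submodule_mk _ _)
  · have := hUcard ⊤
    rw [show U ⊓ (⊤ : Submodule F V).toAddSubgroup = U from inf_eq_left.2 fun _ _ => trivial,
      show pointsOf (⊤ : Submodule F V) = Set.univ from Set.eq_univ_of_forall fun P =>
        (show P.submodule ≤ ⊤ from le_top), Set.inter_univ, hA.ncard_directions] at this
    rw [this]
    have : 0 < Nat.card F ^ k := pow_pos (by omega) k
    omega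
  · intro u hu hu0 c hc
    by_contra! hc'
    refine hA.not_collinear ha hu hc (by simpa using hu0) ?_ ?_
      (Projectivization.mk F u hu0) ?_ ?_
    · simpa using ⟨hc'.1, hu0⟩
    · intro h
      have h1 : (1 : F) • u = c • u := by rw [one_smul]; exact add_left_cancel h
      exact hc'.2 (smul_left_injective F hu0 h1).symm
    · rw [add_sub_cancel_left]; exact Projectivization.mem_submodule_mk _ _
    · rw [add_sub_cancel_left]
      exact Submodule.smul_mem _ _ (Projectivization.mem_submodule_mk _ _)
  · intro s hs
    have h1 := hA.ncard_line s hs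
    rw [hUcard s]
    simp only [Set.mem_insert_iff, Set.mem_singleton_iff] at h1 ⊢
    omega
  · intro s t hs ht hst
    have h1 := hUcard s
    have h2 := hUcard t
    rw [hs.2] at h1
    rw [ht.2] at h2
    exact hA.disjoint_of_ne hs.1 ht.1 (by omega) (by omega) hst
  · rw [hUmem, add_sub_cancel]

end HasSpecialDirections

end Additivity

/-! ### The pseudoregulus and its transversal spaces -/

section Pseudoregulus

variable {F : Type u} [Field F] {V : Type v} [AddCommGroup V] [Module F V]

theorem eq_zero_or_one_of_mem_bot [CharP F 2] {c : F} (hc : c ∈ (⊥ : Subfield F)) :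
    c = 0 ∨ c = 1 := by
  by_contra! h
  have h2 : Nat.card (⊥ : Subfield F) = 2 := Subfield.card_bot F 2
  have hfin : Finite (⊥ : Subfield F) := Nat.finite_of_card_ne_zero (by omega)
  have h3 : ({0, 1, c} : Set F) ⊆ ((⊥ : Subfield F) : Set F) := by
    rintro x (rfl | rfl | rfl)
    exacts [zero_mem _, one_mem _, hc]
  have h4 := Set.ncard_le_ncard h3 (Set.toFinite _)
  rw [Set.ncard_eq_three.2 ⟨0, 1, c, zero_ne_one, h.1.symm, h.2.symm, rfl⟩] at h4
  change 3 ≤ Nat.card (⊥ : Subfield F) at h4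
  omega

/-- An additive subgroup in characteristic two is a subspace over the prime field. -/
def AddSubgroup.toBotSubmodule [CharP F 2] (U : AddSubgroup V) :
    Submodule (⊥ : Subfield F) V where
  carrier := U
  add_mem' := U.add_mem
  zero_mem' := U.zero_mem
  smul_mem' c u hu := by
    change (c : F) • u ∈ U
    rcases eq_zero_or_one_of_mem_bot c.2 with h | h
    · rw [h, zero_smul]; exact U.zero_mem
    · rw [h, one_smul]; exact hu

theorem two_pow_finrank_bot [CharP F 2] (W : Type*) [AddCommGroup W]
    [Module (⊥ : Subfield F) W] [Finite W] :
    2 ^ finrank (⊥ : Subfield F) W = Nat.card W := by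
  have h2 : Nat.card (⊥ : Subfield F) = 2 := Subfield.card_bot F 2
  have hfin : Finite (⊥ : Subfield F) := Nat.finite_of_card_ne_zero (by omega)
  rw [card_eq_card_pow_finrank (F := (⊥ : Subfield F)) (W := W), h2]

namespace IsSpecialSubgroup

variable {k : ℕ} {H : Submodule F V} {U : AddSubgroup V} [FiniteDimensional F V] [Finite F]

theorem exists_linearSet [CharP F 2] (hU : IsSpecialSubgroup F k H U) {D : Set (ℙ F V)}
    (hD : ∀ R : ℙ F V, R ∈ D ↔ ∃ u ∈ U, u ≠ 0 ∧ u ∈ R.submodule) :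
    ∃ U' : Submodule (⊥ : Subfield F) V, (∀ u ∈ U', u ∈ H) ∧
      finrank (⊥ : Subfield F) U' = k * finrank (⊥ : Subfield F) F ∧ IsScattered U' ∧
      D = linearSet U' := by
  have hV : Finite V := Module.finite_of_finite F
  have hq := hU.card_field
  refine ⟨U.toBotSubmodule, hU.le, ?_, fun P => ?_, ?_⟩
  · refine Nat.pow_right_injective (le_refl 2) ?_
    change 2 ^ finrank (⊥ : Subfield F) _ = 2 ^ _
    rw [two_pow_finrank_bot, mul_comm, pow_mul, two_pow_finrank_bot, ← hU.card_eq]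
    rfl
  · by_contra! h
    have h1 : 2 < Nat.card
        (U ⊓ P.submodule.toAddSubgroup : AddSubgroup V) := by
      change 2 < Nat.card
        ↥(U.toBotSubmodule ⊓ P.submodule.restrictScalars (⊥ : Subfield F) : Submodule _ V)
      rw [← two_pow_finrank_bot (F := F)]
      exact lt_of_lt_of_le (by norm_num : 2 < 2 ^ 2) (Nat.pow_le_pow_right (by norm_num) h)
    obtain ⟨u, hu, hu0, -⟩ := AddSubgroup.exists_mem_ne_ne h1 0
    obtain ⟨v, hv, hv0, hvu⟩ := AddSubgroup.exists_mem_ne_ne h1 u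
    have hv' : v ∈ P.submodule := hv.2
    rw [P.submodule_eq_span hu.2 hu0] at hv'
    obtain ⟨c, rfl⟩ := Submodule.mem_span_singleton.1 hv'
    rcases hU.scattered u hu.1 hu0 c hv.1 with rfl | rfl
    · exact hv0 (zero_smul F u)
    · exact hvu (one_smul F u)
  · ext P
    rw [hD]
    constructor
    · rintro ⟨u, hu, hu0, huP⟩
      exact ⟨u, hu0, hu, Projectivization.eq_of_mem_of_mem huP
        (Projectivization.mem_submodule_mk u hu0) hu0⟩
    · rintro ⟨u, hu0, hu, rfl⟩
      exact ⟨u, hu, hu0, Projectivization.mem_submodule_mk u hu0⟩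

/-- The big lines partition U \ {0} into classes of q - 1 elements. -/
theorem ncard_isBigLine_mul (hU : IsSpecialSubgroup F k H U) :
    {s | IsBigLine F U s}.ncard * (Nat.card F - 1) = Nat.card F ^ k - 1 := by
  have hV : Finite V := Module.finite_of_finite F
  have hq := hU.card_field
  have hex : ∀ u : V, ∃ s, u ∈ U → u ≠ 0 → u ∈ s ∧ IsBigLine F U s := fun u => by
    by_cases h : u ∈ U ∧ u ≠ 0
    · obtain ⟨s, h1, h2⟩ := hU.exists_isBigLine h.1 h.2
      exact ⟨s, fun _ _ => ⟨h1, h2⟩⟩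
    · exact ⟨⊥, fun h1 h2 => (h ⟨h1, h2⟩).elim⟩
  choose f hf using hex
  have hfib : ∀ s, IsBigLine F U s → ((U : Set V) \ {0}) ∩ f ⁻¹' {s} =
      ((U ⊓ s.toAddSubgroup : AddSubgroup V) : Set V) \ {0} := by
    intro s hs
    ext w
    simp only [Set.mem_inter_iff, Set.mem_sdiff, SetLike.mem_coe, Set.mem_singleton_iff,
      Set.mem_preimage, AddSubgroup.mem_inf, Submodule.mem_toAddSubgroup]
    constructor
    · rintro ⟨⟨h1, h2⟩, rfl⟩
      exact ⟨⟨h1, (hf w h1 h2).1⟩, h2⟩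
    · rintro ⟨⟨h1, h2⟩, h3⟩
      exact ⟨⟨h1, h3⟩, hU.eq_of_mem_of_mem (hf w h1 h3).2 hs (hf w h1 h3).1 h2 h3⟩
  have hcardfib : ∀ s, IsBigLine F U s →
      (((U : Set V) \ {0}) ∩ f ⁻¹' {s}).ncard = Nat.card F - 1 := fun s hs => by
    rw [hfib s hs, Set.ncard_sdiff_singleton_of_mem (AddSubgroup.zero_mem _), ← hs.2]
    rfl
  have h1 := ncard_eq_ncard_image_mul (X := (U : Set V) \ {0}) f (m := Nat.card F - 1)
    fun w hw => hcardfib _ (hf w hw.1 hw.2).2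
  have h2 : f '' ((U : Set V) \ {0}) = {s | IsBigLine F U s} := by
    ext s
    constructor
    · rintro ⟨w, hw, rfl⟩
      exact (hf w hw.1 hw.2).2
    · intro hs
      have h3 := hcardfib s hs
      obtain ⟨w, hw, hws⟩ := Set.nonempty_of_ncard_ne_zero (by rw [h3]; omega)
      exact ⟨w, hw, hws⟩
  rw [h2, Set.ncard_sdiff_singleton_of_mem U.zero_mem] at h1
  rw [← h1, ← hU.card_eq]
  rfl

variable {D : Set (ℙ F V)}

theorem isPseudoregulus [CharP F 2] (hU : IsSpecialSubgroup F k H U)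
    (hcard : ∀ E : Submodule F V,
      Nat.card (U ⊓ E.toAddSubgroup : AddSubgroup V) = (D ∩ pointsOf E).ncard + 1) :
    IsPseudoregulus (⊥ : Subfield F) k H D {s | IsBigLine F U s} where
  isLine s hs := ⟨hU.le_of_isBigLine hs, hs.1⟩
  card_lines := hU.ncard_isBigLine_mul
  disjoint s hs t ht hst := hU.disjoint_of_ne s t hs ht hst
  card_inter s hs := by
    have h1 := hcard s
    rw [hs.2] at h1
    rw [Subfield.card_bot F 2, h1]
    simp

/-- The lines of R are big by their number of directions, and R has as many lines as there are big
ones. So the transversal spaces do not depend on a choice of pseudoregulus. -/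
theorem eq_of_isPseudoregulus [CharP F 2] (hU : IsSpecialSubgroup F k H U)
    (hcard : ∀ E : Submodule F V,
      Nat.card (U ⊓ E.toAddSubgroup : AddSubgroup V) = (D ∩ pointsOf E).ncard + 1)
    {R : Set (Submodule F V)} (hR : IsPseudoregulus (⊥ : Subfield F) k H D R) :
    R = {s | IsBigLine F U s} := by
  have hV : Finite V := Module.finite_of_finite F
  have hq := hU.card_field
  refine Set.eq_of_subset_of_ncard_le (fun s hs => ⟨(hR.isLine s hs).2, ?_⟩) ?_ (Set.toFinite _)
  · have h1 := hR.card_inter s hs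
    rw [Subfield.card_bot F 2] at h1
    rw [hcard]
    omega
  · have h1 := hR.card_lines
    rw [← hU.ncard_isBigLine_mul] at h1
    exact (Nat.eq_of_mul_eq_mul_right (by omega) h1).ge

end IsSpecialSubgroup

/-- The map y ↦ τ(y) / y is an endomorphism of the finite group of units with trivial kernel, hence
surjective. -/
theorem exists_map_eq_mul_of_fixed_eq {K : Type*} [Field K] [Finite K] {τ : K →+* K}
    (hτ : ∀ y, τ y = y → y = 0 ∨ y = 1) {c : K} (hc : c ≠ 0) : ∃ y, y ≠ 0 ∧ τ y = c * y := by
  let f : Kˣ →* Kˣ := Units.map τ.toMonoidHom / MonoidHom.id Kˣ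
  have hinj : Function.Injective f := by
    rw [injective_iff_map_eq_one]
    intro x hx
    have h1 : Units.map τ.toMonoidHom x = x := div_eq_one.1
      (show Units.map τ.toMonoidHom x / x = 1 from hx)
    exact Units.ext ((hτ _ (congrArg Units.val h1)).resolve_left x.ne_zero)
  obtain ⟨x, hx⟩ := (Finite.injective_iff_surjective.1 hinj) (Units.mk0 c hc)
  refine ⟨x, x.ne_zero, ?_⟩
  have h1 : Units.map τ.toMonoidHom x / x = Units.mk0 c hc := hx
  rw [div_eq_iff_eq_mul] at h1
  exact congrArg Units.val h1

/-- `Φ` identifies `F ^ k × F ^ k` with `H` in such a way that `U` becomes `{(x, σ(x))}`. -/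
structure IsNormalForm {k : ℕ} (H : Submodule F V) (U : AddSubgroup V) (σ : F →+* F)
    (Φ : (Fin k → F) × (Fin k → F) →ₗ[F] V) : Prop where
  injective : Function.Injective Φ
  range_eq : LinearMap.range Φ = H
  mem_iff : ∀ w, w ∈ U ↔ ∃ x : Fin k → F, w = Φ (x, σ ∘ x)

namespace IsNormalForm

variable {k : ℕ} {H : Submodule F V} {U : AddSubgroup V} {σ : F →+* F}
  {Φ : (Fin k → F) × (Fin k → F) →ₗ[F] V}

/-- The image of the first factor. -/
def leftSpace (Φ : (Fin k → F) × (Fin k → F) →ₗ[F] V) : Submodule F V :=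
  LinearMap.range (Φ.comp (LinearMap.inl F _ _))

/-- The image of the second factor. -/
def rightSpace (Φ : (Fin k → F) × (Fin k → F) →ₗ[F] V) : Submodule F V :=
  LinearMap.range (Φ.comp (LinearMap.inr F _ _))

theorem finrank_leftSpace (hΦ : IsNormalForm H U σ Φ) : finrank F (leftSpace Φ) = k := by
  have h : Function.Injective (Φ.comp (LinearMap.inl F _ _)) :=
    hΦ.injective.comp LinearMap.inl_injective
  rw [leftSpace, LinearMap.finrank_range_of_inj h]
  simp

theorem finrank_rightSpace (hΦ : IsNormalForm H U σ Φ) : finrank F (rightSpace Φ) = k := by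
  have h : Function.Injective (Φ.comp (LinearMap.inr F _ _)) :=
    hΦ.injective.comp LinearMap.inr_injective
  rw [rightSpace, LinearMap.finrank_range_of_inj h]
  simp

variable [Finite F] [FiniteDimensional F V]

-- A fixed scalar c maps the element (1, σ(1)) of U to (c, σ(c)), which is again in U; scatteredness
-- then leaves only 0 and 1.
omit [Finite F] [FiniteDimensional F V] in
theorem fixed_eq (hU : IsSpecialSubgroup F k H U) (hΦ : IsNormalForm H U σ Φ) {c : F}
    (hc : σ c = c) : c = 0 ∨ c = 1 := by
  have hk := hU.two_le
  have h1 : Φ (fun _ => 1, σ ∘ fun _ => 1) ∈ U := (hΦ.mem_iff _).2 ⟨_, rfl⟩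
  refine hU.scattered _ h1 (fun h => ?_) c ?_
  · have h2 := hΦ.injective (h.trans (map_zero Φ).symm)
    exact one_ne_zero (congrFun (congrArg Prod.fst h2) ⟨0, by omega⟩)
  · rw [← map_smul]
    refine (hΦ.mem_iff _).2 ⟨fun _ => c, congrArg Φ (Prod.ext (funext fun i => ?_)
      (funext fun i => ?_))⟩
    · simp
    · simp [hc]

/-- The big lines are the lines that join corresponding points of the two factors. -/
theorem isBigLine_span (hU : IsSpecialSubgroup F k H U) (hΦ : IsNormalForm H U σ Φ)
    {x : Fin k → F} (hx : x ≠ 0) :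
    IsBigLine F U (Submodule.span F {Φ (x, 0), Φ (0, σ ∘ x)}) := by
  have hV : Finite V := Module.finite_of_finite F
  have hq := hU.card_field
  have hσx : σ ∘ x ≠ 0 := fun h => hx (funext fun i => σ.injective (by
    rw [Pi.zero_apply, map_zero]; exact congrFun h i))
  have hcomb : ∀ a b : F, a • Φ (x, 0) + b • Φ (0, σ ∘ x) = Φ (a • x, b • (σ ∘ x)) := by
    intro a b
    rw [← map_smul, ← map_smul, ← map_add]
    congr 1
    simp
  have hind : LinearIndependent F ![Φ (x, 0), Φ (0, σ ∘ x)] := by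
    rw [LinearIndependent.pair_iff]
    intro a b h
    rw [hcomb] at h
    have h1 := hΦ.injective (h.trans (map_zero Φ).symm)
    exact ⟨(smul_eq_zero.1 (congrArg Prod.fst h1)).resolve_right hx,
      (smul_eq_zero.1 (congrArg Prod.snd h1)).resolve_right hσx⟩
  refine hU.isBigLine_of_lt (finrank_span_pair hind) (lt_of_lt_of_le (b := Nat.card F)
    (by omega) ?_)
  refine Nat.card_le_card_of_injective (fun c : F => (⟨Φ (c • x, σ c • (σ ∘ x)),
    (hΦ.mem_iff _).2 ⟨c • x, congrArg Φ (Prod.ext rfl (funext fun i => by simp))⟩, ?_⟩ :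
    (U ⊓ (Submodule.span F {Φ (x, 0), Φ (0, σ ∘ x)}).toAddSubgroup : AddSubgroup V))) ?_
  · rw [← hcomb]
    exact Submodule.mem_span_pair.2 ⟨_, _, rfl⟩
  · intro c d h
    exact smul_left_injective F hx
      (congrArg Prod.fst (hΦ.injective (congrArg Subtype.val h)))

theorem transversals_eq (hU : IsSpecialSubgroup F k H U) (hΦ : IsNormalForm H U σ Φ)
    {D : Set (ℙ F V)} (hD : ∀ R : ℙ F V, R ∈ D ↔ ∃ u ∈ U, u ≠ 0 ∧ u ∈ R.submodule) :
    transversals k H D {s | IsBigLine F U s} = {leftSpace Φ, rightSpace Φ} := by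
  have hV : Finite V := Module.finite_of_finite F
  have hσ : Function.Bijective σ := Finite.injective_iff_bijective.1 σ.injective
  have hle : ∀ p, Φ p ∈ H := fun p => by rw [← hΦ.range_eq]; exact ⟨p, rfl⟩
  have hbig : ∀ s, IsBigLine F U s → ∃ x : Fin k → F, x ≠ 0 ∧
      s = Submodule.span F {Φ (x, 0), Φ (0, σ ∘ x)} := by
    intro s hs
    obtain ⟨u, hu, _, _, hus, _, hind⟩ := hU.exists_pair hs
    have hu0 : u ≠ 0 := hind.ne_zero 0
    obtain ⟨x, rfl⟩ := (hΦ.mem_iff u).1 hu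
    have hx : x ≠ 0 := by
      rintro rfl
      refine hu0 ?_
      rw [show σ ∘ (0 : Fin k → F) = 0 from funext fun i => by simp]
      exact map_zero Φ
    refine ⟨x, hx, hU.eq_of_mem_of_mem hs (hΦ.isBigLine_span hU hx) hus ?_ hu0⟩
    refine Submodule.mem_span_pair.2 ⟨1, 1, ?_⟩
    rw [one_smul, one_smul, ← map_add]
    simp
  have hσ0 : ∀ x : Fin k → F, σ ∘ x = 0 → x = 0 := fun x h => funext fun i =>
    σ.injective (by rw [Pi.zero_apply, map_zero]; exact congrFun h i)
  ext T
  constructor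
  · rintro ⟨hTH, hTk, hTD, hTR⟩
    -- A point of a big line off both factors is a multiple of (l x, σ(l x)), where σ(l) = (b / a)
    -- l, so it belongs to D. As T avoids D, it must meet the line in one of the two factors.
    have hor : ∀ x : Fin k → F, Φ (x, 0) ∈ T ∨ Φ (0, σ ∘ x) ∈ T := by
      intro x
      by_cases hx : x = 0
      · left; rw [hx]; rw [show ((0 : Fin k → F), (0 : Fin k → F)) = 0 from rfl, map_zero]
        exact T.zero_mem
      have h1 := hTR _ (hΦ.isBigLine_span hU hx)
      rw [Submodule.disjoint_def] at h1
      push Not at h1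
      obtain ⟨w, hwT, hws, hw0⟩ := h1
      obtain ⟨a, b, rfl⟩ := Submodule.mem_span_pair.1 hws
      by_cases ha : a = 0
      · right
        have hb : b ≠ 0 := by rintro rfl; exact hw0 (by rw [ha, zero_smul, zero_smul, add_zero])
        rw [ha, zero_smul, zero_add] at hwT
        exact (T.smul_mem_iff hb).1 hwT
      by_cases hb : b = 0
      · left
        rw [hb, zero_smul, add_zero] at hwT
        exact (T.smul_mem_iff ha).1 hwT
      exfalso
      obtain ⟨l, hl0, hl⟩ := exists_map_eq_mul_of_fixed_eq (fun c => hΦ.fixed_eq hU (c := c))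
        (div_ne_zero hb ha)
      have h2 : (l / a) • (a • Φ (x, 0) + b • Φ (0, σ ∘ x)) = Φ (l • x, σ ∘ (l • x)) := by
        rw [smul_add, smul_smul, smul_smul, div_mul_cancel₀ _ ha, ← map_smul, ← map_smul,
          ← map_add]
        congr 1
        refine Prod.ext (by simp) (funext fun i => ?_)
        simp [hl]
        field_simp
        simp
      have h3 : Φ (l • x, σ ∘ (l • x)) ∈ T := h2 ▸ T.smul_mem _ hwT
      have h4 : Φ (l • x, σ ∘ (l • x)) ≠ 0 := by
        rw [← h2]; exact smul_ne_zero (div_ne_zero hl0 ha) hw0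
      have h5 : Projectivization.mk F _ h4 ∈ pointsOf T :=
        (Projectivization.mem_pointsOf_iff (Projectivization.mem_submodule_mk _ h4) h4).2 h3
      exact Set.disjoint_left.1 hTD h5 ((hD _).2
        ⟨_, (hΦ.mem_iff _).2 ⟨_, rfl⟩, h4, Projectivization.mem_submodule_mk _ h4⟩)
    -- A group is not the union of two proper subgroups: if T misses (x, 0) but contains (y, 0),
    -- then it misses (x + y, 0), so it contains (0, σ(x + y)) and (0, σ(x)), hence their
    -- difference.
    by_cases hA : ∀ x, Φ (x, 0) ∈ T
    · left
      refine (Submodule.eq_of_le_of_finrank_eq ?_ (by rw [hΦ.finrank_leftSpace, hTk])).symm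
      rintro _ ⟨x, rfl⟩
      exact hA x
    · right
      push Not at hA
      obtain ⟨x, hx⟩ := hA
      refine (Submodule.eq_of_le_of_finrank_eq ?_ (by rw [hΦ.finrank_rightSpace, hTk])).symm
      rintro _ ⟨z, rfl⟩
      change Φ (0, z) ∈ T
      obtain ⟨y, rfl⟩ : ∃ y : Fin k → F, σ ∘ y = z :=
        ⟨fun i => (hσ.2 (z i)).choose, funext fun i => (hσ.2 (z i)).choose_spec⟩
      rcases hor y with hy | hy
      · have h1 : Φ (x + y, 0) ∉ T := fun h => hx (by
          have := T.sub_mem h hy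
          rw [← map_sub] at this
          simpa using this)
        have h2 := (hor (x + y)).resolve_left h1
        have h3 := (hor x).resolve_left hx
        have h4 := T.sub_mem h2 h3
        rw [← map_sub] at h4
        convert h4 using 2
        refine Prod.ext (by simp) (funext fun i => by simp)
      · exact hy
  · have hdis : ∀ T : Submodule F V,
        (∀ x : Fin k → F, Φ (x, σ ∘ x) ∈ T → x = 0) → Disjoint (pointsOf T) D := by
      intro T hT
      rw [Set.disjoint_left]
      intro P hP hPD
      obtain ⟨u, hu, hu0, huP⟩ := (hD P).1 hPD
      obtain ⟨x, rfl⟩ := (hΦ.mem_iff u).1 hu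
      have := hT x (hP huP)
      subst this
      refine hu0 ?_
      rw [show σ ∘ (0 : Fin k → F) = 0 from funext fun i => by simp]
      exact map_zero Φ
    rintro (rfl | rfl)
    · refine ⟨?_, hΦ.finrank_leftSpace, hdis _ ?_, fun s hs hdisj => ?_⟩
      · rintro _ ⟨x, rfl⟩; exact hle _
      · rintro x ⟨y, hy⟩
        have h1 := hΦ.injective (show Φ (y, 0) = Φ (x, σ ∘ x) from hy)
        exact hσ0 x (congrArg Prod.snd h1).symm
      · obtain ⟨x, hx, rfl⟩ := hbig s hs
        have h1 := Submodule.disjoint_def.1 hdisj (Φ (x, 0)) ⟨x, rfl⟩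
          (Submodule.subset_span (by simp))
        exact hx (congrArg Prod.fst (hΦ.injective (h1.trans (map_zero Φ).symm)))
    · refine ⟨?_, hΦ.finrank_rightSpace, hdis _ ?_, fun s hs hdisj => ?_⟩
      · rintro _ ⟨x, rfl⟩; exact hle _
      · rintro x ⟨y, hy⟩
        have h1 := hΦ.injective (show Φ (0, y) = Φ (x, σ ∘ x) from hy)
        exact (congrArg Prod.fst h1).symm
      · obtain ⟨x, hx, rfl⟩ := hbig s hs
        have h1 := Submodule.disjoint_def.1 hdisj (Φ (0, σ ∘ x)) ⟨σ ∘ x, rfl⟩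
          (Submodule.subset_span (by simp))
        exact hx (hσ0 x (congrArg Prod.snd (hΦ.injective (h1.trans (map_zero Φ).symm))))

omit [Finite F] [FiniteDimensional F V] in
theorem leftSpace_ne_rightSpace (hU : IsSpecialSubgroup F k H U) (hΦ : IsNormalForm H U σ Φ) :
    leftSpace Φ ≠ rightSpace Φ := by
  have hk := hU.two_le
  intro h
  obtain ⟨y, hy⟩ : Φ ((fun _ => 1), 0) ∈ rightSpace Φ := by rw [← h]; exact ⟨_, rfl⟩
  have h1 := hΦ.injective (show Φ (0, y) = _ from hy)
  exact zero_ne_one (congrFun (congrArg Prod.fst h1) ⟨0, by omega⟩)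

variable {D : Set (ℙ F V)}

theorem isPseudoregulusTypeWith [CharP F 2] (hU : IsSpecialSubgroup F k H U)
    (hΦ : IsNormalForm H U σ Φ)
    (hD : ∀ R : ℙ F V, R ∈ D ↔ ∃ u ∈ U, u ≠ 0 ∧ u ∈ R.submodule)
    (hcard : ∀ E : Submodule F V,
      Nat.card (U ⊓ E.toAddSubgroup : AddSubgroup V) = (D ∩ pointsOf E).ncard + 1) :
    IsPseudoregulusTypeWith (⊥ : Subfield F) k H D (leftSpace Φ) (rightSpace Φ) :=
  ⟨hU.exists_linearSet hD, _, hU.isPseudoregulus hcard, hΦ.leftSpace_ne_rightSpace hU,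
    hΦ.transversals_eq hU hD⟩

theorem eq_or_eq_of_isPseudoregulusTypeWith [CharP F 2] (hU : IsSpecialSubgroup F k H U)
    (hΦ : IsNormalForm H U σ Φ)
    (hD : ∀ R : ℙ F V, R ∈ D ↔ ∃ u ∈ U, u ≠ 0 ∧ u ∈ R.submodule)
    (hcard : ∀ E : Submodule F V,
      Nat.card (U ⊓ E.toAddSubgroup : AddSubgroup V) = (D ∩ pointsOf E).ncard + 1)
    {T₀ T₁ : Submodule F V} (hT : IsPseudoregulusTypeWith (⊥ : Subfield F) k H D T₀ T₁) :
    (T₀ = leftSpace Φ ∧ T₁ = rightSpace Φ) ∨ (T₀ = rightSpace Φ ∧ T₁ = leftSpace Φ) := by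
  obtain ⟨-, R, hR, -, hRT⟩ := hT
  rw [hU.eq_of_isPseudoregulus hcard hR, hΦ.transversals_eq hU hD] at hRT
  exact Set.pair_eq_pair_iff.1 hRT.symm

end IsNormalForm

end Pseudoregulus

/-! ### Extending σ to a larger field -/

section FieldExtension

theorem FiniteField.exists_eq_pow_two_pow {F : Type*} [Field F] [Finite F] [CharP F 2]
    (σ : F →+* F) : ∃ n : ℕ, ∀ x, σ x = x ^ 2 ^ n := by
  let _ : Algebra (ZMod 2) F := ZMod.algebra F 2
  let σ' : F →ₐ[ZMod 2] F :=
    { σ with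
      commutes' := fun r => congrArg (fun f : ZMod 2 →+* F => f r)
        (Subsingleton.elim (σ.comp (algebraMap (ZMod 2) F)) (algebraMap (ZMod 2) F)) }
  obtain ⟨n, hn⟩ := (FiniteField.bijective_frobeniusAlgHom_pow (ZMod 2) F).2 σ'
  refine ⟨n, fun x => ?_⟩
  have h1 : σ x = (FiniteField.frobeniusAlgHom (ZMod 2) F ^ n.1) x := by
    change σ' x = _
    rw [← hn]
  rw [h1, AlgHom.coe_pow, FiniteField.coe_frobeniusAlgHom, pow_iterate, ZMod.card]

theorem pow_two_pow_eq_of_modEq {F : Type*} [Field F] [Finite F] {h m n : ℕ}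
    (hF : Nat.card F = 2 ^ h) (hmn : m ≡ n [MOD h]) (x : F) : x ^ 2 ^ m = x ^ 2 ^ n := by
  cases nonempty_fintype F
  have key : ∀ m, x ^ 2 ^ m = x ^ 2 ^ (m % h) := fun m => by
    conv_lhs => rw [← Nat.div_add_mod m h, pow_add, pow_mul, pow_mul, ← hF,
      Nat.card_eq_fintype_card, FiniteField.pow_card_pow]
  rw [key m, key n, hmn]

/-- A common divisor g > 1 of n and h would give a unit of order 2^g - 1 > 1, a suitable power of a
generator. It would be fixed because 2^g - 1 divides 2^n - 1. -/
theorem coprime_of_forall_pow_two_pow_eq {F : Type*} [Field F] [Finite F] {h n : ℕ}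
    (hF : Nat.card F = 2 ^ h) (hn : ∀ x : F, x ^ 2 ^ n = x → x = 0 ∨ x = 1) (h0 : h ≠ 0) :
    n.Coprime h := by
  by_contra hg
  set g := n.gcd h with hgdef
  have hg0 : 0 < g := Nat.gcd_pos_of_pos_right _ (Nat.pos_of_ne_zero h0)
  have hg2 : 2 ≤ g := by
    have : g ≠ 1 := hg
    omega
  have hgh : g ∣ h := Nat.gcd_dvd_right _ _
  have hgn : g ∣ n := Nat.gcd_dvd_left _ _
  have h4 : 2 ^ 2 ≤ 2 ^ g := Nat.pow_le_pow_right (by norm_num) hg2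
  obtain ⟨ζ, hζ⟩ := IsCyclic.exists_ofOrder_eq_natCard (α := Fˣ)
  have hunits : Nat.card Fˣ = 2 ^ h - 1 := by rw [Nat.card_units, hF]
  obtain ⟨d, hd⟩ := Nat.pow_sub_one_dvd_pow_sub_one 2 hgh
  have hd0 : d ≠ 0 := by
    rintro rfl
    rw [mul_zero] at hd
    have : 2 ^ 1 ≤ 2 ^ h := Nat.pow_le_pow_right (by norm_num) (by omega)
    omega
  have horder : orderOf (ζ ^ d) = 2 ^ g - 1 := by
    rw [orderOf_pow_of_dvd hd0 (by rw [hζ, hunits, hd]; exact Dvd.intro_left _ rfl), hζ, hunits, hd,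
      Nat.mul_div_cancel _ (Nat.pos_of_ne_zero hd0)]
  have h1 : (ζ ^ d) ^ 2 ^ n = ζ ^ d := by
    obtain ⟨e, he⟩ := Nat.pow_sub_one_dvd_pow_sub_one 2 hgn
    have h2 : 2 ^ n = (2 ^ g - 1) * e + 1 := by
      have : 1 ≤ 2 ^ n := Nat.one_le_two_pow
      omega
    rw [h2, pow_succ, pow_mul, ← horder, pow_orderOf_eq_one, one_pow, one_mul]
  rcases hn _ (by simpa using congrArg Units.val h1 : ((ζ ^ d : Fˣ) : F) ^ 2 ^ n = _) with h3 | h3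
  · exact (ζ ^ d).ne_zero h3
  · have h5 : ζ ^ d = 1 := Units.ext h3
    rw [h5, orderOf_one] at horder
    omega

/-- A generator of the automorphism group of a finite field of characteristic two extends to a
generator of the automorphism group of an extension. -/
theorem FiniteField.exists_extension_fixed_eq {F : Type u} [Field F] [Finite F] [CharP F 2]
    {h k : ℕ} (hF : Nat.card F = 2 ^ h) (h0 : h ≠ 0) (k0 : k ≠ 0) (σ : F →+* F)
    (hσ : ∀ x, σ x = x → x = 0 ∨ x = 1) :
    ∃ (K : Type u) (_ : Field K) (_ : Algebra F K) (τ : K →+* K), finrank F K = k ∧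
      (∀ c : F, τ (algebraMap F K c) = algebraMap F K (σ c)) ∧
      ∀ y : K, τ y = y → y = 0 ∨ y = 1 := by
  have : NeZero k := ⟨k0⟩
  have hhk : NeZero (h * k) := ⟨mul_ne_zero h0 k0⟩
  -- The lift puts K into the universe of F, as the definition of a Desarguesian spread requires.
  let K := ULift.{u} (FiniteField.Extension F 2 k)
  have hfin : finrank F K = k :=
    (ULift.moduleEquiv (R := F) (M := FiniteField.Extension F 2 k)).finrank_eq.trans
      (FiniteField.finrank_extension F 2 k)
  have : FiniteDimensional F K := .of_finrank_pos (by omega)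
  have : Finite K := Module.finite_of_finite F
  have hK : Nat.card K = 2 ^ (h * k) := by
    rw [card_eq_card_pow_finrank (F := F) (W := K), hfin, hF, pow_mul]
  have : CharP K 2 := charP_of_injective_algebraMap (algebraMap F K).injective 2
  obtain ⟨n, hn⟩ := FiniteField.exists_eq_pow_two_pow σ
  have hcop := coprime_of_forall_pow_two_pow_eq (n := n) hF
    (fun x hx => hσ x ((hn x).trans hx)) h0
  -- Units modulo h lift to units modulo hk, so n can be replaced by some m ≡ n modulo h that is
  -- coprime to hk. The 2^m-th power map on K then extends σ and fixes only 0 and 1.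
  obtain ⟨w, hw⟩ := ZMod.unitsMap_surjective (dvd_mul_right h k) (ZMod.unitOfCoprime n hcop)
  set m := (w : ZMod (h * k)).val with hm
  have hm_cop : m.Coprime (h * k) := ZMod.val_coe_unit_coprime w
  have hmn : m ≡ n [MOD h] := by
    rw [← ZMod.natCast_eq_natCast_iff]
    have h1 := congrArg Units.val hw
    rw [ZMod.unitsMap_val, ZMod.coe_unitOfCoprime] at h1
    rw [← h1, hm, ZMod.natCast_val]
  refine ⟨K, inferInstance, inferInstance, iterateFrobenius K 2 m, hfin, fun c => ?_,
    fun y hy => ?_⟩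
  · rw [iterateFrobenius_def, ← map_pow, hn, pow_two_pow_eq_of_modEq hF hmn]
  · have h1 : Function.IsPeriodicPt (frobenius K 2) m y := by
      change (frobenius K 2)^[m] y = y
      rw [← coe_iterateFrobenius]
      exact hy
    have h2 : Function.IsPeriodicPt (frobenius K 2) (h * k) y := by
      change (frobenius K 2)^[h * k] y = y
      cases nonempty_fintype K
      rw [← coe_iterateFrobenius, iterateFrobenius_def, ← hK, Nat.card_eq_fintype_card,
        FiniteField.pow_card]
    have h3 := h1.gcd h2
    rw [hm_cop] at h3
    have h4 : y ^ 2 = y := h3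
    have h5 : y * (y - 1) = 0 := by linear_combination h4
    rcases mul_eq_zero.1 h5 with h6 | h6
    · exact Or.inl h6
    · exact Or.inr (sub_eq_zero.1 h6)

end FieldExtension

/-! ### The Desarguesian spread -/

section DesarguesianSpread

variable {F : Type u} [Field F] {V : Type v} [AddCommGroup V] [Module F V]
  {K : Type*} [Field K] [Algebra F K]

theorem Projectivization.mem_submodule_mk_iff {W : Type*} [AddCommGroup W] [Module K W]
    {v w : W} (hv : v ≠ 0) : w ∈ (Projectivization.mk K v hv).submodule ↔ ∃ c : K, w = c • v := by
  rw [Projectivization.submodule_mk, Submodule.mem_span_singleton]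
  simp only [eq_comm]

/-- The element of the spread that arises from the point `x` by field reduction. -/
def spreadElement {W : Type*} [AddCommGroup W] [Module K W] [Module F W] [IsScalarTower F K W]
    (E : W →ₗ[F] V) (x : ℙ K W) : Submodule F V :=
  (x.submodule.restrictScalars F).map E

theorem mem_spreadElement_mk {W : Type*} [AddCommGroup W] [Module K W] [Module F W]
    [IsScalarTower F K W] (E : W →ₗ[F] V) {v : W} (hv : v ≠ 0) {w : V} :
    w ∈ spreadElement E (Projectivization.mk K v hv) ↔ ∃ c : K, w = E (c • v) := by
  constructor
  · rintro ⟨x, hx, rfl⟩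
    obtain ⟨c, rfl⟩ := (Projectivization.mem_submodule_mk_iff hv).1 hx
    exact ⟨c, rfl⟩
  · rintro ⟨c, rfl⟩
    exact ⟨c • v, (Projectivization.mem_submodule_mk_iff hv).2 ⟨c, rfl⟩, rfl⟩

/-- The `F`-linear set `{⟨(y, τ(y))⟩}` has exactly one point in every element of the spread other
than the two axes. -/
theorem existsUnique_mem_spreadElement [Finite K] {τ : K →+* K}
    (hτ : ∀ y, τ y = y → y = 0 ∨ y = 1) {E : (Fin 2 → K) →ₗ[F] V} (hE : Function.Injective E)
    {D : Set (ℙ F V)}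
    (hD : ∀ R : ℙ F V, R ∈ D ↔ ∃ y : K, y ≠ 0 ∧ E ![y, τ y] ∈ R.submodule)
    {v : Fin 2 → K} (hv : v ≠ 0) (h0 : v 0 ≠ 0) (h1 : v 1 ≠ 0) :
    ∃! P : ℙ F V, P ∈ D ∧ P ∈ pointsOf (spreadElement E (Projectivization.mk K v hv)) := by
  have hne : ∀ y : K, y ≠ 0 → E ![y, τ y] ≠ 0 := fun y hy h =>
    hy (congrFun (hE (h.trans (map_zero E).symm)) 0)
  -- A vector (y, τ(y)) is a K-multiple of v exactly if τ(y) = (v₁ / v₀) y. The quotient of two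
  -- nonzero solutions is fixed by τ, so it is 1.
  obtain ⟨y, hy0, hy⟩ := exists_map_eq_mul_of_fixed_eq hτ (div_ne_zero h1 h0)
  have hyv : ![y, τ y] = (y / v 0) • v := by
    ext i
    fin_cases i
    · simp [h0]
    · simp [hy]; field_simp
  refine ⟨Projectivization.mk F _ (hne y hy0), ⟨(hD _).2 ⟨y, hy0,
    Projectivization.mem_submodule_mk _ _⟩, (Projectivization.mem_pointsOf_iff
      (Projectivization.mem_submodule_mk _ _) (hne y hy0)).2
      ((mem_spreadElement_mk E hv).2 ⟨_, congrArg E hyv⟩)⟩, ?_⟩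
  rintro P ⟨hPD, hPT⟩
  obtain ⟨z, hz0, hz⟩ := (hD P).1 hPD
  obtain ⟨c, hc⟩ := (mem_spreadElement_mk E hv).1 (hPT hz)
  have h2 := hE hc
  have h3 : z = c * v 0 := congrFun h2 0
  have h4 : τ z = c * v 1 := congrFun h2 1
  have h5 : τ (z / y) = z / y := by
    rw [map_div₀, h4, hy, h3]
    field_simp
  rcases hτ _ h5 with h6 | h6
  · exact (div_ne_zero hz0 hy0 h6).elim
  · rw [div_eq_one_iff_eq hy0] at h6
    subst h6
    exact Projectivization.eq_of_mem_of_mem hz (Projectivization.mem_submodule_mk _ _) (hne z hz0)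

end DesarguesianSpread

namespace IsNormalForm

variable {F : Type u} [Field F] {V : Type v} [AddCommGroup V] [Module F V]
  {k : ℕ} {H : Submodule F V} {U : AddSubgroup V} {σ : F →+* F}
  {Φ : (Fin k → F) × (Fin k → F) →ₗ[F] V}

/-- In terms of an extension `K` of degree `k`, the group `U` is the graph of an automorphism. -/
theorem exists_equiv [Finite F] (hΦ : IsNormalForm H U σ Φ) {K : Type*} [Field K] [Algebra F K]
    (hk : k ≠ 0) (hK : finrank F K = k) (τ : K →+* K)
    (hτ : ∀ c : F, τ (algebraMap F K c) = algebraMap F K (σ c)) :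
    ∃ e : (Fin 2 → K) ≃ₗ[F] H,
      (∀ w, w ∈ U ↔ ∃ y : K, w = (e ![y, τ y] : V)) ∧
      (∀ w, w ∈ leftSpace Φ ↔ ∃ y : K, w = (e ![y, 0] : V)) ∧
      ∀ w, w ∈ rightSpace Φ ↔ ∃ y : K, w = (e ![0, y] : V) := by
  have hσ : Function.Bijective σ := Finite.injective_iff_bijective.1 σ.injective
  have : FiniteDimensional F K := .of_finrank_pos (by omega)
  let b : Basis (Fin k) F K := finBasisOfFinrankEq F K hK
  have hsum : ∀ x : Fin k → F, τ (∑ i, x i • b i) = ∑ i, σ (x i) • τ (b i) := fun x => by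
    rw [map_sum]
    exact Finset.sum_congr rfl fun i _ => by
      rw [Algebra.smul_def, map_mul, hτ, Algebra.smul_def]
  have hli : LinearIndependent F (fun i => τ (b i)) := by
    rw [Fintype.linearIndependent_iff]
    intro g hg
    choose d hd using fun i => hσ.2 (g i)
    simp only [← hd] at hg
    rw [← hsum] at hg
    have h1 := (map_eq_zero τ).1 hg
    intro i
    rw [← hd, Fintype.linearIndependent_iff.1 b.linearIndependent d h1 i, map_zero]
  have : Nonempty (Fin k) := ⟨⟨0, Nat.pos_of_ne_zero hk⟩⟩
  -- Reading the second factor in the basis τ(b i) turns the graph of σ into the graph of τ, because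
  -- τ(∑ xᵢ bᵢ) = ∑ σ(xᵢ) τ(bᵢ).
  let b' : Basis (Fin k) F K := basisOfLinearIndependentOfCardEqFinrank hli (by simp [hK])
  have hb' : ∀ i, b' i = τ (b i) := fun i => by simp [b']
  let E : (Fin 2 → K) →ₗ[F] V := Φ ∘ₗ
    (b.equivFun.toLinearMap ∘ₗ LinearMap.proj 0).prod (b'.equivFun.toLinearMap ∘ₗ LinearMap.proj 1)
  have hEdef : ∀ v, E v = Φ (b.equivFun (v 0), b'.equivFun (v 1)) := fun v => rfl
  have hE : Function.Injective E := fun v w h => by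
    have h1 := hΦ.injective h
    ext i
    fin_cases i
    · exact b.equivFun.injective (congrArg Prod.fst h1)
    · exact b'.equivFun.injective (congrArg Prod.snd h1)
  have hE2 : ∀ x z, Φ (x, z) = E ![b.equivFun.symm x, b'.equivFun.symm z] := fun x z => by
    rw [hEdef]
    change _ = Φ (b.equivFun (b.equivFun.symm x), b'.equivFun (b'.equivFun.symm z))
    rw [LinearEquiv.apply_symm_apply, LinearEquiv.apply_symm_apply]
  have hrange : LinearMap.range E = H := by
    rw [← hΦ.range_eq]
    refine le_antisymm ?_ ?_
    · rintro _ ⟨v, rfl⟩; exact ⟨_, rfl⟩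
    · rintro _ ⟨⟨x, z⟩, rfl⟩; exact ⟨_, (hE2 x z).symm⟩
  have hgraph : ∀ x : Fin k → F, b'.equivFun.symm (σ ∘ x) = τ (b.equivFun.symm x) := fun x => by
    rw [Basis.equivFun_symm_apply, Basis.equivFun_symm_apply, hsum]
    simp [hb']
  refine ⟨(LinearEquiv.ofInjective E hE).trans (LinearEquiv.ofEq _ _ hrange), ?_, ?_, ?_⟩
  · intro w
    rw [hΦ.mem_iff]
    constructor
    · rintro ⟨x, rfl⟩
      exact ⟨b.equivFun.symm x, by rw [hE2, hgraph]; rfl⟩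
    · rintro ⟨y, rfl⟩
      refine ⟨b.equivFun y, ?_⟩
      rw [hE2, hgraph, LinearEquiv.symm_apply_apply]
      rfl
  · intro w
    constructor
    · rintro ⟨x, rfl⟩
      refine ⟨b.equivFun.symm x, ?_⟩
      change Φ (x, 0) = _
      rw [hE2, map_zero]
      rfl
    · rintro ⟨y, rfl⟩
      refine ⟨b.equivFun y, ?_⟩
      change Φ (b.equivFun y, 0) = _
      rw [hE2, map_zero, LinearEquiv.symm_apply_apply]
      rfl
  · intro w
    constructor
    · rintro ⟨x, rfl⟩
      refine ⟨b'.equivFun.symm x, ?_⟩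
      change Φ (0, x) = _
      rw [hE2, map_zero]
      rfl
    · rintro ⟨y, rfl⟩
      refine ⟨b'.equivFun y, ?_⟩
      change Φ (0, b'.equivFun y) = _
      rw [hE2, map_zero, LinearEquiv.symm_apply_apply]
      rfl

/-- In the coordinates over K the two transversal spaces are the axes, and U is the graph of τ.
Field reduction of the points of PG(1, K) therefore works. -/
theorem exists_isSuitableSpread [Finite F] [CharP F 2] (hΦ : IsNormalForm H U σ Φ) {h : ℕ}
    (hF : Nat.card F = 2 ^ h) (h0 : h ≠ 0) (hk : k ≠ 0) (hσ : ∀ c, σ c = c → c = 0 ∨ c = 1)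
    {D : Set (ℙ F V)} (hD : ∀ R : ℙ F V, R ∈ D ↔ ∃ u ∈ U, u ≠ 0 ∧ u ∈ R.submodule) :
    ∃ S, IsSuitableSpread k H D (leftSpace Φ) (rightSpace Φ) S := by
  obtain ⟨K, _, _, τ, hK, hτσ, hτ⟩ := FiniteField.exists_extension_fixed_eq hF h0 hk σ hσ
  have : FiniteDimensional F K := .of_finrank_pos (by omega)
  have : Finite K := Module.finite_of_finite F
  obtain ⟨e, heU, heL, heR⟩ := hΦ.exists_equiv hk hK τ hτσ
  set E : (Fin 2 → K) →ₗ[F] V := H.subtype ∘ₗ e.toLinearMap with hEdef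
  have hE : Function.Injective E := H.injective_subtype.comp e.injective
  have hleft : ∀ (v : Fin 2 → K) (hv : v ≠ 0), v 1 = 0 →
      spreadElement E (Projectivization.mk K v hv) = leftSpace Φ := by
    intro v hv h1
    have h2 : v 0 ≠ 0 := fun h2 => hv (by ext i; fin_cases i <;> assumption)
    ext w
    rw [mem_spreadElement_mk, heL]
    constructor
    · rintro ⟨c, rfl⟩
      exact ⟨c * v 0, congrArg E (by ext i; fin_cases i <;> simp [h1])⟩
    · rintro ⟨y, rfl⟩
      exact ⟨y / v 0, congrArg E (by ext i; fin_cases i <;> simp [h1, h2])⟩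
  have hright : ∀ (v : Fin 2 → K) (hv : v ≠ 0), v 0 = 0 →
      spreadElement E (Projectivization.mk K v hv) = rightSpace Φ := by
    intro v hv h1
    have h2 : v 1 ≠ 0 := fun h2 => hv (by ext i; fin_cases i <;> assumption)
    ext w
    rw [mem_spreadElement_mk, heR]
    constructor
    · rintro ⟨c, rfl⟩
      exact ⟨c * v 1, congrArg E (by ext i; fin_cases i <;> simp [h1])⟩
    · rintro ⟨y, rfl⟩
      exact ⟨y / v 1, congrArg E (by ext i; fin_cases i <;> simp [h1, h2])⟩
  have hl0 : (![1, 0] : Fin 2 → K) ≠ 0 := fun h => one_ne_zero (congrFun h 0)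
  have hr0 : (![0, 1] : Fin 2 → K) ≠ 0 := fun h => one_ne_zero (congrFun h 1)
  refine ⟨{T | ∃ x : ℙ K (Fin 2 → K), T = spreadElement E x}, ⟨K, _, _, hK, e, rfl⟩,
    ⟨_, (hleft _ hl0 rfl).symm⟩, ⟨_, (hright _ hr0 rfl).symm⟩, ?_⟩
  rintro _ ⟨x, rfl⟩ hxl hxr
  induction x using Projectivization.ind with
  | h v hv =>
    refine existsUnique_mem_spreadElement hτ hE (fun R => ?_) hv
      (fun h => hxr (hright v hv h)) (fun h => hxl (hleft v hv h))
    rw [hD]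
    constructor
    · rintro ⟨u, hu, hu0, huR⟩
      obtain ⟨y, rfl⟩ := (heU u).1 hu
      refine ⟨y, fun hy => hu0 ?_, huR⟩
      subst hy
      rw [map_zero, show (![0, 0] : Fin 2 → K) = 0 from by ext i; fin_cases i <;> rfl, map_zero]
      rfl
    · rintro ⟨y, hy, hyR⟩
      exact ⟨_, (heU _).2 ⟨y, rfl⟩, fun h => hy (congrFun (hE (h.trans (map_zero E).symm)) 0), hyR⟩

end IsNormalForm

/-! ### The André/Bruck–Bose plane of a Desarguesian spread -/

section BruckBose

variable {F : Type u} [Field F] {V : Type v} [AddCommGroup V] [Module F V]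
  {H : Submodule F V} {S : Set (Submodule F V)}

/-- The subspace of `V` that is a given point of the André/Bruck–Bose plane. -/
def BBPoint.carrier : BBPoint H S → Submodule F V
  | .affine P _ => P.submodule
  | .infinite T _ => T

/-- The subspace of `V` whose points make up a given line of the André/Bruck–Bose plane. -/
def BBLine.carrier : BBLine H S → Submodule F V
  | .affine M _ => M
  | .atInfinity => H

theorem BBLine.mem_iff (hS : ∀ T ∈ S, T ≤ H) (X : BBPoint H S) (l : BBLine H S) :
    X ∈ l ↔ X.carrier ≤ l.carrier := by
  cases X with
  | affine P hP =>
    cases l with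
    | affine M hM => exact Iff.rfl
    | atInfinity => exact iff_of_false id hP
  | infinite T hT =>
    cases l with
    | affine M hM => exact Iff.rfl
    | atInfinity => exact iff_of_true trivial (hS T hT)

theorem BBPoint.carrier_injective (hS : ∀ T ∈ S, T ≤ H) :
    Function.Injective (BBPoint.carrier : BBPoint H S → Submodule F V) := by
  intro X Y h
  cases X with
  | affine P hP =>
    cases Y with
    | affine P' hP' =>
      have := Projectivization.submodule_injective h
      subst this
      rfl
    | infinite T hT =>
      exact (hP (show P.submodule ≤ H from (show P.submodule = T from h) ▸ hS T hT)).elim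
  | infinite T hT =>
    cases Y with
    | affine P hP =>
      exact (hP (show P.submodule ≤ H from (show T = P.submodule from h) ▸ hS T hT)).elim
    | infinite T' hT' =>
      have : T = T' := h
      subst this
      rfl

theorem BBLine.carrier_injective :
    Function.Injective (BBLine.carrier : BBLine H S → Submodule F V) := by
  have key : ∀ M : Submodule F V, (∃ T ∈ S, ∃ P : ℙ F V, P ∉ pointsOf H ∧ M = T ⊔ P.submodule) →
      M ≠ H := by
    rintro _ ⟨T, -, P, hP, rfl⟩ h
    exact hP (show P.submodule ≤ H from le_sup_right.trans h.le)
  intro X Y h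
  cases X with
  | affine M hM =>
    cases Y with
    | affine M' hM' =>
      have : M = M' := h
      subst this
      rfl
    | atInfinity => exact (key M hM h).elim
  | atInfinity =>
    cases Y with
    | affine M hM => exact (key M hM h.symm).elim
    | atInfinity => rfl

variable {K : Type*} [Field K] [Algebra F K]

/-- The `F`-subspace that a `K`-subspace cuts out on the image of `ψ`. -/
def traceSpace (ψ : V →ₗ[F] (Fin 3 → K)) (N : Submodule K (Fin 3 → K)) : Submodule F V :=
  (N.restrictScalars F).comap ψ

theorem mem_traceSpace {ψ : V →ₗ[F] (Fin 3 → K)} {N : Submodule K (Fin 3 → K)} {v : V} :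
    v ∈ traceSpace ψ N ↔ ψ v ∈ N := Iff.rfl

/-- `ψ` embeds `V` into `K ^ 3` as the set of the vectors with last coordinate in `F`, and `H` as
the set of the vectors with last coordinate zero, so that the elements of `S` become the
one-dimensional `K`-subspaces of the latter. The functional `f` is the last coordinate. -/
structure IsBBEmbedding (H : Submodule F V) (S : Set (Submodule F V)) (f : V →ₗ[F] F)
    (ψ : V →ₗ[F] (Fin 3 → K)) : Prop where
  apply_eq_zero : ∀ v, f v = 0 ↔ v ∈ H
  injective : Function.Injective ψ
  apply_two : ∀ v, ψ v 2 = algebraMap F K (f v)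
  exists_eq : ∀ z : Fin 3 → K, z 2 = 0 ∨ z 2 = 1 → ∃ v, ψ v = z
  mem_spread : ∀ T, T ∈ S ↔ ∃ z : Fin 3 → K, z ≠ 0 ∧ z 2 = 0 ∧
    T = traceSpace ψ (Submodule.span K {z})

namespace IsBBEmbedding

variable {f : V →ₗ[F] F} {ψ : V →ₗ[F] (Fin 3 → K)}

theorem le_of_mem (hψ : IsBBEmbedding H S f ψ) {T : Submodule F V} (hT : T ∈ S) : T ≤ H := by
  obtain ⟨z, -, hz2, rfl⟩ := (hψ.mem_spread T).1 hT
  intro v hv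
  obtain ⟨c, hc⟩ := Submodule.mem_span_singleton.1 (mem_traceSpace.1 hv)
  rw [← hψ.apply_eq_zero]
  have h1 := hψ.apply_two v
  rw [← hc, Pi.smul_apply, hz2, smul_zero] at h1
  exact (map_eq_zero (algebraMap F K)).1 h1.symm

/-- Dividing by the last coordinate, if it is nonzero, brings a vector into the image of ψ. This is
why K-subspaces are determined by their traces. -/
theorem exists_smul_eq (hψ : IsBBEmbedding H S f ψ) (z : Fin 3 → K) :
    ∃ c : K, c ≠ 0 ∧ ∃ v, ψ v = c • z := by
  by_cases h : z 2 = 0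
  · exact ⟨1, one_ne_zero, hψ.exists_eq _ (Or.inl (by simp [h]))⟩
  · exact ⟨(z 2)⁻¹, inv_ne_zero h, hψ.exists_eq _ (Or.inr (by simp [h]))⟩

theorem traceSpace_le_iff (hψ : IsBBEmbedding H S f ψ) {N N' : Submodule K (Fin 3 → K)} :
    traceSpace ψ N ≤ traceSpace ψ N' ↔ N ≤ N' := by
  refine ⟨fun h z hz => ?_, fun h v hv => h hv⟩
  obtain ⟨c, hc, v, hv⟩ := hψ.exists_smul_eq z
  have h1 : v ∈ traceSpace ψ N := by rw [mem_traceSpace, hv]; exact N.smul_mem c hz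
  have h2 := h h1
  rw [mem_traceSpace, hv] at h2
  exact (N'.smul_mem_iff hc).1 h2

theorem traceSpace_injective (hψ : IsBBEmbedding H S f ψ) : Function.Injective (traceSpace ψ) :=
  fun _ _ h => le_antisymm (hψ.traceSpace_le_iff.1 h.le) (hψ.traceSpace_le_iff.1 h.ge)

/-- As z has last coordinate zero, the last coordinate forces the coefficient of ψ v to lie in F. So
the span over K adds no more than the span over F does. -/
theorem traceSpace_sup (hψ : IsBBEmbedding H S f ψ) {z : Fin 3 → K} (hz : z 2 = 0) {v : V}
    (hv : v ∉ H) :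
    traceSpace ψ (Submodule.span K {z} ⊔ Submodule.span K {ψ v}) =
      traceSpace ψ (Submodule.span K {z}) ⊔ Submodule.span F {v} := by
  have hfv : f v ≠ 0 := fun h => hv ((hψ.apply_eq_zero v).1 h)
  refine le_antisymm (fun w hw => ?_) (sup_le (fun w hw => ?_) ?_)
  · obtain ⟨t, ht, s, hs, hts⟩ := Submodule.mem_sup.1 (mem_traceSpace.1 hw)
    obtain ⟨c, rfl⟩ := Submodule.mem_span_singleton.1 hs
    obtain ⟨d, rfl⟩ := Submodule.mem_span_singleton.1 ht
    have h1 : c * algebraMap F K (f v) = algebraMap F K (f w) := by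
      rw [← hψ.apply_two, ← hψ.apply_two, ← hts]
      simp [hz]
    have h2 : c • ψ v = ψ ((f w / f v) • v) := by
      rw [map_smul, ← algebraMap_smul K (f w / f v), map_div₀, ← h1, mul_div_cancel_right₀]
      simpa using hfv
    have h3 : ψ (w - (f w / f v) • v) = d • z := by
      rw [map_sub, ← h2, ← hts, add_sub_cancel_right]
    refine Submodule.mem_sup.2 ⟨w - (f w / f v) • v, ?_, (f w / f v) • v,
      Submodule.mem_span_singleton.2 ⟨_, rfl⟩, sub_add_cancel _ _⟩
    rw [mem_traceSpace, h3]
    exact Submodule.mem_span_singleton.2 ⟨_, rfl⟩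
  · exact (le_sup_left : Submodule.span K {z} ≤ _) hw
  · rw [Submodule.span_singleton_le_iff_mem, mem_traceSpace]
    exact (le_sup_right : Submodule.span K {ψ v} ≤ _) (Submodule.mem_span_singleton_self _)

theorem traceSpace_span (hψ : IsBBEmbedding H S f ψ) {v : V} (hv : v ∉ H) :
    traceSpace ψ (Submodule.span K {ψ v}) = Submodule.span F {v} := by
  have h := hψ.traceSpace_sup (z := 0) rfl hv
  have h0 : traceSpace ψ (⊥ : Submodule K (Fin 3 → K)) = ⊥ := by
    rw [eq_bot_iff]
    intro w hw
    exact hψ.injective (((Submodule.mem_bot K).1 hw).trans (map_zero ψ).symm)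
  rwa [Submodule.span_zero_singleton, bot_sup_eq, h0, bot_sup_eq] at h

theorem exists_point (hψ : IsBBEmbedding H S f ψ) (X : BBPoint H S) :
    ∃ p : ℙ K (Fin 3 → K), X.carrier = traceSpace ψ p.submodule := by
  cases X with
  | affine P hP =>
    induction P using Projectivization.ind with
    | h v hv =>
      have hvH : v ∉ H := fun h =>
        hP ((Projectivization.mem_pointsOf_iff (Projectivization.mem_submodule_mk v hv) hv).2 h)
      have hψv : ψ v ≠ 0 := fun h => hv (hψ.injective (h.trans (map_zero ψ).symm))
      refine ⟨Projectivization.mk K _ hψv, ?_⟩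
      rw [Projectivization.submodule_mk, hψ.traceSpace_span hvH]
      exact Projectivization.submodule_mk v hv
  | infinite T hT =>
    obtain ⟨z, hz, -, rfl⟩ := (hψ.mem_spread T).1 hT
    exact ⟨Projectivization.mk K z hz, by rw [Projectivization.submodule_mk]; rfl⟩

theorem exists_bbPoint (hψ : IsBBEmbedding H S f ψ) (p : ℙ K (Fin 3 → K)) :
    ∃ X : BBPoint H S, X.carrier = traceSpace ψ p.submodule := by
  induction p using Projectivization.ind with
  | h z hz =>
    rw [Projectivization.submodule_mk]
    by_cases h2 : z 2 = 0
    · exact ⟨.infinite _ ((hψ.mem_spread _).2 ⟨z, hz, h2, rfl⟩), rfl⟩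
    · obtain ⟨c, hc, v, hv⟩ := hψ.exists_smul_eq z
      have hvH : v ∉ H := fun h => by
        have h3 := hψ.apply_two v
        rw [(hψ.apply_eq_zero v).2 h, hv, map_zero, Pi.smul_apply, smul_eq_mul] at h3
        exact (mul_ne_zero hc h2) h3
      have hv0 : v ≠ 0 := fun h => hvH (h ▸ H.zero_mem)
      refine ⟨.affine (Projectivization.mk F v hv0) fun h => hvH
        ((Projectivization.mem_pointsOf_iff (Projectivization.mem_submodule_mk v hv0) hv0).1 h), ?_⟩
      rw [← Submodule.span_singleton_smul_eq (IsUnit.mk0 c hc), ← hv, hψ.traceSpace_span hvH]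
      exact Projectivization.submodule_mk v hv0

theorem finrank_span_sup {z w : Fin 3 → K} (hz : z ≠ 0) (hz2 : z 2 = 0) (hw : w 2 ≠ 0) :
    finrank K ↥(Submodule.span K {z} ⊔ Submodule.span K {w}) = 2 := by
  have hind : LinearIndependent K ![z, w] := by
    rw [LinearIndependent.pair_iff]
    intro a b h
    have h1 : b = 0 := by simpa [hz2, hw] using congrFun h 2
    subst h1
    rw [zero_smul, add_zero] at h
    exact ⟨(smul_eq_zero.1 h).resolve_right hz, rfl⟩
  rw [← Submodule.span_insert]
  exact finrank_span_pair hind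

/-- The line at infinity. -/
def lineAtInfinity (K : Type*) [Field K] : Submodule K (Fin 3 → K) :=
  LinearMap.ker (LinearMap.proj 2 : (Fin 3 → K) →ₗ[K] K)

theorem mem_lineAtInfinity {z : Fin 3 → K} : z ∈ lineAtInfinity K ↔ z 2 = 0 := Iff.rfl

theorem finrank_lineAtInfinity : finrank K (lineAtInfinity K) = 2 := by
  have h1 := LinearMap.finrank_range_add_finrank_ker
    (LinearMap.proj 2 : (Fin 3 → K) →ₗ[K] K)
  rw [LinearMap.range_eq_top.2 (LinearMap.proj_surjective 2), finrank_top, finrank_self,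
    finrank_fin_fun] at h1
  change finrank K (LinearMap.ker (LinearMap.proj 2 : (Fin 3 → K) →ₗ[K] K)) = 2
  omega

theorem traceSpace_lineAtInfinity (hψ : IsBBEmbedding H S f ψ) :
    traceSpace ψ (lineAtInfinity K) = H := by
  ext v
  rw [mem_traceSpace, mem_lineAtInfinity, hψ.apply_two, map_eq_zero, hψ.apply_eq_zero]

theorem exists_line (hψ : IsBBEmbedding H S f ψ) (l : BBLine H S) :
    ∃ N : PlaneLine K, l.carrier = traceSpace ψ N.1 := by
  cases l with
  | atInfinity => exact ⟨⟨_, finrank_lineAtInfinity⟩, hψ.traceSpace_lineAtInfinity.symm⟩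
  | affine M hM =>
    obtain ⟨T, hT, P, hP, rfl⟩ := hM
    obtain ⟨z, hz, hz2, rfl⟩ := (hψ.mem_spread T).1 hT
    induction P using Projectivization.ind with
    | h v hv =>
      have hvH : v ∉ H := fun h =>
        hP ((Projectivization.mem_pointsOf_iff (Projectivization.mem_submodule_mk v hv) hv).2 h)
      have h2 : ψ v 2 ≠ 0 := by
        rw [hψ.apply_two, Ne, map_eq_zero, hψ.apply_eq_zero]
        exact hvH
      refine ⟨⟨_, finrank_span_sup hz hz2 h2⟩, ?_⟩
      change _ ⊔ (Projectivization.mk F v hv).submodule = _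
      rw [hψ.traceSpace_sup hz2 hvH, Projectivization.submodule_mk]

theorem exists_bbLine (hψ : IsBBEmbedding H S f ψ) (N : PlaneLine K) :
    ∃ l : BBLine H S, l.carrier = traceSpace ψ N.1 := by
  obtain ⟨N, hN⟩ := N
  by_cases h : N ≤ lineAtInfinity K
  · refine ⟨.atInfinity, ?_⟩
    change H = traceSpace ψ N
    rw [Submodule.eq_of_le_of_finrank_eq h (by rw [hN, finrank_lineAtInfinity]),
      hψ.traceSpace_lineAtInfinity]
  · obtain ⟨w, hw, hw2⟩ := SetLike.not_le_iff_exists.1 h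
    rw [mem_lineAtInfinity] at hw2
    obtain ⟨c, hc, v, hv⟩ := hψ.exists_smul_eq w
    have hvN : ψ v ∈ N := hv ▸ N.smul_mem c hw
    have h2 : ψ v 2 ≠ 0 := by rw [hv]; exact mul_ne_zero hc hw2
    have hvH : v ∉ H := by
      rwa [hψ.apply_two, Ne, map_eq_zero, hψ.apply_eq_zero] at h2
    have hlt : Submodule.span K {ψ v} < N := by
      refine lt_of_le_of_ne ((Submodule.span_singleton_le_iff_mem _ _).2 hvN) fun h3 => ?_
      have h4 := finrank_span_singleton (K := K) (v := ψ v) (fun h5 => h2 (by rw [h5]; rfl))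
      rw [h3, hN] at h4
      omega
    obtain ⟨y, hyN, hy⟩ := SetLike.exists_of_lt hlt
    -- Subtracting a multiple of ψ v moves the second spanning vector to the line at infinity, where
    -- it gives a spread element.
    set z := y - (y 2 / ψ v 2) • ψ v with hz
    have hz0 : z ≠ 0 := fun h3 => hy (by
      rw [sub_eq_zero.1 h3]
      exact Submodule.mem_span_singleton.2 ⟨_, rfl⟩)
    have hz2 : z 2 = 0 := by simp [hz, h2]
    have hzN : z ∈ N := N.sub_mem hyN (N.smul_mem _ hvN)
    have hNeq : Submodule.span K {z} ⊔ Submodule.span K {ψ v} = N :=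
      Submodule.eq_of_le_of_finrank_eq (sup_le ((Submodule.span_singleton_le_iff_mem _ _).2 hzN)
        ((Submodule.span_singleton_le_iff_mem _ _).2 hvN))
        (by rw [finrank_span_sup hz0 hz2 h2, hN])
    have hv0 : v ≠ 0 := fun h => hvH (h ▸ H.zero_mem)
    refine ⟨.affine _ ⟨_, (hψ.mem_spread _).2 ⟨z, hz0, hz2, rfl⟩, Projectivization.mk F v hv0,
      fun h => hvH ((Projectivization.mem_pointsOf_iff
        (Projectivization.mem_submodule_mk v hv0) hv0).1 h), rfl⟩, ?_⟩
    change _ ⊔ (Projectivization.mk F v hv0).submodule = traceSpace ψ N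
    rw [Projectivization.submodule_mk, ← hψ.traceSpace_sup hz2 hvH, hNeq]

/-- The André/Bruck–Bose plane of a Desarguesian spread is Desarguesian. -/
theorem nonempty_iso (hψ : IsBBEmbedding H S f ψ) :
    Nonempty (Incidence.Iso (BBPoint H S) (BBLine H S) (ℙ K (Fin 3 → K)) (PlaneLine K)) := by
  have hS : ∀ T ∈ S, T ≤ H := fun T hT => hψ.le_of_mem hT
  choose g hg using hψ.exists_point
  choose m hm using hψ.exists_line
  have hgbij : Function.Bijective g := by
    refine ⟨fun X Y h => BBPoint.carrier_injective hS (by rw [hg, hg, h]), fun p => ?_⟩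
    obtain ⟨X, hX⟩ := hψ.exists_bbPoint p
    exact ⟨X, Projectivization.submodule_injective
      (hψ.traceSpace_injective ((hg X).symm.trans hX))⟩
  have hmbij : Function.Bijective m := by
    refine ⟨fun X Y h => BBLine.carrier_injective (by rw [hm, hm, h]), fun N => ?_⟩
    obtain ⟨l, hl⟩ := hψ.exists_bbLine N
    exact ⟨l, Subtype.ext (hψ.traceSpace_injective ((hm l).symm.trans hl))⟩
  refine ⟨⟨Equiv.ofBijective g hgbij, Equiv.ofBijective m hmbij, fun X l => ?_⟩⟩
  rw [BBLine.mem_iff hS, hg, hm, hψ.traceSpace_le_iff]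
  rfl

theorem eq_of_le (hψ : IsBBEmbedding H S f ψ) {T T' : Submodule F V} (hT : T ∈ S) (hT' : T' ∈ S)
    (h : T ≤ T') : T = T' := by
  obtain ⟨z, hz, hz2, rfl⟩ := (hψ.mem_spread T).1 hT
  obtain ⟨z', hz', hz2', rfl⟩ := (hψ.mem_spread T').1 hT'
  congr 1
  refine Submodule.eq_of_le_of_finrank_eq (hψ.traceSpace_le_iff.1 h) ?_
  rw [finrank_span_singleton hz, finrank_span_singleton hz']

theorem exists_mem (hψ : IsBBEmbedding H S f ψ) {u : V} (hu : u ∈ H) (hu0 : u ≠ 0) :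
    ∃ T ∈ S, u ∈ T :=
  ⟨_, (hψ.mem_spread _).2 ⟨ψ u, fun h => hu0 (hψ.injective (h.trans (map_zero ψ).symm)), by
    rw [hψ.apply_two, (hψ.apply_eq_zero u).2 hu, map_zero], rfl⟩,
    Submodule.mem_span_singleton_self _⟩

end IsBBEmbedding

/-- A Desarguesian spread of a hyperplane gives an embedding as in the André/Bruck–Bose
construction. -/
theorem exists_isBBEmbedding {f : V →ₗ[F] F} (hf : ∀ v, f v = 0 ↔ v ∈ H) {e₀ : V} (he₀ : f e₀ = 1)
    (e : (Fin 2 → K) ≃ₗ[F] H)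
    (hS : S = {T | ∃ x : ℙ K (Fin 2 → K),
      T = (x.submodule.restrictScalars F).map (H.subtype ∘ₗ e.toLinearMap)}) :
    ∃ ψ : V →ₗ[F] (Fin 3 → K), IsBBEmbedding H S f ψ := by
  -- This is the projection to H along e₀; ψ records its two K-coordinates and the value of f.
  let pr : V →ₗ[F] H := LinearMap.codRestrict H (LinearMap.id - f.smulRight e₀) fun v => by
    rw [← hf]; simp [he₀]
  have hpr : ∀ v, (pr v : V) = v - f v • e₀ := fun v => rfl
  have hprH : ∀ v : H, pr v = v := fun v => Subtype.ext (by
    rw [hpr, (hf v).2 v.2, zero_smul, sub_zero])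
  let ψ : V →ₗ[F] (Fin 3 → K) := LinearMap.pi
    ![LinearMap.proj 0 ∘ₗ e.symm.toLinearMap ∘ₗ pr, LinearMap.proj 1 ∘ₗ e.symm.toLinearMap ∘ₗ pr,
      Algebra.linearMap F K ∘ₗ f]
  have h0 : ∀ v, ψ v 0 = e.symm (pr v) 0 := fun v => rfl
  have h1 : ∀ v, ψ v 1 = e.symm (pr v) 1 := fun v => rfl
  have h2 : ∀ v, ψ v 2 = algebraMap F K (f v) := fun v => rfl
  have hψe : ∀ w : Fin 2 → K, ψ (e w) = ![w 0, w 1, 0] := fun w => by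
    ext i
    fin_cases i
    · change ψ _ 0 = _
      rw [h0, hprH, e.symm_apply_apply]; rfl
    · change ψ _ 1 = _
      rw [h1, hprH, e.symm_apply_apply]; rfl
    · change ψ _ 2 = _
      rw [h2, (hf _).2 (e w).2, map_zero]; rfl
  have hinj : Function.Injective ψ := by
    rw [← LinearMap.ker_eq_bot, LinearMap.ker_eq_bot']
    intro v hv
    have hfv : f v = 0 := (map_eq_zero (algebraMap F K)).1 ((h2 v).symm.trans (congrFun hv 2))
    have hp : e.symm (pr v) = 0 := by
      ext i
      fin_cases i
      · exact (h0 v).symm.trans (congrFun hv 0)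
      · exact (h1 v).symm.trans (congrFun hv 1)
    have hp' := congrArg Subtype.val ((LinearEquiv.map_eq_zero_iff e.symm).1 hp)
    rw [hpr, hfv, zero_smul, sub_zero] at hp'
    exact hp'
  have htrace : ∀ (w : Fin 2 → K) (hw : w ≠ 0),
      ((Projectivization.mk K w hw).submodule.restrictScalars F).map
        (H.subtype ∘ₗ e.toLinearMap) = traceSpace ψ (Submodule.span K {![w 0, w 1, 0]}) := by
    intro w hw
    ext v
    constructor
    · rintro ⟨x, hx, rfl⟩
      obtain ⟨c, rfl⟩ := (Projectivization.mem_submodule_mk_iff hw).1 hx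
      refine Submodule.mem_span_singleton.2 ⟨c, ?_⟩
      refine Eq.trans ?_ (hψe (c • w)).symm
      ext i; fin_cases i <;> simp
    · intro hv
      obtain ⟨c, hc⟩ := Submodule.mem_span_singleton.1 (mem_traceSpace.1 hv)
      refine ⟨c • w, (Projectivization.mem_submodule_mk_iff hw).2 ⟨c, rfl⟩, hinj ?_⟩
      rw [← hc]
      refine (hψe (c • w)).trans ?_
      ext i; fin_cases i <;> simp
  refine ⟨ψ, hf, hinj, h2, ?_, fun T => ?_⟩
  · have key : ∀ z : Fin 3 → K, ∀ a : F, z 2 = algebraMap F K a → ∃ v, ψ v = z := by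
      intro z a ha
      refine ⟨e ![z 0, z 1] + a • e₀, ?_⟩
      have hfe : f (e ![z 0, z 1] + a • e₀) = a := by
        rw [map_add, (hf _).2 (e _).2, map_smul, he₀, zero_add, smul_eq_mul, mul_one]
      have hp : pr (e ![z 0, z 1] + a • e₀) = e ![z 0, z 1] := Subtype.ext (by
        rw [hpr, hfe, add_sub_cancel_right])
      ext i
      fin_cases i
      · change ψ _ 0 = _
        rw [h0, hp, e.symm_apply_apply]; rfl
      · change ψ _ 1 = _
        rw [h1, hp, e.symm_apply_apply]; rfl
      · change ψ _ 2 = _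
        rw [h2, hfe, ← ha]; rfl
    rintro z (hz | hz)
    · exact key z 0 (by rw [hz, map_zero])
    · exact key z 1 (by rw [hz, map_one])
  · rw [hS]
    constructor
    · rintro ⟨x, rfl⟩
      induction x using Projectivization.ind with
      | h w hw =>
        refine ⟨![w 0, w 1, 0], fun h => hw ?_, rfl, htrace w hw⟩
        ext i
        fin_cases i
        · exact congrFun h 0
        · exact congrFun h 1
    · rintro ⟨z, hz, hz2, rfl⟩
      have hzz : z = ![(![z 0, z 1] : Fin 2 → K) 0, (![z 0, z 1] : Fin 2 → K) 1, 0] := by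
        ext i; fin_cases i
        · rfl
        · rfl
        · exact hz2
      have hw : (![z 0, z 1] : Fin 2 → K) ≠ 0 := fun h => hz (by
        rw [hzz, h]; ext i; fin_cases i <;> rfl)
      refine ⟨Projectivization.mk K _ hw, ?_⟩
      rw [htrace _ hw, ← hzz]

end BruckBose

/-! ### The hyperoval and its elations -/

section Translations

variable {F : Type u} [Field F] {V : Type v} [AddCommGroup V] [Module F V]
  {H : Submodule F V} {S : Set (Submodule F V)}

theorem map_eq_of_le_of_fixed {t : V ≃ₗ[F] V} (ht : ∀ v ∈ H, t v = v) {T : Submodule F V}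
    (hT : T ≤ H) : T.map t.toLinearMap = T := by
  ext w
  constructor
  · rintro ⟨v, hv, rfl⟩
    exact (ht v (hT hv)).symm ▸ hv
  · exact fun hw => ⟨w, hw, ht w (hT hw)⟩

theorem map_span_singleton_equiv (t : V ≃ₗ[F] V) (v : V) :
    (Submodule.span F {v}).map t.toLinearMap = Submodule.span F {t v} := by
  rw [Submodule.map_span, Set.image_singleton]
  rfl

namespace BBPoint

theorem exists_carrier_eq_map (hS : ∀ T ∈ S, T ≤ H) {t : V ≃ₗ[F] V} (ht : ∀ v ∈ H, t v = v)
    (X : BBPoint H S) : ∃ Y : BBPoint H S, Y.carrier = X.carrier.map t.toLinearMap := by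
  cases X with
  | affine P hP =>
    induction P using Projectivization.ind with
    | h v hv =>
      have htv : t v ≠ 0 := fun h => hv ((LinearEquiv.map_eq_zero_iff t).1 h)
      refine ⟨.affine (Projectivization.mk F (t v) htv) fun h => hP ?_, ?_⟩
      · have h1 := (Projectivization.mem_pointsOf_iff
          (Projectivization.mem_submodule_mk _ htv) htv).1 h
        have h2 := t.injective (ht _ h1)
        exact (Projectivization.mem_pointsOf_iff (Projectivization.mem_submodule_mk v hv) hv).2
          (h2 ▸ h1)
      · change (Projectivization.mk F (t v) htv).submodule =
          (Projectivization.mk F v hv).submodule.map t.toLinearMap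
        rw [Projectivization.submodule_mk, Projectivization.submodule_mk, map_span_singleton_equiv]
  | infinite T hT => exact ⟨.infinite T hT, (map_eq_of_le_of_fixed ht (hS T hT)).symm⟩

end BBPoint

theorem BBLine.exists_carrier_eq_map (hS : ∀ T ∈ S, T ≤ H) {t : V ≃ₗ[F] V}
    (ht : ∀ v ∈ H, t v = v) (l : BBLine H S) :
    ∃ m : BBLine H S, m.carrier = l.carrier.map t.toLinearMap := by
  cases l with
  | affine M hM =>
    obtain ⟨T, hT, P, hP, rfl⟩ := hM
    obtain ⟨Y, hY⟩ := BBPoint.exists_carrier_eq_map hS ht (.affine P hP)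
    cases Y with
    | affine P' hP' =>
      refine ⟨.affine _ ⟨T, hT, P', hP', rfl⟩, ?_⟩
      change T ⊔ P'.submodule = (T ⊔ P.submodule).map t.toLinearMap
      rw [Submodule.map_sup, map_eq_of_le_of_fixed ht (hS T hT)]
      exact congrArg (T ⊔ ·) hY
    | infinite T' hT' =>
      refine (hP fun v hv => ?_).elim
      have h1 : t v ∈ T' := by
        change t v ∈ BBPoint.carrier (.infinite T' hT' : BBPoint H S)
        rw [hY]
        exact ⟨v, hv, rfl⟩
      have h2 := t.injective (ht _ (hS T' hT' h1))
      exact h2 ▸ hS T' hT' h1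
  | atInfinity => exact ⟨.atInfinity, (map_eq_of_le_of_fixed ht le_rfl).symm⟩

/-- A linear automorphism that fixes all vectors of `H` induces a collineation. -/
theorem exists_collineation (hS : ∀ T ∈ S, T ≤ H) {t : V ≃ₗ[F] V} (ht : ∀ v ∈ H, t v = v) :
    ∃ g : Incidence.Collineation (BBPoint H S) (BBLine H S),
      (∀ X, (g.onPoints X).carrier = X.carrier.map t.toLinearMap) ∧
      ∀ l, (g.onLines l).carrier = l.carrier.map t.toLinearMap := by
  have ht' : ∀ v ∈ H, t.symm v = v := fun v hv => by rw [LinearEquiv.symm_apply_eq, ht v hv]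
  have hinj : Function.Injective (Submodule.map t.toLinearMap) :=
    Submodule.map_injective_of_injective t.injective
  have hsymm : ∀ M : Submodule F V, (M.map t.symm.toLinearMap).map t.toLinearMap = M := fun M => by
    rw [← Submodule.map_comp]
    simp
  choose g hg using BBPoint.exists_carrier_eq_map hS ht
  choose m hm using BBLine.exists_carrier_eq_map hS ht
  have hgbij : Function.Bijective g := by
    refine ⟨fun X Y h => BBPoint.carrier_injective hS (hinj (by rw [← hg, ← hg, h])), fun X => ?_⟩
    obtain ⟨Y, hY⟩ := BBPoint.exists_carrier_eq_map hS ht' X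
    exact ⟨Y, BBPoint.carrier_injective hS (by rw [hg, hY, hsymm])⟩
  have hmbij : Function.Bijective m := by
    refine ⟨fun X Y h => BBLine.carrier_injective (hinj (by rw [← hm, ← hm, h])), fun X => ?_⟩
    obtain ⟨Y, hY⟩ := BBLine.exists_carrier_eq_map hS ht' X
    exact ⟨Y, BBLine.carrier_injective (by rw [hm, hY, hsymm])⟩
  refine ⟨⟨Equiv.ofBijective g hgbij, Equiv.ofBijective m hmbij, fun X l => ?_⟩, hg, hm⟩
  rw [BBLine.mem_iff hS, BBLine.mem_iff hS, Equiv.ofBijective_apply, Equiv.ofBijective_apply,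
    hg, hm, Submodule.map_le_map_iff_of_injective t.injective]

/-- The translation `v ↦ v + f(v) u`. -/
def translationEquiv (f : V →ₗ[F] F) {u : V} (hu : f u = 0) : V ≃ₗ[F] V :=
  LinearEquiv.ofLinearMap (LinearMap.id + f.smulRight u) (LinearMap.id - f.smulRight u)
    (by ext v; simp [hu]) (by ext v; simp [hu])

theorem translationEquiv_apply (f : V →ₗ[F] F) {u : V} (hu : f u = 0) (v : V) :
    translationEquiv f hu v = v + f v • u := rfl

theorem map_translationEquiv {f : V →ₗ[F] F} {u : V} (hu : f u = 0) {M : Submodule F V}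
    (hM : u ∈ M) : M.map (translationEquiv f hu).toLinearMap = M := by
  ext w
  constructor
  · rintro ⟨v, hv, rfl⟩
    exact M.add_mem hv (M.smul_mem _ hM)
  · intro hw
    refine ⟨w - f w • u, M.sub_mem hw (M.smul_mem _ hM), ?_⟩
    change translationEquiv f hu _ = w
    rw [translationEquiv_apply]
    simp [hu]

theorem mem_of_mem_sup_of_mem {T : Submodule F V} (hT : T ≤ H) {P : ℙ F V} (hP : P ∉ pointsOf H)
    {v : V} (hv : v ∈ T ⊔ P.submodule) (hvH : v ∈ H) : v ∈ T := by
  obtain ⟨t, ht, s, hs, rfl⟩ := Submodule.mem_sup.1 hv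
  have hsH : s ∈ H := (H.add_mem_iff_right (hT ht)).1 hvH
  by_cases hs0 : s = 0
  · rwa [hs0, add_zero]
  · exact (hP ((Projectivization.mem_pointsOf_iff hs hs0).2 hsH)).elim

variable {K : Type*} [Field K] [Algebra F K] {f : V →ₗ[F] F} {ψ : V →ₗ[F] (Fin 3 → K)}
  {U : AddSubgroup V} {A : Set V} {Q : Set (ℙ F V)} {T₀ T₁ : Submodule F V}

theorem carrier_image_bbSet (hQH : ∀ P ∈ Q, P ∉ pointsOf H) (h0 : T₀ ∈ S) (h1 : T₁ ∈ S) :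
    BBPoint.carrier '' bbSet H S Q T₀ T₁ = Projectivization.submodule '' Q ∪ {T₀, T₁} := by
  ext W
  constructor
  · rintro ⟨_, ⟨P, hP, rfl, hPQ⟩ | ⟨T, hT, rfl, hTT⟩, rfl⟩
    · exact Or.inl ⟨P, hPQ, rfl⟩
    · exact Or.inr hTT
  · rintro (⟨P, hPQ, rfl⟩ | rfl | rfl)
    · exact ⟨_, Or.inl ⟨P, hQH P hPQ, rfl, hPQ⟩, rfl⟩
    · exact ⟨_, Or.inr ⟨_, h0, rfl, Or.inl rfl⟩, rfl⟩
    · exact ⟨_, Or.inr ⟨_, h1, rfl, Or.inr rfl⟩, rfl⟩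

theorem ncard_bbSet [Finite V] (hS : ∀ T ∈ S, T ≤ H) (hQH : ∀ P ∈ Q, P ∉ pointsOf H)
    (h0 : T₀ ∈ S) (h1 : T₁ ∈ S) (h01 : T₀ ≠ T₁) :
    (bbSet H S Q T₀ T₁).ncard = Q.ncard + 2 := by
  have hfin : Finite (ℙ F V) := inferInstance
  rw [← Set.ncard_image_of_injective _ (BBPoint.carrier_injective hS),
    carrier_image_bbSet hQH h0 h1, Set.ncard_union_eq ?_ (Set.toFinite _) (Set.toFinite _),
    Set.ncard_image_of_injective _ Projectivization.submodule_injective, Set.ncard_pair h01]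
  rw [Set.disjoint_left]
  rintro _ ⟨P, hP, rfl⟩ (h | h)
  · exact hQH P hP (show P.submodule ≤ H from h ▸ hS T₀ h0)
  · exact hQH P hP (show P.submodule ≤ H from h ▸ hS T₁ h1)

theorem ncard_bbSet_atInfinity (hS : ∀ T ∈ S, T ≤ H)
    (h0 : T₀ ∈ S) (h1 : T₁ ∈ S) (h01 : T₀ ≠ T₁) :
    {p ∈ bbSet H S Q T₀ T₁ | p ∈ (BBLine.atInfinity : BBLine H S)}.ncard = 2 := by
  rw [← Set.ncard_image_of_injective _ (BBPoint.carrier_injective hS), ← Set.ncard_pair h01]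
  congr 1
  ext W
  constructor
  · rintro ⟨_, ⟨⟨P, hP, rfl, hPQ⟩ | ⟨T, hT, rfl, hTT⟩, hinf⟩, rfl⟩
    · exact hinf.elim
    · exact hTT
  · rintro (rfl | rfl)
    · exact ⟨_, ⟨Or.inr ⟨_, h0, rfl, Or.inl rfl⟩, trivial⟩, rfl⟩
    · exact ⟨_, ⟨Or.inr ⟨_, h1, rfl, Or.inr rfl⟩, trivial⟩, rfl⟩

/-- `Q` consists of the points `⟨a⟩` with `a` in the coset `A` of `U` in the affine space `f = 1`. -/
structure IsAffineCoset (f : V →ₗ[F] F) (U : AddSubgroup V) (A : Set V) (Q : Set (ℙ F V)) :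
    Prop where
  apply_eq_one : ∀ a ∈ A, f a = 1
  mem_iff_sub_mem : ∀ a ∈ A, ∀ x, x ∈ A ↔ x - a ∈ U
  mem_iff : ∀ P, P ∈ Q ↔ ∃ a ∈ A, a ∈ P.submodule

namespace IsAffineCoset

theorem exists_span (hQ : IsAffineCoset f U A Q) {P : ℙ F V} (hP : P ∈ Q) :
    ∃ a ∈ A, P.submodule = Submodule.span F {a} := by
  obtain ⟨a, ha, haP⟩ := (hQ.mem_iff P).1 hP
  refine ⟨a, ha, P.submodule_eq_span haP fun h => ?_⟩
  have h1 := hQ.apply_eq_one a ha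
  rw [h, map_zero] at h1
  exact zero_ne_one h1

/-- Two affine points on a line through T differ by a nonzero element of U ∩ T. There is none if T
is T₀ or T₁, as these avoid D. Otherwise T has a single point in D, scatteredness leaves one such
element, and a third affine point would repeat it. -/
theorem isArc (hQ : IsAffineCoset f U A Q) (hS : ∀ T ∈ S, T ≤ H)
    (hS' : ∀ T ∈ S, ∀ T' ∈ S, T ≤ T' → T = T')
    (hU : U ≤ H.toAddSubgroup) (hsc : ScatteredSubgroup F U) {D : Set (ℙ F V)}
    (hD : ∀ R : ℙ F V, R ∈ D ↔ ∃ u ∈ U, u ≠ 0 ∧ u ∈ R.submodule)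
    (hd0 : Disjoint (pointsOf T₀) D) (hd1 : Disjoint (pointsOf T₁) D)
    (hex : ∀ T ∈ S, T ≠ T₀ → T ≠ T₁ → ∃! P : ℙ F V, P ∈ D ∧ P ∈ pointsOf T) :
    Incidence.IsArc (BBLine H S) (bbSet H S Q T₀ T₁) := by
  have hcases : ∀ X ∈ bbSet H S Q T₀ T₁, (∃ a ∈ A, X.carrier = Submodule.span F {a}) ∨
      (X.carrier ∈ S ∧ (X.carrier = T₀ ∨ X.carrier = T₁)) := by
    rintro _ (⟨P, hP, rfl, hPQ⟩ | ⟨T, hT, rfl, hTT⟩)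
    · exact Or.inl (hQ.exists_span hPQ)
    · exact Or.inr ⟨hT, hTT⟩
  have hpoint : ∀ {u : V} {T : Submodule F V} (hu : u ∈ U) (hu0 : u ≠ 0) (huT : u ∈ T),
      Projectivization.mk F u hu0 ∈ D ∧ Projectivization.mk F u hu0 ∈ pointsOf T :=
    fun hu hu0 huT => ⟨(hD _).2 ⟨_, hu, hu0, Projectivization.mem_submodule_mk _ hu0⟩,
      (Projectivization.mem_pointsOf_iff (Projectivization.mem_submodule_mk _ hu0) hu0).2 huT⟩
  intro X hX Y hY Z hZ hXY hXZ hYZ l hl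
  have hinj := BBPoint.carrier_injective hS
  rw [← hinj.ne_iff] at hXY hXZ hYZ
  simp only [BBLine.mem_iff hS] at hl
  obtain ⟨hlX, hlY, hlZ⟩ := hl
  cases l with
  | atInfinity =>
    have hno : ∀ W ∈ bbSet H S Q T₀ T₁, W.carrier ≤ H → W.carrier = T₀ ∨ W.carrier = T₁ := by
      rintro _ (⟨P, hP, rfl, hPQ⟩ | ⟨T, hT, rfl, hTT⟩) hW
      · exact (hP hW).elim
      · exact hTT
    rcases hno X hX hlX with h1 | h1 <;> rcases hno Y hY hlY with h2 | h2 <;>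
      rcases hno Z hZ hlZ with h3 | h3 <;>
      first
      | exact hXY (h1.trans h2.symm)
      | exact hXZ (h1.trans h3.symm)
      | exact hYZ (h2.trans h3.symm)
  | affine M hM =>
    obtain ⟨T, hT, P, hP, rfl⟩ := hM
    change _ ≤ T ⊔ P.submodule at hlX hlY hlZ
    have hinf : ∀ W ∈ S, W ≤ T ⊔ P.submodule → W = T := fun W hW hWT =>
      hS' W hW T hT fun v hv => mem_of_mem_sup_of_mem (hS T hT) hP (hWT hv) (hS W hW hv)
    have haff : ∀ {a b : V}, a ∈ A → b ∈ A → Submodule.span F {a} ≤ T ⊔ P.submodule →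
        Submodule.span F {b} ≤ T ⊔ P.submodule → a - b ∈ U ∧ a - b ∈ T := by
      intro a b ha hb haM hbM
      have h1 := (hQ.mem_iff_sub_mem b hb a).1 ha
      exact ⟨h1, mem_of_mem_sup_of_mem (hS T hT) hP (Submodule.sub_mem _
        (haM (Submodule.mem_span_singleton_self a)) (hbM (Submodule.mem_span_singleton_self b)))
        (hU h1)⟩
    have hne : ∀ {a b : V}, Submodule.span F {a} ≠ Submodule.span F {b} → a - b ≠ 0 :=
      fun h h' => h (by rw [sub_eq_zero.1 h'])
    have hnot : ∀ {a b : V}, a ∈ A → b ∈ A → Submodule.span F {a} ≤ T ⊔ P.submodule →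
        Submodule.span F {b} ≤ T ⊔ P.submodule → Submodule.span F {a} ≠ Submodule.span F {b} →
        T ≠ T₀ ∧ T ≠ T₁ := by
      intro a b ha hb haM hbM hab
      obtain ⟨h1, h2⟩ := haff ha hb haM hbM
      obtain ⟨h3, h4⟩ := hpoint h1 (hne hab) h2
      constructor
      · rintro rfl
        exact Set.disjoint_left.1 hd0 h4 h3
      · rintro rfl
        exact Set.disjoint_left.1 hd1 h4 h3
    have htwo : ∀ {a b : V} {W : Submodule F V}, a ∈ A → b ∈ A →
        Submodule.span F {a} ≤ T ⊔ P.submodule → Submodule.span F {b} ≤ T ⊔ P.submodule →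
        Submodule.span F {a} ≠ Submodule.span F {b} → W ∈ S → (W = T₀ ∨ W = T₁) →
        W ≤ T ⊔ P.submodule → False := by
      intro a b W ha hb haM hbM hab hW hW' hWM
      obtain ⟨h1, h2⟩ := hnot ha hb haM hbM hab
      rw [hinf W hW hWM] at hW'
      exact hW'.elim h1 h2
    rcases hcases X hX with ⟨a, ha, h1⟩ | ⟨h1, h1'⟩ <;>
      rcases hcases Y hY with ⟨b, hb, h2⟩ | ⟨h2, h2'⟩ <;>
      rcases hcases Z hZ with ⟨c, hc, h3⟩ | ⟨h3, h3'⟩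
    · rw [h1, h2] at hXY
      rw [h1, h3] at hXZ
      rw [h2, h3] at hYZ
      rw [h1] at hlX
      rw [h2] at hlY
      rw [h3] at hlZ
      obtain ⟨h4, h5⟩ := hnot ha hb hlX hlY hXY
      obtain ⟨R, -, hR⟩ := hex T hT h4 h5
      obtain ⟨hu, huT⟩ := haff ha hb hlX hlY
      obtain ⟨hw, hwT⟩ := haff ha hc hlX hlZ
      have h6 := (hR _ (hpoint hu (hne hXY) huT)).trans (hR _ (hpoint hw (hne hXZ) hwT)).symm
      obtain ⟨d, hd⟩ := (Projectivization.mk_eq_mk_iff' F _ _ _ _).1 h6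
      rcases hsc _ hw (hne hXZ) d (hd ▸ hu) with rfl | rfl
      · exact hne hXY (by rw [← hd, zero_smul])
      · rw [one_smul] at hd
        exact hne hYZ (by rw [← sub_sub_sub_cancel_left, hd, sub_self])
    · rw [h1, h2] at hXY
      exact htwo ha hb (h1 ▸ hlX) (h2 ▸ hlY) hXY h3 h3' hlZ
    · rw [h1, h3] at hXZ
      exact htwo ha hc (h1 ▸ hlX) (h3 ▸ hlZ) hXZ h2 h2' hlY
    · exact hYZ ((hinf _ h2 hlY).trans (hinf _ h3 hlZ).symm)
    · rw [h2, h3] at hYZ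
      exact htwo hb hc (h2 ▸ hlY) (h3 ▸ hlZ) hYZ h1 h1' hlX
    · exact hXZ ((hinf _ h1 hlX).trans (hinf _ h3 hlZ).symm)
    · exact hXY ((hinf _ h1 hlX).trans (hinf _ h2 hlY).symm)
    · exact hXY ((hinf _ h1 hlX).trans (hinf _ h2 hlY).symm)

/-- The translation v ↦ v + f(v)(b - a) fixes H vectorwise and moves A by an element of U, so it
preserves the coset A. Its centre is a spread element through b - a. -/
theorem exists_elation (hQ : IsAffineCoset f U A Q) (hS : ∀ T ∈ S, T ≤ H)
    (hf : ∀ v, f v = 0 ↔ v ∈ H) (hU : U ≤ H.toAddSubgroup)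
    (hex : ∀ u ∈ H, u ≠ 0 → ∃ T ∈ S, u ∈ T) (h0 : T₀ ∈ S)
    {x y : BBPoint H S} (hx : x ∈ bbSet H S Q T₀ T₁)
    (hx' : x ∉ (BBLine.atInfinity : BBLine H S)) (hy : y ∈ bbSet H S Q T₀ T₁)
    (hy' : y ∉ (BBLine.atInfinity : BBLine H S)) :
    ∃ g : Incidence.Collineation (BBPoint H S) (BBLine H S),
      g.IsElation (BBLine.atInfinity : BBLine H S) ∧
      g.onPoints '' bbSet H S Q T₀ T₁ = bbSet H S Q T₀ T₁ ∧ g.onPoints x = y := by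
  have hinj := BBPoint.carrier_injective hS
  have haff : ∀ X ∈ bbSet H S Q T₀ T₁, X ∉ (BBLine.atInfinity : BBLine H S) →
      ∃ a ∈ A, X.carrier = Submodule.span F {a} := by
    rintro _ (⟨P, hP, rfl, hPQ⟩ | ⟨T, hT, rfl, hTT⟩) hX
    · exact hQ.exists_span hPQ
    · exact (hX trivial).elim
  have hmem : ∀ a ∈ A, ∀ X : BBPoint H S, X.carrier = Submodule.span F {a} →
      X ∈ bbSet H S Q T₀ T₁ := by
    intro a ha X hX
    have haX : a ∈ X.carrier := hX ▸ Submodule.mem_span_singleton_self a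
    cases X with
    | affine P hP => exact Or.inl ⟨P, hP, rfl, (hQ.mem_iff P).2 ⟨a, ha, haX⟩⟩
    | infinite T hT =>
      have h2 := (hf a).2 (hS T hT haX)
      rw [hQ.apply_eq_one a ha] at h2
      exact (one_ne_zero h2).elim
  obtain ⟨a, ha, hxa⟩ := haff x hx hx'
  obtain ⟨b, hb, hyb⟩ := haff y hy hy'
  have hu : b - a ∈ U := (hQ.mem_iff_sub_mem a ha b).1 hb
  have hfu : f (b - a) = 0 := (hf _).2 (hU hu)
  have htA : ∀ c ∈ A, translationEquiv f hfu c = c + (b - a) := fun c hc => by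
    rw [translationEquiv_apply, hQ.apply_eq_one c hc, one_smul]
  have ht : ∀ v ∈ H, translationEquiv f hfu v = v := fun v hv => by
    rw [translationEquiv_apply, (hf v).2 hv, zero_smul, add_zero]
  obtain ⟨g, hg, hm⟩ := exists_collineation hS ht
  have hginf : ∀ T hT, g.onPoints (.infinite T hT) = .infinite T hT := fun T hT =>
    hinj (by rw [hg]; exact map_eq_of_le_of_fixed ht (hS T hT))
  refine ⟨g, ⟨?_, ?_⟩, ?_, ?_⟩
  · intro X hX
    cases X with
    | affine P hP => exact hX.elim
    | infinite T hT => exact hginf T hT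
  -- For b = a the map is the identity, and T₀ serves as a centre.
  · obtain ⟨T, hT, huT⟩ : ∃ T ∈ S, b - a ∈ T := by
      by_cases hu0 : b - a = 0
      · exact ⟨T₀, h0, hu0 ▸ T₀.zero_mem⟩
      · exact hex _ (hU hu) hu0
    refine ⟨.infinite T hT, trivial, fun l hl => BBLine.carrier_injective ?_⟩
    rw [hm]
    exact map_translationEquiv hfu ((BBLine.mem_iff hS _ _).1 hl huT)
  · ext X
    constructor
    · rintro ⟨_, ⟨P, hP, rfl, hPQ⟩ | ⟨T, hT, rfl, hTT⟩, rfl⟩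
      · obtain ⟨c, hc, hPc⟩ := hQ.exists_span hPQ
        refine hmem (c + (b - a)) ((hQ.mem_iff_sub_mem c hc _).2 (by simpa using hu)) _ ?_
        rw [hg, ← htA c hc, ← map_span_singleton_equiv, ← hPc]
        rfl
      · rw [hginf]
        exact Or.inr ⟨T, hT, rfl, hTT⟩
    · rintro (⟨P, hP, rfl, hPQ⟩ | ⟨T, hT, rfl, hTT⟩)
      · obtain ⟨c, hc, hPc⟩ := hQ.exists_span hPQ
        have hc' : c - (b - a) ∈ A := (hQ.mem_iff_sub_mem c hc _).2 (by
          rw [sub_sub_cancel_left]; exact U.neg_mem hu)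
        refine ⟨g.onPoints.symm (.affine P hP), hmem _ hc' _ ?_, Equiv.apply_symm_apply _ _⟩
        apply Submodule.map_injective_of_injective (translationEquiv f hfu).injective
        rw [← hg, Equiv.apply_symm_apply, map_span_singleton_equiv, htA _ hc', sub_add_cancel]
        exact hPc
      · exact ⟨.infinite T hT, Or.inr ⟨T, hT, rfl, hTT⟩, hginf T hT⟩
  · apply hinj
    rw [hg, hxa, map_span_singleton_equiv, htA a ha, add_sub_cancel, hyb]

end IsAffineCoset

end Translations

/-! ### Affine representatives and the main theorem -/

section Main

variable {F : Type u} [Field F] {V : Type v} [AddCommGroup V] [Module F V]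
  {H : Submodule F V}

theorem exists_functional_of_finrank_eq [FiniteDimensional F V]
    (hH : finrank F V = finrank F H + 1) :
    ∃ f : V →ₗ[F] F, (∀ v, f v = 0 ↔ v ∈ H) ∧ ∃ e₀, f e₀ = 1 := by
  have h1 := H.finrank_quotient_add_finrank
  have h2 : finrank F (V ⧸ H) = finrank F F := by rw [finrank_self]; omega
  let e := LinearEquiv.ofFinrankEq (V ⧸ H) F h2
  refine ⟨e.toLinearMap ∘ₗ H.mkQ, fun v => ?_, ?_⟩
  · simp
  · obtain ⟨v, hv⟩ := H.mkQ_surjective (e.symm 1)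
    exact ⟨v, by simp [hv]⟩

/-- The representatives in the affine space `f = 1` of the points of `Q`. -/
def affineRepresentatives (f : V →ₗ[F] F) (Q : Set (ℙ F V)) : Set V :=
  {v | f v = 1 ∧ ∃ P ∈ Q, v ∈ P.submodule}

variable {f : V →ₗ[F] F} {Q : Set (ℙ F V)}

theorem exists_mem_affineRepresentatives (hf : ∀ v, f v = 0 ↔ v ∈ H)
    (hQ : ∀ P ∈ Q, P ∉ pointsOf H) {P : ℙ F V} (hP : P ∈ Q) :
    ∃ a ∈ affineRepresentatives f Q, a ∈ P.submodule := by
  induction P using Projectivization.ind with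
  | h v hv =>
    have hmem := Projectivization.mem_submodule_mk (F := F) v hv
    have hfv : f v ≠ 0 := fun h => hQ _ hP
      ((Projectivization.mem_pointsOf_iff hmem hv).2 ((hf v).1 h))
    refine ⟨(f v)⁻¹ • v, ⟨?_, _, hP, Submodule.smul_mem _ _ hmem⟩, Submodule.smul_mem _ _ hmem⟩
    rw [map_smul, smul_eq_mul, inv_mul_cancel₀ hfv]

theorem ne_zero_of_apply_eq_one {a : V} (ha : f a = 1) : a ≠ 0 := by
  rintro rfl
  rw [map_zero] at ha
  exact zero_ne_one ha

theorem eq_of_apply_eq_one {P : ℙ F V} {a b : V} (ha : a ∈ P.submodule) (hb : b ∈ P.submodule)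
    (ha1 : f a = 1) (hb1 : f b = 1) : a = b := by
  rw [P.submodule_eq_span ha (ne_zero_of_apply_eq_one ha1)] at hb
  obtain ⟨c, rfl⟩ := Submodule.mem_span_singleton.1 hb
  rw [map_smul, ha1, smul_eq_mul, mul_one] at hb1
  rw [hb1, one_smul]

theorem ncard_affineRepresentatives [Finite V] (hf : ∀ v, f v = 0 ↔ v ∈ H)
    (hQ : ∀ P ∈ Q, P ∉ pointsOf H) : (affineRepresentatives f Q).ncard = Q.ncard := by
  refine (Set.ncard_congr (fun P hP => (exists_mem_affineRepresentatives hf hQ hP).choose)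
    (fun P hP => (exists_mem_affineRepresentatives hf hQ hP).choose_spec.1) ?_ ?_).symm
  · intro P R hP hR h
    have h1 := (exists_mem_affineRepresentatives hf hQ hP).choose_spec
    have h2 := (exists_mem_affineRepresentatives hf hQ hR).choose_spec
    rw [← h] at h2
    exact Projectivization.eq_of_mem_of_mem h1.2 h2.2 (ne_zero_of_apply_eq_one h1.1.1)
  · rintro a ⟨ha, P, hP, haP⟩
    have h1 := (exists_mem_affineRepresentatives hf hQ hP).choose_spec
    exact ⟨P, hP, eq_of_apply_eq_one h1.2 haP h1.1.1 ha⟩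

/-- As f takes the value 1 at a and b, a combination c a + d b lies in H only if c + d = 0, that is,
if it is a multiple of a - b. -/
theorem mem_directions_iff (hf : ∀ v, f v = 0 ↔ v ∈ H) (hQ : ∀ P ∈ Q, P ∉ pointsOf H)
    (R : ℙ F V) : R ∈ directions H Q ↔ ∃ a ∈ affineRepresentatives f Q,
      ∃ b ∈ affineRepresentatives f Q, a ≠ b ∧ a - b ∈ R.submodule := by
  constructor
  · rintro ⟨hRH, P₁, h1, P₂, h2, h12, hR⟩
    obtain ⟨a, ha, haP⟩ := exists_mem_affineRepresentatives hf hQ h1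
    obtain ⟨b, hb, hbP⟩ := exists_mem_affineRepresentatives hf hQ h2
    have ha0 := ne_zero_of_apply_eq_one ha.1
    have hab : a ≠ b := by
      rintro rfl
      exact h12 (Projectivization.eq_of_mem_of_mem haP hbP ha0)
    refine ⟨a, ha, b, hb, hab, ?_⟩
    have hr := hR R.rep_mem_submodule
    rw [P₁.submodule_eq_span haP ha0,
      P₂.submodule_eq_span hbP (ne_zero_of_apply_eq_one hb.1), ← Submodule.span_insert] at hr
    obtain ⟨c, d, hcd⟩ := Submodule.mem_span_pair.1 hr
    have h3 := (hf _).2 (hRH R.rep_mem_submodule)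
    rw [← hcd, map_add, map_smul, map_smul, ha.1, hb.1, smul_eq_mul, mul_one, smul_eq_mul,
      mul_one] at h3
    have h4 : c • (a - b) = R.rep := by
      rw [← hcd, eq_neg_of_add_eq_zero_right h3, smul_sub, neg_smul, sub_eq_add_neg]
    have hc : c ≠ 0 := by
      rintro rfl
      rw [zero_smul] at h4
      exact R.rep_nonzero h4.symm
    exact (R.submodule.smul_mem_iff hc).1 (h4 ▸ R.rep_mem_submodule)
  · rintro ⟨a, ⟨ha, P₁, h1, haP⟩, b, ⟨hb, P₂, h2, hbP⟩, hab, habR⟩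
    have h0 := sub_ne_zero.2 hab
    refine ⟨(Projectivization.mem_pointsOf_iff habR h0).2 ((hf _).1 ?_), P₁, h1, P₂, h2, ?_,
      (Projectivization.mem_pointsOf_iff habR h0).2 (Submodule.sub_mem _
        ((le_sup_left : P₁.submodule ≤ _) haP) ((le_sup_right : P₂.submodule ≤ _) hbP))⟩
    · rw [map_sub, ha, hb, sub_self]
    · rintro rfl
      exact hab (eq_of_apply_eq_one haP hbP ha hb)

theorem isAffineCoset_affineRepresentatives (hf : ∀ v, f v = 0 ↔ v ∈ H)
    (hQ : ∀ P ∈ Q, P ∉ pointsOf H) {U : AddSubgroup V} {a : V}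
    (hU : ∀ x, x ∈ affineRepresentatives f Q ↔ x - a ∈ U) :
    IsAffineCoset f U (affineRepresentatives f Q) Q where
  apply_eq_one _ h := h.1
  mem_iff_sub_mem b hb x := by
    rw [hU, ← sub_add_sub_cancel x b a, U.add_mem_cancel_right ((hU b).1 hb)]
  mem_iff P := by
    refine ⟨fun hP => exists_mem_affineRepresentatives hf hQ hP, ?_⟩
    rintro ⟨b, ⟨hb, R, hR, hbR⟩, hbP⟩
    rwa [Projectivization.eq_of_mem_of_mem hbP hbR (ne_zero_of_apply_eq_one hb)]

theorem IsSuitableSpread.symm {k : ℕ} {D : Set (ℙ F V)} {T₀ T₁ : Submodule F V}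
    {S : Set (Submodule F V)} (h : IsSuitableSpread k H D T₀ T₁ S) :
    IsSuitableSpread k H D T₁ T₀ S :=
  ⟨h.1, h.2.2.1, h.2.1, fun T hT h1 h0 => h.2.2.2 T hT h0 h1⟩

end Main

theorem mainTheorem7 {F : Type u} [Field F] {V : Type v} [AddCommGroup V] [Module F V]
    (h k : ℕ) (hh : 4 ≤ h) (hk : 2 ≤ k) (q : ℕ) (hq : q = 2 ^ h) (hF : Nat.card F = q)
    (hV : finrank F V = 2 * k + 1)
    (H : Submodule F V) (hH : finrank F H = 2 * k)
    (Q : Set (ℙ F V)) (hQ_affine : ∀ P ∈ Q, P ∉ pointsOf H) (hQ_card : Q.ncard = q ^ k)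
    (hD_card : (directions H Q).ncard = q ^ k - 1)
    (hD_lines : ∀ s : Submodule F V, finrank F s = 2 →
      (directions H Q ∩ pointsOf s).ncard ∈ ({0, 1, 3, q - 1} : Set ℕ)) :
    (∃ T₀ T₁ : Submodule F V,
      IsPseudoregulusTypeWith (⊥ : Subfield F) k H (directions H Q) T₀ T₁) ∧
    ∀ T₀ T₁ : Submodule F V,
      IsPseudoregulusTypeWith (⊥ : Subfield F) k H (directions H Q) T₀ T₁ →
      (∃ S : Set (Submodule F V), IsSuitableSpread k H (directions H Q) T₀ T₁ S) ∧
      ∀ S : Set (Submodule F V), IsSuitableSpread k H (directions H Q) T₀ T₁ S →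
        (∃ (K : Type u) (_ : Field K), Nat.card K = q ^ k ∧
          Nonempty (Incidence.Iso (BBPoint H S) (BBLine H S)
            (ℙ K (Fin 3 → K)) (PlaneLine K))) ∧
        Incidence.IsTranslationHyperoval (q ^ k) (bbSet H S Q T₀ T₁)
          (BBLine.atInfinity : BBLine H S) := by
  have hq16 : 16 ≤ q := by
    rw [hq]
    exact le_trans (by norm_num : 16 ≤ 2 ^ 4) (Nat.pow_le_pow_right (by norm_num) hh)
  have hfinF : Finite F := Nat.finite_of_card_ne_zero (by omega)
  have hfd : FiniteDimensional F V := .of_finrank_pos (by omega)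
  have hfinV : Finite V := Module.finite_of_finite F
  have hchar : CharP F 2 := by
    cases nonempty_fintype F
    exact charP_of_card_eq_prime_pow (f := h) (by rw [← Nat.card_eq_fintype_card, hF, hq])
  obtain ⟨f, hf, e₀, he₀⟩ := exists_functional_of_finrank_eq (H := H) (by omega)
  have hspecial : HasSpecialDirections k (affineRepresentatives f Q) (directions H Q) :=
    { card_field := hF ▸ hq16
      two_eq_zero := CharTwo.two_eq_zero
      two_le := hk
      ncard_eq := by rw [ncard_affineRepresentatives hf hQ_affine, hQ_card, hF]
      mem_iff := mem_directions_iff hf hQ_affine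
      ncard_directions := by rw [hD_card, hF]
      ncard_line := by rw [hF]; exact hD_lines }
  obtain ⟨a, ha⟩ := Set.nonempty_of_ncard_ne_zero (s := affineRepresentatives f Q) (by
    rw [ncard_affineRepresentatives hf hQ_affine, hQ_card]
    exact pow_ne_zero _ (by omega))
  obtain ⟨U, hU, hUA, hUD, hcard⟩ :=
    hspecial.exists_isSpecialSubgroup hH (fun R hR => hR.1) ha
  obtain ⟨σ, Φ, hΦ1, hΦ2, hΦ3⟩ := hU.exists_normal_form
  have hΦ : IsNormalForm H U σ Φ := ⟨hΦ1, hΦ2, hΦ3⟩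
  have hcoset := isAffineCoset_affineRepresentatives hf hQ_affine hUA
  refine ⟨⟨_, _, hΦ.isPseudoregulusTypeWith hU hUD hcard⟩, fun T₀ T₁ hT => ⟨?_, fun S hS => ?_⟩⟩
  · obtain ⟨S, hS⟩ := hΦ.exists_isSuitableSpread (hF.trans hq) (by omega) (by omega)
      (fun c hc => IsNormalForm.fixed_eq hU hΦ hc) hUD
    -- The transversal spaces are determined up to their order, and suitability of a spread is
    -- symmetric in them.
    rcases IsNormalForm.eq_or_eq_of_isPseudoregulusTypeWith hU hΦ hUD hcard hT with
      ⟨rfl, rfl⟩ | ⟨rfl, rfl⟩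
    · exact ⟨S, hS⟩
    · exact ⟨S, hS.symm⟩
  -- Nothing about the spread constructed for (a) enters here; only the suitability of S is used,
  -- with its own field K.
  · obtain ⟨⟨K, _, _, hK, e, heS⟩, h0, h1, hex⟩ := hS
    obtain ⟨ψ, hψ⟩ := exists_isBBEmbedding hf he₀ e heS
    have hSH : ∀ T ∈ S, T ≤ H := fun T hT => hψ.le_of_mem hT
    obtain ⟨-, R, -, h01, hRT⟩ := hT
    have hd0 : T₀ ∈ transversals k H (directions H Q) R := hRT ▸ Or.inl rfl
    have hd1 : T₁ ∈ transversals k H (directions H Q) R := hRT ▸ Or.inr rfl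
    refine ⟨⟨K, inferInstance, ?_, hψ.nonempty_iso⟩, ⟨?_, ?_⟩, ?_, ?_⟩
    · have : FiniteDimensional F K := .of_finrank_pos (by omega)
      rw [card_eq_card_pow_finrank (F := F) (W := K), hK, hF]
    · rw [ncard_bbSet hSH hQ_affine h0 h1 h01, hQ_card]
    · exact hcoset.isArc hSH (fun T hT T' hT' => hψ.eq_of_le hT hT') hU.le hU.scattered hUD
        hd0.2.2.1 hd1.2.2.1 hex
    · exact ncard_bbSet_atInfinity hSH h0 h1 h01
    · intro x hx hx' y hy hy'
      exact hcoset.exists_elation hSH hf hU.le (fun u hu hu0 => hψ.exists_mem hu hu0) h0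
        hx hx' hy hy'
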